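/- All logarithms are binary and all Hilbert spaces are finite-dimensional. Write $\|M\|=\mathrm{tr}\sqrt{M^\dagger M}$. For a nonnegative operator $\rho_{AB}$ let $$H_{\min}(A|B)_\rho=-\log\min_{\sigma_B}\min\{\lambda:\rho_{AB}\le\lambda\cdot \mathrm{id}_A\otimes\sigma_B\},$$ where $\sigma_B$ ranges over the nonnegative operators of trace one on $B$ (so that $H_{\min}(A|B)_0=+\infty$). For $\varepsilon\ge 0$ let $H_{\min}^{\varepsilon}(A|B)_\rho=\sup_{\bar\rho}H_{\min}(A|B)_{\bar\rho}\in(-\infty,+\infty]$, the supremum being over all nonnegative operators $\bar\rho_{AB}$ with $\mathrm{tr}\,\bar\rho_{AB}\le 1$ and $\|\bar\rho_{AB}-\rho_{AB}\|\le\varepsilon$, and let $R_{\min}^{\varepsilon}(A|B)_\rho=H_{\min}^{\varepsilon}(A|B)_\rho/\log\dim\mathcal H_A$ be the smooth min-entropy rate. An $(n,\xi,\varepsilon)$-averaging sampler is a random subset $\mathcal S\subset[n]=\{1,\dots,n\}$ of a fixed size $|\mathcal S|\ge 1$ such that $$\Pr_{\mathcal S}\Big[\tfrac1{|\mathcal S|}\sum_{i\in\mathcal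 S}\beta_i\le\tfrac1n\sum_{i=1}^n\beta_i-\xi\Big]\le\varepsilon\qquad\text{for all }(\beta_1,\dots,\beta_n)\in[0,1]^n .$$ **Statement.** Let $\mathcal X$ be a finite set with $|\mathcal X|\ge 2$, let $\rho_{X^nE}=\sum_{x\in\mathcal X^n}|x\rangle\langle x|\otimes\rho_E^x$ be a quantum state (nonnegative, of trace one) which is classical on $X^n=(X_1,\dots,X_n)$, and let $\mathcal S$ be an $(n,\xi,\varepsilon)$-averaging sampler, independent of $X^nE$. Let $X_{\mathcal S}=(X_i)_{i\in\mathcal S}$ (an element of $\mathcal X^{|\mathcal S|}$), so that the joint state of $X_{\mathcal S}$, $\mathcal S$ and $E$ is $$\rho_{X_{\mathcal S}\mathcal SE}=\sum_{S}\sum_{x\in\mathcal X^n}P_{\mathcal S}(S)\,|x_S\rangle\langle x_S|\otimes|S\rangle\langle S|\otimes\rho_E^x .$$ Assume that $$\kappa=\frac{n}{|\mathcal S|\log|\mathcal X|}\le 0.15 .$$ Then, for all $\tau\ge 0$, $$R_{\min}^{\varepsilon'+\tau}(X_{\mathcal S}|\mathcal S E)_\rho\ \ge\ R_{\min}^{\tau}(X^n|E)_\rho-3\xi-2\kappa\log\tfrac1\kappa,\qquad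 \varepsilon'=2\cdot2^{-\xi n\log|\mathcal X|}+3\varepsilon^{1/4}.$$ -/

import Mathlib

open scoped Kronecker MatrixOrder ComplexOrder

noncomputable section

namespace QSampling

/-- Nonnegative operators of trace one on `ℂ^B`. -/
structure IsDensity {B : Type*} [Fintype B] (σ : Matrix B B ℂ) : Prop where
  posSemidef : σ.PosSemidef
  trace_eq_one : σ.trace = 1

/-- The `L₁`-norm `‖M‖ = tr √(M† M)`; here `CFC.abs M` is `√(M† M)`. -/
def traceNorm {A : Type*} [Fintype A] [DecidableEq A] (M : Matrix A A ℂ) : ℝ :=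
  (CFC.abs M).trace.re

/-- The conditional min-entropy
`H_min(A|B)_ρ = - log₂ min_σ min {t : ρ ≤ t • (id_A ⊗ σ)}`, `σ` ranging over the density operators
on `B`, written as the supremum of all `h` with `ρ ≤ 2^(-h) • (id_A ⊗ σ)` for some `σ`.
It is `⊤` at `ρ = 0`. -/
def minEntropy {A B : Type*} [Fintype A] [DecidableEq A] [Fintype B] [DecidableEq B]
    (ρ : Matrix (A × B) (A × B) ℂ) : EReal :=
  ⨆ (σ : Matrix B B ℂ) (_ : IsDensity σ) (h : ℝ)
    (_ : ρ ≤ ((2 : ℝ) ^ (-h)) • ((1 : Matrix A A ℂ) ⊗ₖ σ)), (h : EReal)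

/-- The `ε`-smooth min-entropy: the supremum of `H_min(A|B)` over all nonnegative operators of trace
at most one (not only the classical ones) in the `L₁`-ball of radius `ε` around `ρ`. -/
def smoothMinEntropy {A B : Type*} [Fintype A] [DecidableEq A] [Fintype B] [DecidableEq B]
    (ε : ℝ) (ρ : Matrix (A × B) (A × B) ℂ) : EReal :=
  ⨆ (ρ' : Matrix (A × B) (A × B) ℂ)
    (_ : ρ'.PosSemidef ∧ ρ'.trace.re ≤ 1 ∧ traceNorm (ρ' - ρ) ≤ ε), minEntropy ρ'

/-- The smooth min-entropy rate `H_min^ε(A|B)_ρ / H₀(A)`, where `H₀(A) = log₂ |A|`. -/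
def smoothMinEntropyRate {A B : Type*} [Fintype A] [DecidableEq A] [Fintype B] [DecidableEq B]
    (ε : ℝ) (ρ : Matrix (A × B) (A × B) ℂ) : EReal :=
  smoothMinEntropy ε ρ / ((Real.logb 2 (Fintype.card A) : ℝ) : EReal)

/-- The operator `∑ₐ |a⟩⟨a| ⊗ ρᵃ` on `A B` which is classical on `A`. -/
def cqOperator {A B : Type*} [Fintype A] [DecidableEq A]
    (ρ : A → Matrix B B ℂ) : Matrix (A × B) (A × B) ℂ :=
  ∑ a, Matrix.single a a (1 : ℂ) ⊗ₖ ρ a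

/-- The subsets of `[n]` of size `r`. -/
abbrev Subsets (n r : ℕ) : Type := {S : Finset (Fin n) // S.card = r}

/-- An `(n, ξ, ε)`-averaging sampler: a probability distribution `P` over the subsets of `[n]` of a
fixed size `r` such that, for all `β ∈ [0,1]ⁿ`, the sample average is at most the average minus `ξ`
with probability at most `ε`. -/
structure IsSampler (n r : ℕ) (ξ ε : ℝ) (P : Subsets n r → ℝ) : Prop where
  mem_stdSimplex : P ∈ stdSimplex ℝ (Subsets n r)
  prob_le : ∀ β : Fin n → ℝ, (∀ i, β i ∈ Set.Icc (0 : ℝ) 1) →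
    ∑ S : Subsets n r with (∑ i ∈ S.1, β i) / r ≤ (∑ i, β i) / n - ξ, P S ≤ ε

/-- The substring `x_S = (x_{s₁}, …, x_{s_r})` for `S = {s₁ < … < s_r}`. -/
def substring {n r : ℕ} {X : Type*} (S : Subsets n r) (x : Fin n → X) : Fin r → X :=
  fun j => x (S.1.orderEmbOfFin S.2 j)

/-- The state `∑_{x,S} P(S) |x_S⟩⟨x_S| ⊗ |S⟩⟨S| ⊗ ρˣ` on `X_S (S E)`, obtained from
`∑ₓ |x⟩⟨x| ⊗ ρˣ` on `Xⁿ E` by choosing `S` according to `P`, independently of `Xⁿ E`, and by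
keeping only the substring `X_S` of `Xⁿ` together with `S` and `E`. -/
def sampledState {n r : ℕ} {X E : Type*} [Fintype X] [DecidableEq X]
    (P : Subsets n r → ℝ) (ρ : (Fin n → X) → Matrix E E ℂ) :
    Matrix ((Fin r → X) × (Subsets n r × E)) ((Fin r → X) × (Subsets n r × E)) ℂ :=
  cqOperator fun y : Fin r → X =>
    cqOperator fun S : Subsets n r => P S • ∑ x : Fin n → X with substring S x = y, ρ x

end QSampling

end

open scoped Kronecker MatrixOrder ComplexOrder

set_option linter.unusedSectionVars false

noncomputable section

/-! Classically, the surprisal of `x i` given the preceding symbols, capped at `log |X|` and divided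
by it, is a number in `[0,1]`. Min-entropy `h` forces these surprisals to sum to almost `h` except
on a set of small weight, so the sampler finds about the fraction `r / n` of this sum on `S`. Since
surprisals are logarithms of conditional probabilities, weighting each string by `2` to the
surprisal on `S` and summing over the unsampled symbols leaves a bounded quantity. Hence the typical
strings with a given substring have total probability about `2 ^ (-(r / n) h)`.

With quantum side information the conditional probabilities become operators. A projection `P` on
which the state is at most `c • P` is refined, symbol by symbol, by the binned spectra of the
compressed operators of the prefixes. The bin `v i` is the surprisal in units of `δ`, and the bin
string `v` does not depend on the sample, so the sampler property applies to `v i / m`.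
`exists_isSpectralTree` gives both estimates: bounded weighted sums on every sample, and small
weight of the strings `v` with small total.

A tree needs a starting space on which a dominating operator is nearly constant, hence a cut into
dyadic spectral bands. Their number is not bounded by the parameters, so pinching to all bands would
cost too much. Instead (`exists_offset_pinch_le`) the bands are collected into blocks with a
suitably chosen offset: couplings across block boundaries are small on average over the offset, and
couplings of remote bands are exponentially small. Inside a block the pinching inequality costs only
the number of cells. Discarding atypical cells costs the square root of their weight. This gives
`exists_sampled_family`.

The total loss must be at most `K ^ (2 n)` with `K = 1 / κ` (`loss_factor_le`). This needs `n` not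
too small. When `n` is small, either no sampler of error below `1 / 81` exists, so that `ε' ≥ 1`, or
the entropy bound is already implied by positivity of the entropy or by counting the discarded
symbols (`le_smoothMinEntropy_sampledState_of_le`). -/

namespace QSampling

/-! ### Traces, the positive semidefinite order and weighted Cauchy-Schwarz -/

section

open Matrix

variable {E : Type*} [Fintype E]

/-- The real part of the trace, as a real-linear functional. -/
def rtr : Matrix E E ℂ →ₗ[ℝ] ℝ :=
  Complex.reLm ∘ₗ (Matrix.traceLinearMap E ℝ ℂ)

theorem rtr_apply (M : Matrix E E ℂ) : rtr M = M.trace.re := rfl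

theorem rtr_mul_comm {F : Type*} [Fintype F] (A : Matrix E F ℂ) (B : Matrix F E ℂ) :
    rtr (A * B) = rtr (B * A) := by
  rw [rtr_apply, rtr_apply, Matrix.trace_mul_comm]

theorem rtr_conjTranspose (A : Matrix E E ℂ) : rtr Aᴴ = rtr A := by
  simp [rtr_apply, Matrix.trace_conjTranspose]

theorem rtr_nonneg {A : Matrix E E ℂ} (hA : A.PosSemidef) : 0 ≤ rtr A :=
  (Complex.le_def.1 hA.trace_nonneg).1

theorem rtr_mono {A B : Matrix E E ℂ} (h : A ≤ B) : rtr A ≤ rtr B := by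
  have := rtr_nonneg (Matrix.le_iff.1 h)
  rw [map_sub] at this
  linarith

/-- Conjugation preserves the order, with the adjoint on the right. -/
theorem conj_le_conj {F : Type*} [Fintype F] {A B : Matrix E E ℂ} (h : A ≤ B)
    (C : Matrix F E ℂ) : C * A * Cᴴ ≤ C * B * Cᴴ := by
  rw [Matrix.le_iff] at h ⊢
  have := h.mul_mul_conjTranspose_same C
  rwa [Matrix.mul_sub, Matrix.sub_mul] at this

theorem conj_herm_le {A B C : Matrix E E ℂ} (h : A ≤ B) (hC : Cᴴ = C) :
    C * A * C ≤ C * B * C := by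
  simpa [hC] using conj_le_conj h C

theorem conj_posSemidef {A C : Matrix E E ℂ} (h : A.PosSemidef) (hC : Cᴴ = C) :
    (C * A * C).PosSemidef := by
  simpa [hC] using h.mul_mul_conjTranspose_same C

theorem smul_posSemidef {A : Matrix E E ℂ} (h : A.PosSemidef) {c : ℝ} (hc : 0 ≤ c) :
    (c • A).PosSemidef := by
  have := h.smul (a := (c : ℂ)) (by exact_mod_cast hc)
  simpa using this

theorem smul_le_smul_matrix {A B : Matrix E E ℂ} (h : A ≤ B) {c : ℝ} (hc : 0 ≤ c) :
    c • A ≤ c • B := by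
  rw [Matrix.le_iff, ← smul_sub]
  exact smul_posSemidef h hc

theorem smul_le_smul_right_matrix {A : Matrix E E ℂ} (h : A.PosSemidef) {c d : ℝ} (hc : c ≤ d) :
    c • A ≤ d • A := by
  rw [Matrix.le_iff, ← sub_smul]
  exact smul_posSemidef h (by linarith)

theorem exists_eq_conjTranspose_mul_self [DecidableEq E] {A : Matrix E E ℂ} (hA : A.PosSemidef) :
    ∃ R : Matrix E E ℂ, A = Rᴴ * R := by
  obtain ⟨R, hR⟩ := CStarAlgebra.nonneg_iff_eq_star_mul_self.1
    (Matrix.nonneg_iff_posSemidef.2 hA)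
  exact ⟨R, hR⟩

theorem rtr_mul_nonneg [DecidableEq E] {A B : Matrix E E ℂ} (hA : A.PosSemidef)
    (hB : B.PosSemidef) : 0 ≤ rtr (A * B) := by
  obtain ⟨R, rfl⟩ := exists_eq_conjTranspose_mul_self hA
  rw [Matrix.mul_assoc, rtr_mul_comm]
  exact rtr_nonneg (hB.mul_mul_conjTranspose_same R)

/-- The weighted arithmetic-geometric mean inequality for the form `(A, B) ↦ tr (A ρ B)`. -/
theorem two_mul_rtr_le {F : Type*} [Fintype F] {ρ : Matrix E E ℂ} (hρ : ρ.PosSemidef)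
    (A : Matrix F E ℂ) (B : Matrix E F ℂ) {s : ℝ} (hs : 0 < s) :
    2 * rtr (A * ρ * B) ≤ s * rtr (A * ρ * Aᴴ) + s⁻¹ * rtr (Bᴴ * ρ * B) := by
  have hq : 0 < Real.sqrt s := Real.sqrt_pos.2 hs
  set q := Real.sqrt s with hqdef
  have hqq : q * q = s := Real.mul_self_sqrt hs.le
  have h := rtr_nonneg (hρ.mul_mul_conjTranspose_same (q • A - q⁻¹ • Bᴴ))
  have e : (q • A - q⁻¹ • Bᴴ) * ρ * (q • A - q⁻¹ • Bᴴ)ᴴ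
      = (q * q) • (A * ρ * Aᴴ) - (A * ρ * B) - (Bᴴ * ρ * Aᴴ)
        + (q⁻¹ * q⁻¹) • (Bᴴ * ρ * B) := by
    simp only [Matrix.conjTranspose_sub, Matrix.conjTranspose_smul, Matrix.conjTranspose_conjTranspose,
      Matrix.sub_mul, Matrix.mul_sub, Matrix.smul_mul, Matrix.mul_smul, smul_sub, smul_smul, star_trivial,
      mul_inv_cancel₀ hq.ne', inv_mul_cancel₀ hq.ne', one_smul]
    abel
  rw [e, map_add, map_sub, map_sub, map_smul, map_smul] at h
  have e2 : rtr (Bᴴ * ρ * Aᴴ) = rtr (A * ρ * B) := by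
    rw [← rtr_conjTranspose (A * ρ * B)]
    simp [Matrix.conjTranspose_mul, hρ.isHermitian.eq, Matrix.mul_assoc]
  rw [e2, hqq, ← mul_inv, hqq] at h
  simp only [smul_eq_mul] at h
  linarith

end

/-! ### Functions of a fixed eigenbasis, contractions and trace-norm duality -/

section

open Matrix

variable {E : Type*} [Fintype E] [DecidableEq E]

/-- The matrix which is diagonal with real entries `f` in the orthonormal basis given by `U`. -/
def specDiag (U : unitaryGroup E ℂ) (f : E → ℝ) : Matrix E E ℂ :=
  (U : Matrix E E ℂ) * diagonal (fun e => (f e : ℂ)) * (U : Matrix E E ℂ)ᴴ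

variable (U : unitaryGroup E ℂ)

theorem unitary_mul_conj : (U : Matrix E E ℂ) * (U : Matrix E E ℂ)ᴴ = 1 :=
  (Matrix.mem_unitaryGroup_iff).1 U.2

theorem unitary_conj_mul : (U : Matrix E E ℂ)ᴴ * (U : Matrix E E ℂ) = 1 :=
  (Matrix.mem_unitaryGroup_iff').1 U.2

theorem specDiag_mul (f g : E → ℝ) :
    specDiag U f * specDiag U g = specDiag U (fun e => f e * g e) := by
  have : specDiag U f * specDiag U g = (U : Matrix E E ℂ) * diagonal (fun e => (f e : ℂ)) *
      ((U : Matrix E E ℂ)ᴴ * (U : Matrix E E ℂ)) * diagonal (fun e => (g e : ℂ)) *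
      (U : Matrix E E ℂ)ᴴ := by
    simp only [specDiag, Matrix.mul_assoc]
  rw [this, unitary_conj_mul, Matrix.mul_one, Matrix.mul_assoc (U : Matrix E E ℂ),
    Matrix.diagonal_mul_diagonal]
  simp [specDiag]

theorem specDiag_conjTranspose (f : E → ℝ) : (specDiag U f)ᴴ = specDiag U f := by
  have : (diagonal (fun e => (f e : ℂ)))ᴴ = diagonal (fun e => (f e : ℂ)) := by
    rw [Matrix.diagonal_conjTranspose]
    congr 1
    funext i
    simp
  simp only [specDiag, Matrix.conjTranspose_mul, Matrix.conjTranspose_conjTranspose, this,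
    Matrix.mul_assoc]

theorem specDiag_sum {ι : Type*} (s : Finset ι) (f : ι → E → ℝ) :
    ∑ i ∈ s, specDiag U (f i) = specDiag U (fun e => ∑ i ∈ s, f i e) := by
  simp only [specDiag]
  rw [← Finset.sum_mul, ← Finset.mul_sum]
  congr 2
  ext i j
  rw [Matrix.sum_apply]
  by_cases h : i = j
  · subst h; simp
  · simp [h]

theorem specDiag_smul (c : ℝ) (f : E → ℝ) : c • specDiag U f = specDiag U (fun e => c * f e) := by
  simp only [specDiag]
  rw [← Matrix.smul_mul, ← Matrix.mul_smul]
  congr 2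
  ext i j
  by_cases h : i = j
  · subst h; simp
  · simp [h]

theorem specDiag_sub (f g : E → ℝ) :
    specDiag U f - specDiag U g = specDiag U (fun e => f e - g e) := by
  simp only [specDiag]
  rw [← Matrix.sub_mul, ← Matrix.mul_sub]
  congr 2
  ext i j
  by_cases h : i = j
  · subst h; simp
  · simp [h]

theorem specDiag_one : specDiag U (fun _ => 1) = 1 := by
  simp [specDiag, unitary_mul_conj]

theorem specDiag_posSemidef {f : E → ℝ} (hf : ∀ e, 0 ≤ f e) : (specDiag U f).PosSemidef := by
  refine PosSemidef.mul_mul_conjTranspose_same ?_ _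
  refine PosSemidef.diagonal fun e => ?_
  simpa using hf e

theorem specDiag_mono {f g : E → ℝ} (h : ∀ e, f e ≤ g e) : specDiag U f ≤ specDiag U g := by
  rw [Matrix.le_iff, specDiag_sub]
  exact specDiag_posSemidef U fun e => sub_nonneg.2 (h e)

theorem rtr_specDiag (f : E → ℝ) : rtr (specDiag U f) = ∑ e, f e := by
  rw [specDiag, rtr_mul_comm, ← Matrix.mul_assoc, unitary_conj_mul, Matrix.one_mul, rtr_apply,
    Matrix.trace_diagonal]
  simp

/-- A Hermitian matrix is diagonal, with its eigenvalues as entries, in an orthonormal basis. -/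
theorem exists_eq_specDiag {A : Matrix E E ℂ} (hA : A.IsHermitian) :
    ∃ (U : unitaryGroup E ℂ) (d : E → ℝ), A = specDiag U d := by
  refine ⟨hA.eigenvectorUnitary, hA.eigenvalues, ?_⟩
  have := hA.spectral_theorem
  rw [Unitary.conjStarAlgAut_apply] at this
  exact this

/-- The diagonal entries of a bounded operator are bounded. -/
theorem le_of_specDiag_le {f g : E → ℝ} (h : specDiag U f ≤ specDiag U g) (e : E) :
    f e ≤ g e := by
  rw [Matrix.le_iff, specDiag_sub] at h
  have h2 := h.conjTranspose_mul_mul_same (U : Matrix E E ℂ)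
  have e3 : (U : Matrix E E ℂ)ᴴ * specDiag U (fun e => f e * 0 + (g e - f e)) * (U : Matrix E E ℂ)
      = diagonal (fun e => ((g e - f e : ℝ) : ℂ)) := by
    simp only [specDiag, mul_zero, zero_add]
    calc _ = ((U : Matrix E E ℂ)ᴴ * (U : Matrix E E ℂ)) * diagonal (fun e => ((g e - f e : ℝ) : ℂ))
          * ((U : Matrix E E ℂ)ᴴ * (U : Matrix E E ℂ)) := by simp only [Matrix.mul_assoc]
      _ = _ := by rw [unitary_conj_mul]; simp
  simp only [mul_zero, zero_add] at e3
  rw [e3] at h2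
  have := h2.diag_nonneg (i := e)
  rw [diagonal_apply_eq] at this
  have := (Complex.le_def.1 this).1
  simp at this
  linarith

/-- In the eigenbasis `U`, every summand is an entrywise product of `ρ` with a rank-one kernel. -/
theorem sum_specDiag_mul_mul {ι : Type*} (s : Finset ι) (f g : ι → E → ℝ) (ρ : Matrix E E ℂ) :
    ∑ i ∈ s, specDiag U (f i) * ρ * specDiag U (g i)
      = (U : Matrix E E ℂ) * (Matrix.of fun e e' => ((∑ i ∈ s, f i e * g i e' : ℝ) : ℂ) *
        ((U : Matrix E E ℂ)ᴴ * ρ * (U : Matrix E E ℂ)) e e') * (U : Matrix E E ℂ)ᴴ := by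
  have h1 : ∀ i, specDiag U (f i) * ρ * specDiag U (g i)
      = (U : Matrix E E ℂ) * (diagonal (fun e => (f i e : ℂ)) *
        ((U : Matrix E E ℂ)ᴴ * ρ * (U : Matrix E E ℂ)) * diagonal (fun e => (g i e : ℂ)))
        * (U : Matrix E E ℂ)ᴴ := by
    intro i; simp only [specDiag, Matrix.mul_assoc]
  simp only [h1]
  rw [← Finset.sum_mul, ← Finset.mul_sum]
  congr 2
  ext e e'
  rw [Matrix.sum_apply]
  simp only [Matrix.mul_diagonal, Matrix.diagonal_mul, Matrix.of_apply]
  push_cast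
  rw [Finset.sum_mul]
  refine Finset.sum_congr rfl fun i _ => ?_
  ring

/-- Two-sided multiplication by commuting diagonal operators only depends on the kernel
`∑ₖ fₖ(e) gₖ(e')`. -/
theorem sum_specDiag_mul_mul_congr {ι κ : Type*} (s : Finset ι) (t : Finset κ)
    (f g : ι → E → ℝ) (f' g' : κ → E → ℝ)
    (h : ∀ e e', ∑ i ∈ s, f i e * g i e' = ∑ k ∈ t, f' k e * g' k e') (ρ : Matrix E E ℂ) :
    ∑ i ∈ s, specDiag U (f i) * ρ * specDiag U (g i)
      = ∑ k ∈ t, specDiag U (f' k) * ρ * specDiag U (g' k) := by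
  rw [sum_specDiag_mul_mul, sum_specDiag_mul_mul]
  simp only [h]

/-- A contraction, together with its adjoint. -/
structure IsContr (C : Matrix E E ℂ) : Prop where
  left : Cᴴ * C ≤ 1
  right : C * Cᴴ ≤ 1

theorem IsContr.conjTranspose {C : Matrix E E ℂ} (hC : IsContr C) : IsContr Cᴴ :=
  ⟨by simpa using hC.right, by simpa using hC.left⟩

theorem IsContr.rtr_conj_le {C : Matrix E E ℂ} (hC : IsContr C) {ρ : Matrix E E ℂ}
    (hρ : ρ.PosSemidef) : rtr (C * ρ * Cᴴ) ≤ rtr ρ := by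
  rw [Matrix.mul_assoc, rtr_mul_comm, Matrix.mul_assoc]
  have := rtr_mul_nonneg hρ hC.left
  rw [Matrix.mul_sub, Matrix.mul_one, map_sub] at this
  linarith

theorem projection_le_one {p : Matrix E E ℂ} (h1 : pᴴ = p) (h2 : p * p = p) : p ≤ 1 := by
  rw [Matrix.le_iff]
  have : (1 - p) = (1 - p)ᴴ * (1 - p) := by
    simp [h1, Matrix.sub_mul, Matrix.mul_sub, h2]
  rw [this]
  exact posSemidef_conjTranspose_mul_self _

/-- Singular value data: `|M| = specDiag U d` and `MᴴM = |M|²`. -/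
theorem exists_abs_eq_specDiag (M : Matrix E E ℂ) :
    ∃ (U : unitaryGroup E ℂ) (d : E → ℝ), CFC.abs M = specDiag U d ∧ (∀ e, 0 ≤ d e) ∧
      Mᴴ * M = specDiag U d * specDiag U d := by
  have hpos : (CFC.abs M).PosSemidef := Matrix.nonneg_iff_posSemidef.1 (CFC.abs_nonneg M)
  obtain ⟨U, d, h⟩ := exists_eq_specDiag hpos.isHermitian
  refine ⟨U, d, h, fun e => ?_, ?_⟩
  · refine le_of_specDiag_le U (f := fun _ => 0) ?_ e
    rw [← h]
    have : specDiag U (fun _ => 0) = 0 := by simp [specDiag]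
    rw [this]
    exact CFC.abs_nonneg M
  · rw [← h, CFC.abs_mul_abs]
    rfl

/-- The maximiser is the adjoint of the partial isometry in the polar decomposition, built from the
pseudo-inverse `V` of `|M|`; the convention `0⁻¹ = 0` makes `V` vanish on the kernel. -/
theorem exists_contr_rtr_eq (M : Matrix E E ℂ) :
    ∃ C, IsContr C ∧ rtr (C * M) = traceNorm M := by
  obtain ⟨U, d, h, -, h2⟩ := exists_abs_eq_specDiag M
  set V := specDiag U (fun e => (d e)⁻¹) with hV
  have hVh : Vᴴ = V := specDiag_conjTranspose U _
  have hid : ∀ a : ℝ, a⁻¹ * (a * a) = a := fun a => by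
    by_cases ha : a = 0 <;> field_simp
  have hVA : V * (Mᴴ * M) = specDiag U d := by
    rw [h2, specDiag_mul, hV, specDiag_mul]
    simp only [hid]
  refine ⟨V * Mᴴ, ⟨?_, ?_⟩, ?_⟩
  · refine projection_le_one ?_ ?_
    · simp [Matrix.conjTranspose_mul, Matrix.mul_assoc]
    · have : (V * Mᴴ)ᴴ * (V * Mᴴ) * ((V * Mᴴ)ᴴ * (V * Mᴴ))
          = M * (V * (V * (Mᴴ * M) * V * V)) * Mᴴ := by
        simp only [Matrix.conjTranspose_mul, hVh, Matrix.conjTranspose_conjTranspose,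
          Matrix.mul_assoc]
      rw [this, hVA, hV]
      simp only [specDiag_mul, Matrix.conjTranspose_mul, Matrix.conjTranspose_conjTranspose,
        specDiag_conjTranspose]
      rw [Matrix.mul_assoc M, Matrix.mul_assoc M, ← Matrix.mul_assoc (specDiag U _) (specDiag U _),
        specDiag_mul]
      congr 3
      ext e
      by_cases hd : d e = 0 <;> field_simp
  · have : V * Mᴴ * (V * Mᴴ)ᴴ = V * (Mᴴ * M) * V := by
      simp only [Matrix.conjTranspose_mul, hVh, Matrix.conjTranspose_conjTranspose,
        Matrix.mul_assoc]
    rw [this, hVA, hV, specDiag_mul, ← specDiag_one U]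
    refine specDiag_mono U fun e => ?_
    by_cases hd : d e = 0 <;> simp [hd]
  · rw [Matrix.mul_assoc, hVA, ← h]
    rfl

/-- With `M = (M V) |M|` and `M V` a partial isometry, Cauchy-Schwarz with respect to `|M|` applied
to `C M V` and `1` bounds the trace by `tr |M|`. -/
theorem IsContr.rtr_mul_le {C : Matrix E E ℂ} (hC : IsContr C) (M : Matrix E E ℂ) :
    rtr (C * M) ≤ traceNorm M := by
  obtain ⟨U, d, h, hd, h2⟩ := exists_abs_eq_specDiag M
  set V := specDiag U (fun e => (d e)⁻¹) with hV
  have hVh : Vᴴ = V := specDiag_conjTranspose U _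
  set A := specDiag U d with hA
  have hAp : A.PosSemidef := specDiag_posSemidef U hd
  have hM : M * V * A = M := by
    have h0 : M * (1 - V * A) = 0 := by
      rw [← Matrix.conjTranspose_mul_self_eq_zero]
      have : (M * (1 - V * A))ᴴ * (M * (1 - V * A)) = (1 - V * A)ᴴ * (Mᴴ * M) * (1 - V * A) := by
        simp only [Matrix.conjTranspose_mul, Matrix.mul_assoc]
      rw [this, h2, Matrix.mul_assoc, Matrix.mul_sub, Matrix.mul_one, hV, hA, specDiag_mul,
        specDiag_mul, specDiag_mul, specDiag_sub]
      have : (fun e => d e * d e - d e * d e * ((d e)⁻¹ * d e)) = fun _ => 0 := by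
        ext e
        by_cases he : d e = 0 <;> field_simp <;> simp
      rw [this]
      simp [specDiag]
    rw [Matrix.mul_sub, Matrix.mul_one, ← Matrix.mul_assoc] at h0
    exact (sub_eq_zero.1 h0).symm
  have h3 := two_mul_rtr_le hAp (C * (M * V)) (1 : Matrix E E ℂ) one_pos
  have e1 : rtr (C * (M * V) * A * (C * (M * V))ᴴ) ≤ rtr A := by
    have : C * (M * V) * A * (C * (M * V))ᴴ = C * ((M * V) * A * (M * V)ᴴ) * Cᴴ := by
      simp only [Matrix.conjTranspose_mul, Matrix.mul_assoc]
    rw [this]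
    refine (hC.rtr_conj_le (hAp.mul_mul_conjTranspose_same _)).trans ?_
    rw [Matrix.mul_assoc, rtr_mul_comm, Matrix.mul_assoc]
    have : (M * V)ᴴ * (M * V) = V * (Mᴴ * M) * V := by
      simp only [Matrix.conjTranspose_mul, hVh, Matrix.mul_assoc]
    rw [this, h2, hV, hA, specDiag_mul, specDiag_mul, specDiag_mul, specDiag_mul, rtr_specDiag,
      rtr_specDiag]
    refine Finset.sum_le_sum fun e _ => ?_
    by_cases he : d e = 0
    · simp [he]
    · exact le_of_eq (by field_simp)
  have e2 : C * (M * V) * A * 1 = C * M := by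
    rw [Matrix.mul_one, Matrix.mul_assoc, hM]
  rw [e2] at h3
  simp only [Matrix.conjTranspose_one, Matrix.mul_one, inv_one, one_mul] at h3
  have : traceNorm M = rtr A := by rw [traceNorm, h, rtr_apply]
  linarith

/-- Through this duality, distances are estimated by testing against contractions, which are
additive in the operator and need no further use of `|M|`. -/
theorem traceNorm_le_iff {M : Matrix E E ℂ} {c : ℝ} :
    traceNorm M ≤ c ↔ ∀ C, IsContr C → rtr (C * M) ≤ c := by
  constructor
  · exact fun h C hC => (hC.rtr_mul_le M).trans h
  · intro h
    obtain ⟨C, hC, e⟩ := exists_contr_rtr_eq M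
    exact e ▸ h C hC

end

/-! ### Spectral projections onto geometric bins -/

section

open Matrix

variable {E : Type*} [Fintype E] [DecidableEq E]

theorem exists_geometric_bin {c δ t : ℝ} (ht : t ≤ c) (m : ℕ) :
    ∃ j : Fin (m + 1), t ≤ c * (2 : ℝ) ^ (-(δ * j)) ∧
      (j ≠ Fin.last m → c * (2 : ℝ) ^ (-(δ * ((j : ℕ) + 1))) < t) := by
  by_cases h : ∃ j : ℕ, j < m ∧ c * (2 : ℝ) ^ (-(δ * ((j : ℕ) + 1))) < t
  · classical
    obtain ⟨h1, h2⟩ := Nat.find_spec h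
    refine ⟨⟨Nat.find h, by omega⟩, ?_, fun _ => h2⟩
    rcases Nat.eq_zero_or_pos (Nat.find h) with h0 | h0
    · simpa [h0] using ht
    · have := Nat.find_min h (m := Nat.find h - 1) (by omega)
      push Not at this
      have h3 := this (by omega)
      have e : (((Nat.find h - 1 : ℕ) : ℝ) + 1) = (Nat.find h : ℝ) := by
        rw [Nat.cast_sub h0]; push_cast; ring
      rwa [e] at h3
  · push Not at h
    refine ⟨Fin.last m, ?_, fun h => absurd rfl h⟩
    rcases Nat.eq_zero_or_pos m with h0 | h0
    · subst h0; simpa using ht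
    · have h3 := h (m - 1) (by omega)
      have e : (((m - 1 : ℕ) : ℝ) + 1) = (m : ℝ) := by
        rw [Nat.cast_sub h0]; push_cast; ring
      rw [e] at h3
      simpa using h3

/-- The spectral projections of `0 ≤ H ≤ c P` to geometric bins, refining the projection `P`. The
last bin takes all small eigenvalues. -/
theorem exists_spectral_bins {P H : Matrix E E ℂ} (hP : Pᴴ = P) (hP2 : P * P = P)
    (hH : H.PosSemidef) (hPH : P * H = H) {c : ℝ} (hc : 0 < c) (hle : H ≤ c • P) (δ : ℝ)
    (m : ℕ) :
    ∃ Q : Fin (m + 1) → Matrix E E ℂ, (∀ j, (Q j)ᴴ = Q j) ∧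
      (∀ j k, Q j * Q k = if j = k then Q j else 0) ∧ ∑ j, Q j = P ∧
      ∑ j, Q j * H * Q j = H ∧
      (∀ j, Q j * H * Q j ≤ (c * (2 : ℝ) ^ (-(δ * (j : ℕ)))) • Q j) ∧
      (∀ j, j ≠ Fin.last m →
        (c * (2 : ℝ) ^ (-(δ * (j : ℕ)))) • Q j ≤ ((2 : ℝ) ^ δ) • (Q j * H * Q j)) := by
  obtain ⟨U, d, hd⟩ := exists_eq_specDiag hH.isHermitian
  have hdc : ∀ e, d e ≤ c := by
    refine le_of_specDiag_le U (g := fun _ => c) ?_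
    have h1 : specDiag U (fun _ => c) = c • (1 : Matrix E E ℂ) := by
      rw [← specDiag_one U, specDiag_smul]; simp
    rw [← hd, h1]
    exact hle.trans (smul_le_smul_matrix (projection_le_one hP hP2) hc.le)
  choose b hb1 hb2 using fun e => exists_geometric_bin (δ := δ) (hdc e) m
  set F : Fin (m + 1) → Matrix E E ℂ := fun j => specDiag U (fun e => if b e = j then 1 else 0)
   
  have hFd : ∀ j, F j = specDiag U (fun e => if b e = j then 1 else 0) := fun j => rfl
  clear_value F
  have hFh : ∀ j, (F j)ᴴ = F j := fun j => by
    rw [hFd, specDiag_conjTranspose]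
  have hHP : H * P = H := by
    have := congrArg Matrix.conjTranspose hPH
    rwa [Matrix.conjTranspose_mul, hP, hH.isHermitian.eq] at this
  have hFsum : ∑ j, F j = 1 := by
    simp only [hFd]
    rw [specDiag_sum, ← specDiag_one U]
    simp
  have hFF : ∀ j k, F j * F k = if j = k then F j else 0 := by
    intro j k
    rw [hFd, hFd, specDiag_mul]
    split_ifs with h
    · subst h
      refine congrArg (specDiag U) (funext fun e => ?_)
      split_ifs <;> simp
    · have : (fun e => (if b e = j then (1 : ℝ) else 0) * (if b e = k then 1 else 0))
          = fun _ => 0 := by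
        ext e; by_cases h1 : b e = j
        · have : b e ≠ k := fun h2 => h (h1.symm.trans h2)
          simp [this]
        · simp [h1]
      rw [this]; simp [specDiag]
  -- Bins other than the last contain only positive eigenvalues, so their projections factor through
  -- `H` and lie below `P`. The last one also holds the kernel of `H`, including the complement of
  -- `P`; it commutes with `P` as the complement of the others and is cut down to `P * F j`.
  have hFlow : ∀ j, j ≠ Fin.last m → P * F j = F j := by
    intro j hj
    have : F j = H * specDiag U (fun e => if b e = j then (d e)⁻¹ else 0) := by
      rw [hd, specDiag_mul, hFd]
      refine congrArg (specDiag U) (funext fun e => ?_)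
      split_ifs with h
      · have := hb2 e (h ▸ hj)
        have h0 : 0 < d e := lt_trans (by positivity) this
        field_simp
      · simp
    rw [this, ← Matrix.mul_assoc, hPH]
  have hFlow' : ∀ j, j ≠ Fin.last m → F j * P = F j := by
    intro j hj
    have := congrArg Matrix.conjTranspose (hFlow j hj)
    rwa [Matrix.conjTranspose_mul, hP, hFh] at this
  have hcomm : ∀ j, P * F j = F j * P := by
    intro j
    by_cases hj : j = Fin.last m
    · have e : F (Fin.last m) = 1 - ∑ j ∈ Finset.univ.erase (Fin.last m), F j := by
        rw [← hFsum, ← Finset.sum_erase_add _ _ (Finset.mem_univ (Fin.last m))]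
        abel
      subst hj
      rw [e, Matrix.mul_sub, Matrix.sub_mul, Finset.mul_sum, Finset.sum_mul, Matrix.mul_one,
        Matrix.one_mul]
      congr 1
      refine Finset.sum_congr rfl fun j hj => ?_
      rw [hFlow j (Finset.ne_of_mem_erase hj), hFlow' j (Finset.ne_of_mem_erase hj)]
    · rw [hFlow j hj, hFlow' j hj]
  have hPFP : ∀ j, P * F j * P = P * F j := fun j => by
    rw [Matrix.mul_assoc, ← hcomm, ← Matrix.mul_assoc, hP2]
  have hQHQ : ∀ j, (P * F j) * H * (P * F j) = F j * H := by
    intro j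
    have h1 : F j * H = H * F j := by
      rw [hd, hFd, specDiag_mul, specDiag_mul]
      exact congrArg (specDiag U) (funext fun e => mul_comm _ _)
    calc (P * F j) * H * (P * F j) = F j * (P * H * P) * F j := by
          rw [hcomm]; conv_lhs => rw [← hcomm]
          simp only [Matrix.mul_assoc, hcomm]
      _ = F j * H := by
          rw [hPH, hHP, h1, Matrix.mul_assoc, hFF]; simp
  have hFH : ∀ j, F j * H = specDiag U (fun e => if b e = j then d e else 0) := by
    intro j
    rw [hd, hFd, specDiag_mul]
    refine congrArg (specDiag U) (funext fun e => ?_)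
    split_ifs <;> simp
  have hFHP : ∀ j, F j * H = P * (F j * H) * P := by
    intro j
    rw [← hQHQ]
    simp only [Matrix.mul_assoc]
    rw [← Matrix.mul_assoc P P, hP2, ← hcomm, ← Matrix.mul_assoc P P, hP2]
  refine ⟨fun j => P * F j, fun j => ?_, fun j k => ?_, ?_, ?_, fun j => ?_, fun j hj => ?_⟩
  · rw [Matrix.conjTranspose_mul, hFh, hP, ← hcomm]
  · rw [← Matrix.mul_assoc, hPFP, Matrix.mul_assoc, hFF]
    split_ifs <;> simp
  · rw [← Finset.mul_sum, hFsum, Matrix.mul_one]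
  · simp only [hQHQ]
    rw [← Finset.sum_mul, hFsum, Matrix.one_mul]
  · beta_reduce
    rw [hQHQ, hFHP, ← hPFP, ← Matrix.smul_mul, ← Matrix.mul_smul]
    refine conj_herm_le ?_ hP
    rw [hFH, hFd, specDiag_smul]
    refine specDiag_mono U fun e => ?_
    split_ifs with h
    · have := hb1 e
      rw [h] at this
      simpa using this
    · simp
  · beta_reduce
    rw [hQHQ, hFHP, ← hPFP, ← Matrix.smul_mul, ← Matrix.mul_smul, ← Matrix.smul_mul,
      ← Matrix.mul_smul]
    refine conj_herm_le ?_ hP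
    rw [hFH, hFd, specDiag_smul, specDiag_smul]
    refine specDiag_mono U fun e => ?_
    split_ifs with h
    · have := hb2 e (h ▸ hj)
      rw [h] at this
      have e2 : (2 : ℝ) ^ (-(δ * (j : ℕ))) = 2 ^ δ * 2 ^ (-(δ * ((j : ℕ) + 1))) := by
        rw [← Real.rpow_add (by norm_num)]; congr 1; ring
      rw [e2, mul_one]
      have := mul_le_mul_of_nonneg_left this.le (Real.rpow_nonneg (by norm_num : (0:ℝ) ≤ 2) δ)
      linarith
    · simp

end

/-! ### Spectral trees: coefficients and definition -/

section

open Matrix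

variable {E : Type*} [Fintype E] [DecidableEq E]

theorem sum_fin_succ_fun {X M : Type*} [Fintype X] [AddCommMonoid M] {n : ℕ}
    (f : (Fin (n + 1) → X) → M) :
    ∑ x, f x = ∑ a : X, ∑ x' : Fin n → X, f (Fin.cons a x') := by
  rw [← (Fin.consEquiv (fun _ => X)).sum_comp, Fintype.sum_prod_type]
  rfl

/-- Coefficients `(α, β)` of the bound on the substring operators of a spectral tree: they change
according to whether a position belongs to the sample. -/
def runCoef (δ : ℝ) : {n : ℕ} → (Fin n → Bool) → ℝ × ℝ
  | 0, _ => (0, 1)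
  | _ + 1, S =>
    let p := runCoef δ (fun i => S i.succ)
    if S 0 then (p.1 + p.2, 0) else (p.1, p.1 * (2 : ℝ) ^ δ + p.2)

theorem runCoef_nonneg (δ : ℝ) : ∀ {n : ℕ} (S : Fin n → Bool),
    0 ≤ (runCoef δ S).1 ∧ 0 ≤ (runCoef δ S).2
  | 0, S => by simp [runCoef]
  | n + 1, S => by
    obtain ⟨h1, h2⟩ := runCoef_nonneg δ (fun i => S i.succ)
    simp only [runCoef]
    split_ifs
    · exact ⟨add_nonneg h1 h2, le_rfl⟩
    · exact ⟨h1, by positivity⟩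

/-- A family of projections `Q x v`, orthogonal in `v`, which refines the projection `P` according to
the (binned) spectra of the operators `ρ (x₁, …, xᵢ)`; `v i` is the bin at position `i`. -/
structure IsSpectralTree {X : Type*} [Fintype X] [DecidableEq X] {n m : ℕ} (δ c : ℝ)
    (P : Matrix E E ℂ) (ρ : (Fin n → X) → Matrix E E ℂ)
    (Q : (Fin n → X) → (Fin n → Fin (m + 1)) → Matrix E E ℂ) : Prop where
  herm : ∀ x v, (Q x v)ᴴ = Q x v
  orth : ∀ x v w, Q x v * Q x w = if v = w then Q x v else 0
  sum_eq : ∀ x, ∑ v, Q x v = P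
  sample_le : ∀ (S : Fin n → Bool) (y : Fin n → X),
    ∑ v, ((2 : ℝ) ^ (δ * ∑ i, if S i then ((v i : ℕ) : ℝ) else 0)) •
        ∑ x, (if ∀ i, S i → x i = y i then Q x v * ρ x * Q x v else 0)
      ≤ ((runCoef δ S).1 * c) • P + (runCoef δ S).2 • (P * (∑ x, ρ x) * P)
  low_weight : ∀ b t : ℝ, 0 ≤ b → 0 < t → (∀ x, P * ρ x * P ≤ b • P) →
    ∑ v, (if t < c * (2 : ℝ) ^ (-(δ * ∑ i, ((v i : ℕ) : ℝ))) then
        ∑ x, rtr (Q x v * ρ x * Q x v) else 0)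
      ≤ b / t * (c * rtr P + n * (2 : ℝ) ^ δ * rtr (P * (∑ x, ρ x) * P))

theorem IsSpectralTree.mul_proj {X : Type*} [Fintype X] [DecidableEq X] {n m : ℕ} {δ c : ℝ}
    {P : Matrix E E ℂ} {ρ : (Fin n → X) → Matrix E E ℂ}
    {Q : (Fin n → X) → (Fin n → Fin (m + 1)) → Matrix E E ℂ} (h : IsSpectralTree δ c P ρ Q)
    (x v) : Q x v * P = Q x v := by
  rw [← h.sum_eq x, Finset.mul_sum]
  simp [h.orth]

theorem IsSpectralTree.proj_mul {X : Type*} [Fintype X] [DecidableEq X] {n m : ℕ} {δ c : ℝ}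
    {P : Matrix E E ℂ} {ρ : (Fin n → X) → Matrix E E ℂ}
    {Q : (Fin n → X) → (Fin n → Fin (m + 1)) → Matrix E E ℂ} (h : IsSpectralTree δ c P ρ Q)
    (x v) : P * Q x v = Q x v := by
  rw [← h.sum_eq x, Finset.sum_mul]
  simp [h.orth]

theorem exists_isSpectralTree_zero {X : Type*} [Fintype X] [DecidableEq X] {m : ℕ}
    (δ : ℝ) {c : ℝ} (hc : 0 < c) {P : Matrix E E ℂ} (hP : Pᴴ = P) (hP2 : P * P = P)
    (ρ : (Fin 0 → X) → Matrix E E ℂ) :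
    ∃ Q : (Fin 0 → X) → (Fin 0 → Fin (m + 1)) → Matrix E E ℂ, IsSpectralTree δ c P ρ Q := by
  refine ⟨fun _ _ => P, ⟨fun _ _ => hP, fun _ v w => ?_, fun x => ?_, fun S y => ?_, ?_⟩⟩
  · simp [hP2, Subsingleton.elim v w]
  · simp
  · simp [runCoef, Subsingleton.elim default y]
  · intro b t hb ht h
    simp only [Finset.univ_unique, Finset.sum_singleton, Finset.univ_eq_empty, Finset.sum_empty,
      mul_zero, neg_zero, Real.rpow_zero, mul_one, CharP.cast_eq_zero, zero_mul, add_zero]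
    have hP0 : 0 ≤ rtr P := rtr_nonneg (by
      have := posSemidef_conjTranspose_mul_self P
      rwa [hP, hP2] at this)
    split_ifs with htc
    · have h1 := rtr_mono (h default)
      rw [map_smul, smul_eq_mul] at h1
      refine h1.trans ?_
      rw [div_mul_eq_mul_div, le_div_iff₀ ht]
      nlinarith [mul_nonneg hb hP0]
    · positivity

end

/-! ### Construction of spectral trees -/

section

open Matrix

variable {E : Type*} [Fintype E] [DecidableEq E]

/-- In a bin other than the last, the upper bound on the eigenvalues exceeds them by at most the
factor `2 ^ δ`, so these bins are paid for by `H` itself. Only the last bin lacks a lower bound, and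
it is paid for by `P` at the smallest scale. -/
theorem sum_smul_bins_le {P H : Matrix E E ℂ} {m : ℕ} {c δ : ℝ} (hc : 0 < c)
    {Q : Fin (m + 1) → Matrix E E ℂ}
    (hQh : ∀ j, (Q j)ᴴ = Q j) (hQQ : ∀ j k, Q j * Q k = if j = k then Q j else 0)
    (hQs : ∑ j, Q j = P) (hHs : ∑ j, Q j * H * Q j = H) (hH : H.PosSemidef)
    (hlow : ∀ j, j ≠ Fin.last m →
      (c * (2 : ℝ) ^ (-(δ * (j : ℕ)))) • Q j ≤ ((2 : ℝ) ^ δ) • (Q j * H * Q j)) :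
    ∑ j : Fin (m + 1), (c * (2 : ℝ) ^ (-(δ * (j : ℕ)))) • Q j
      ≤ (c * (2 : ℝ) ^ (-(δ * m))) • P + ((2 : ℝ) ^ δ) • H := by
  have hQp : ∀ j, (Q j).PosSemidef := fun j => by
    have := posSemidef_conjTranspose_mul_self (Q j)
    rwa [hQh, hQQ, if_pos rfl] at this
  have hQHp : ∀ j, (Q j * H * Q j).PosSemidef := fun j => conj_posSemidef hH (hQh j)
  rw [← Finset.add_sum_erase _ _ (Finset.mem_univ (Fin.last m))]
  refine add_le_add ?_ ?_
  · rw [Fin.val_last]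
    refine smul_le_smul_matrix ?_ (by positivity)
    rw [← hQs, ← Finset.add_sum_erase _ _ (Finset.mem_univ (Fin.last m)), Matrix.le_iff,
      add_sub_cancel_left]
    exact posSemidef_sum _ fun j _ => hQp j
  · refine (Finset.sum_le_sum fun j hj => hlow j (Finset.ne_of_mem_erase hj)).trans ?_
    rw [← Finset.smul_sum]
    refine smul_le_smul_matrix ?_ (by positivity)
    conv_rhs => rw [← hHs, ← Finset.add_sum_erase _ _ (Finset.mem_univ (Fin.last m))]
    rw [Matrix.le_iff, add_sub_cancel_right]
    exact hQHp _

/-- Induction on the length: bin the compressed operator of each first symbol, then grow a tree on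
every bin with its scale `c 2 ^ (-δ j)`. At a sampled position only one symbol contributes and the
weight `2 ^ (δ j)` cancels the decrease of the scale. At an unsampled position all symbols
contribute, and `sum_smul_bins_le` returns to the scale `c` at the price of one more `2 ^ δ` times
the state. The weight estimate uses the same summation at every position, ending with a Markov
argument at the leaves, where `ρ x` is bounded by `b`. -/
theorem exists_isSpectralTree {X : Type*} [Fintype X] [DecidableEq X] {m : ℕ} {δ : ℝ}
    (hδm : (2 : ℝ) ^ (-(δ * m)) * Fintype.card X ≤ 1) :
    ∀ (n : ℕ) {c : ℝ} (_ : 0 < c) {P : Matrix E E ℂ} (_ : Pᴴ = P) (_ : P * P = P)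
      (ρ : (Fin n → X) → Matrix E E ℂ) (_ : ∀ x, (ρ x).PosSemidef)
      (_ : P * (∑ x, ρ x) * P ≤ c • P),
    ∃ Q : (Fin n → X) → (Fin n → Fin (m + 1)) → Matrix E E ℂ, IsSpectralTree δ c P ρ Q := by
  intro n
  induction n with
  | zero => intro c hc P hP hP2 ρ hρ _; exact exists_isSpectralTree_zero δ hc hP hP2 ρ
  | succ n ih =>
    intro c hc P hP hP2 ρ hρ hle
    have hPp : P.PosSemidef := by
      have := posSemidef_conjTranspose_mul_self P
      rwa [hP, hP2] at this
    set ρa : X → Matrix E E ℂ := fun a => ∑ x' : Fin n → X, ρ (Fin.cons a x') with hρa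
    have hρap : ∀ a, (ρa a).PosSemidef := fun a => posSemidef_sum _ fun x' _ => hρ _
    have hρs : ∑ x, ρ x = ∑ a, ρa a := sum_fin_succ_fun ρ
    set H : X → Matrix E E ℂ := fun a => P * ρa a * P with hH
    have hHp : ∀ a, (H a).PosSemidef := fun a => conj_posSemidef (hρap a) hP
    have hHs : ∑ a, H a = P * (∑ x, ρ x) * P := by
      rw [hρs, Finset.mul_sum, Finset.sum_mul]
    have hHle : ∀ a, H a ≤ c • P := fun a => by
      refine le_trans ?_ hle
      rw [← hHs, ← Finset.add_sum_erase _ _ (Finset.mem_univ a), Matrix.le_iff,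
        add_sub_cancel_left]
      exact posSemidef_sum _ fun b _ => hHp b
    choose B hBh hBB hBs hBHs hBup hBlow using fun a =>
      exists_spectral_bins hP hP2 (hHp a)
        (show P * H a = H a by simp only [hH]; rw [← Matrix.mul_assoc, ← Matrix.mul_assoc, hP2])
        hc (hHle a) δ m
    have hBP : ∀ a j, B a j * P = B a j := fun a j => by
      rw [← hBs a, Finset.mul_sum]; simp [hBB]
    have hPB : ∀ a j, P * B a j = B a j := fun a j => by
      rw [← hBs a, Finset.sum_mul]; simp [hBB]
    have hBMB : ∀ a j M, B a j * (P * M * P) * B a j = B a j * M * B a j := fun a j M => by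
      calc _ = (B a j * P) * M * (P * B a j) := by simp only [Matrix.mul_assoc]
        _ = _ := by rw [hBP, hPB]
    have hBB1 : ∀ a j, B a j * B a j = B a j := fun a j => by simp [hBB]
    choose T hT using fun a (j : Fin (m + 1)) =>
      ih (c := c * (2 : ℝ) ^ (-(δ * (j : ℕ)))) (by positivity) (hBh a j) (hBB1 a j)
        (fun x' => ρ (Fin.cons a x')) (fun x' => hρ _)
        (by
          have := hBup a j
          simp only [hH] at this
          rwa [hBMB] at this)
    have hsub : ∀ a, ∑ j : Fin (m + 1), (c * (2 : ℝ) ^ (-(δ * (j : ℕ)))) • B a j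
        ≤ (c * (2 : ℝ) ^ (-(δ * m))) • P + ((2 : ℝ) ^ δ) • H a := fun a =>
      sum_smul_bins_le hc (hBh a) (hBB a) (hBs a) (hBHs a) (hHp a) (hBlow a)
    have hsubs : ∑ a, ∑ j : Fin (m + 1), (c * (2 : ℝ) ^ (-(δ * (j : ℕ)))) • B a j
        ≤ c • P + ((2 : ℝ) ^ δ) • (P * (∑ x, ρ x) * P) := by
      refine (Finset.sum_le_sum fun a _ => hsub a).trans ?_
      rw [Finset.sum_add_distrib, ← Finset.smul_sum (s := Finset.univ) (f := H), hHs, Finset.sum_const, Finset.card_univ,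
        ← Nat.cast_smul_eq_nsmul ℝ, smul_smul]
      -- The last bins of all symbols together contribute `|X| c 2 ^ (-δ m)`, which is at most `c`
      -- by `hδm`.
      refine add_le_add (smul_le_smul_right_matrix hPp ?_) le_rfl
      nlinarith
    refine ⟨fun x v => T (x 0) (v 0) (Fin.tail x) (Fin.tail v),
      ⟨fun x v => (hT _ _).herm _ _, fun x v w => ?_, fun x => ?_, fun S y => ?_, ?_⟩⟩
    · by_cases h0 : v 0 = w 0
      · have h1 := (hT (x 0) (v 0)).orth (Fin.tail x) (Fin.tail v) (Fin.tail w)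
        rw [← h0, h1]
        by_cases h2 : Fin.tail v = Fin.tail w
        · have : v = w := by
            rw [← Fin.cons_self_tail v, ← Fin.cons_self_tail w, h0, h2]
          simp [this]
        · have : v ≠ w := fun h => h2 (by rw [h])
          simp [this, h2]
      · have : v ≠ w := fun h => h0 (by rw [h])
        rw [if_neg this, ← (hT (x 0) (v 0)).mul_proj, ← (hT (x 0) (w 0)).proj_mul,
          Matrix.mul_assoc, ← Matrix.mul_assoc (B _ _) (B _ _), hBB, if_neg h0]
        simp
    · rw [sum_fin_succ_fun]
      simp only [Fin.cons_zero, Fin.tail_cons]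
      simp only [(hT _ _).sum_eq, hBs]
    · have key : ∀ a j, ∑ v', ((2 : ℝ) ^ (δ * ∑ i : Fin n, if S i.succ then ((v' i : ℕ) : ℝ) else 0))
          • ∑ x', (if ∀ i : Fin n, S i.succ → x' i = y i.succ then
            T a j x' v' * ρ (Fin.cons a x') * T a j x' v' else 0)
          ≤ ((runCoef δ fun i : Fin n => S i.succ).1 * (c * (2 : ℝ) ^ (-(δ * (j : ℕ))))) • B a j
            + (runCoef δ fun i : Fin n => S i.succ).2 • (B a j * H a * B a j) := by
        intro a j
        have := (hT a j).sample_le (fun i => S i.succ) (fun i => y i.succ)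
        simp only [hH]
        rwa [hBMB]
      obtain ⟨hα, hβ⟩ := runCoef_nonneg δ (fun i : Fin n => S i.succ)
      have hsum : ∀ (j : Fin (m + 1)) (v' : Fin n → Fin (m + 1)),
          ∑ i, (if S i then (((Fin.cons j v' : Fin (n + 1) → Fin (m + 1)) i : ℕ) : ℝ) else 0)
            = (if S 0 then ((j : ℕ) : ℝ) else 0)
              + ∑ i : Fin n, if S i.succ then ((v' i : ℕ) : ℝ) else 0 := fun j v' => by
        rw [Fin.sum_univ_succ]; simp
      rw [sum_fin_succ_fun]
      simp only [Fin.cons_zero, Fin.tail_cons, sum_fin_succ_fun, hsum, Fin.cons_succ,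
        Fin.forall_fin_succ, runCoef]
      set α := (runCoef δ fun i : Fin n => S i.succ).1 with hαd
      set β := (runCoef δ fun i : Fin n => S i.succ).2 with hβd
      by_cases hS : S 0 = true
      · simp only [hS, if_true, true_implies]
        have e : ∀ j : Fin (m + 1), ∀ v' : Fin n → Fin (m + 1),
            ((2 : ℝ) ^ (δ * (((j : ℕ) : ℝ) + ∑ i : Fin n, if S i.succ then ((v' i : ℕ) : ℝ) else 0)))
            • ∑ a, ∑ x', (if a = y 0 ∧ ∀ i : Fin n, S i.succ → x' i = y i.succ then
              T a j x' v' * ρ (Fin.cons a x') * T a j x' v' else 0)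
            = ((2 : ℝ) ^ (δ * (j : ℕ))) •
              (((2 : ℝ) ^ (δ * ∑ i : Fin n, if S i.succ then ((v' i : ℕ) : ℝ) else 0)) •
                ∑ x', (if ∀ i : Fin n, S i.succ → x' i = y i.succ then
                  T (y 0) j x' v' * ρ (Fin.cons (y 0) x') * T (y 0) j x' v' else 0)) := by
          intro j v'
          rw [mul_add, Real.rpow_add (by norm_num), ← smul_smul,
            Finset.sum_eq_single (y 0)]
          · simp
          · intro a _ ha
            simp [ha]
          · simp
        simp only [e, ← Finset.smul_sum]
        have h1 : ∀ j : Fin (m + 1), ((2 : ℝ) ^ (δ * (j : ℕ))) •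
            (((α * (c * (2 : ℝ) ^ (-(δ * (j : ℕ))))) • B (y 0) j
              + β • (B (y 0) j * H (y 0) * B (y 0) j))) ≤ ((α + β) * c) • B (y 0) j := by
          intro j
          have hx : (2 : ℝ) ^ (δ * (j : ℕ)) * 2 ^ (-(δ * (j : ℕ))) = 1 := by
            rw [← Real.rpow_add (by norm_num)]; simp
          have := smul_le_smul_matrix (hBup (y 0) j)
            (c := (2 : ℝ) ^ (δ * (j : ℕ)) * β) (by positivity)
          rw [smul_smul] at this
          rw [smul_add, smul_smul, smul_smul]
          refine (add_le_add le_rfl this).trans (le_of_eq ?_)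
          rw [← add_smul]
          congr 1
          linear_combination (α + β) * c * hx
        refine (Finset.sum_le_sum fun j _ => (smul_le_smul_matrix (key (y 0) j)
          (by positivity)).trans (h1 j)).trans (le_of_eq ?_)
        rw [← Finset.smul_sum, hBs]
        simp
      · simp only [hS, if_false, false_implies, true_and, zero_add, Bool.false_eq_true]
        have e : ∀ j : Fin (m + 1),
            ∑ v' : Fin n → Fin (m + 1),
            ((2 : ℝ) ^ (δ * ∑ i : Fin n, if S i.succ then ((v' i : ℕ) : ℝ) else 0))
            • ∑ a, ∑ x', (if ∀ i : Fin n, S i.succ → x' i = y i.succ then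
              T a j x' v' * ρ (Fin.cons a x') * T a j x' v' else 0)
            = ∑ a, ∑ v' : Fin n → Fin (m + 1),
            ((2 : ℝ) ^ (δ * ∑ i : Fin n, if S i.succ then ((v' i : ℕ) : ℝ) else 0))
            • ∑ x', (if ∀ i : Fin n, S i.succ → x' i = y i.succ then
              T a j x' v' * ρ (Fin.cons a x') * T a j x' v' else 0) := by
          intro j
          rw [Finset.sum_comm]
          simp only [Finset.smul_sum]
        simp only [e]
        rw [Finset.sum_comm]
        refine (Finset.sum_le_sum fun a _ => Finset.sum_le_sum fun j _ => key a j).trans ?_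
        have h2 := smul_le_smul_matrix hsubs hα
        have e3 : ∑ a, ∑ j : Fin (m + 1), ((α * (c * (2 : ℝ) ^ (-(δ * (j : ℕ))))) • B a j
            + β • (B a j * H a * B a j))
            = α • (∑ a, ∑ j : Fin (m + 1), (c * (2 : ℝ) ^ (-(δ * (j : ℕ)))) • B a j)
              + β • (P * (∑ x, ρ x) * P) := by
          rw [← hHs]
          simp only [Finset.sum_add_distrib, Finset.smul_sum, smul_smul]
          congr 1
          refine Finset.sum_congr rfl fun a _ => ?_
          rw [← Finset.smul_sum, hBHs]
        rw [e3]
        refine (add_le_add h2 le_rfl).trans (le_of_eq ?_)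
        rw [smul_add, smul_smul, smul_smul, add_assoc, ← add_smul, ← sum_fin_succ_fun]
    · intro b t hb ht hbx
      have hsum : ∀ (j : Fin (m + 1)) (v' : Fin n → Fin (m + 1)),
          ∑ i, (((Fin.cons j v' : Fin (n + 1) → Fin (m + 1)) i : ℕ) : ℝ)
            = ((j : ℕ) : ℝ) + ∑ i : Fin n, ((v' i : ℕ) : ℝ) := fun j v' => by
        rw [Fin.sum_univ_succ]; simp
      rw [sum_fin_succ_fun]
      simp only [Fin.cons_zero, Fin.tail_cons, sum_fin_succ_fun, hsum]
      have e : ∀ (j : Fin (m + 1)) (v' : Fin n → Fin (m + 1)),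
          c * (2 : ℝ) ^ (-(δ * (((j : ℕ) : ℝ) + ∑ i, ((v' i : ℕ) : ℝ))))
            = c * (2 : ℝ) ^ (-(δ * (j : ℕ))) * (2 : ℝ) ^ (-(δ * ∑ i, ((v' i : ℕ) : ℝ))) := by
        intro j v'
        rw [mul_assoc, ← Real.rpow_add (by norm_num)]
        congr 2; ring
      simp only [e]
      have e2 : ∀ (j : Fin (m + 1)), ∑ v' : Fin n → Fin (m + 1),
          (if t < c * (2 : ℝ) ^ (-(δ * (j : ℕ))) * (2 : ℝ) ^ (-(δ * ∑ i, ((v' i : ℕ) : ℝ))) then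
            ∑ a, ∑ x', rtr (T a j x' v' * ρ (Fin.cons a x') * T a j x' v') else 0)
          = ∑ a, ∑ v' : Fin n → Fin (m + 1),
          (if t < c * (2 : ℝ) ^ (-(δ * (j : ℕ))) * (2 : ℝ) ^ (-(δ * ∑ i, ((v' i : ℕ) : ℝ))) then
            ∑ x', rtr (T a j x' v' * ρ (Fin.cons a x') * T a j x' v') else 0) := by
        intro j
        rw [Finset.sum_comm]
        refine Finset.sum_congr rfl fun v' _ => ?_
        split_ifs <;> simp
      simp only [e2]
      rw [Finset.sum_comm]
      have key : ∀ a (j : Fin (m + 1)), ∑ v' : Fin n → Fin (m + 1),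
          (if t < c * (2 : ℝ) ^ (-(δ * (j : ℕ))) * (2 : ℝ) ^ (-(δ * ∑ i, ((v' i : ℕ) : ℝ))) then
            ∑ x', rtr (T a j x' v' * ρ (Fin.cons a x') * T a j x' v') else 0)
          ≤ b / t * (rtr ((c * (2 : ℝ) ^ (-(δ * (j : ℕ)))) • B a j)
            + n * (2 : ℝ) ^ δ * rtr (B a j * H a * B a j)) := by
        intro a j
        have := (hT a j).low_weight b t hb ht (fun x' => by
          rw [← hBMB]
          have := conj_herm_le (hbx (Fin.cons a x')) (hBh a j)
          rwa [Matrix.mul_smul, Matrix.smul_mul, hBP, hBB1] at this)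
        simp only [hH]
        rwa [hBMB, map_smul, smul_eq_mul]
      refine (Finset.sum_le_sum fun a _ => Finset.sum_le_sum fun j _ => key a j).trans ?_
      simp only [← Finset.mul_sum, Finset.sum_add_distrib, ← map_sum, hBHs, hHs]
      have h3 := rtr_mono hsubs
      rw [map_add, map_smul, map_smul, smul_eq_mul, smul_eq_mul] at h3
      refine mul_le_mul_of_nonneg_left ?_ (by positivity)
      rw [← sum_fin_succ_fun]
      push_cast
      linarith

end

/-! ### Growth of the coefficients and constraints on samplers of small size -/

section

theorem natCast_le_three_halves_pow (k : ℕ) : (k : ℝ) ≤ (3 / 2 : ℝ) ^ k := by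
  have h : ∀ k : ℕ, ((k + 2 : ℕ) : ℝ) ≤ (3 / 2 : ℝ) ^ (k + 2) := by
    intro k
    induction k with
    | zero => norm_num
    | succ k ih =>
      rw [show k + 1 + 2 = (k + 2) + 1 from rfl, pow_succ]
      push_cast at ih ⊢
      have : (0 : ℝ) ≤ k := k.cast_nonneg
      linarith
  match k with
  | 0 => norm_num
  | 1 => norm_num
  | k + 2 => exact h k

/-- Here `k` measures the leading run of unsampled positions and `j` the rest. Along the run the
second coefficient gains `2 ^ δ` times the first at each position. The next sampled position merges
the two, costing `2 ^ δ (k + 1)`, and `k + 1 ≤ (3 / 2) ^ (k + 1)` spreads the factor over the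
positions of the run, so the total does not depend on how the sample is arranged. -/
theorem exists_runCoef_le {δ : ℝ} (hδ : 0 ≤ δ) : ∀ {n : ℕ} (S : Fin n → Bool),
    ∃ k j : ℕ, k + j = n + 1 ∧
      (runCoef δ S).1 ≤ (2 : ℝ) ^ (δ * ((∑ i, if S i then (1 : ℝ) else 0) - 1)) * (3 / 2) ^ j ∧
      (runCoef δ S).2 ≤ (2 : ℝ) ^ δ * k *
        ((2 : ℝ) ^ (δ * ((∑ i, if S i then (1 : ℝ) else 0) - 1)) * (3 / 2) ^ j)
  | 0, S => by
    -- The empty string starts with `k = 1`: its second coefficient is `1`, which `2 ^ δ * 2 ^ (-δ)`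
    -- matches exactly.
    refine ⟨1, 0, rfl, ?_, ?_⟩
    · simp only [runCoef]; positivity
    · simp only [runCoef, Finset.univ_eq_empty, Finset.sum_empty, pow_zero, mul_one,
        Nat.cast_one]
      rw [← Real.rpow_add (by norm_num)]
      simp
  | n + 1, S => by
    obtain ⟨k, j, hkj, h1, h2⟩ := exists_runCoef_le hδ (fun i => S i.succ)
    rw [Fin.sum_univ_succ]
    set s := ∑ i : Fin n, if S i.succ then (1 : ℝ) else 0 with hs
    simp only [runCoef]
    by_cases h0 : S 0 = true
    · simp only [h0, if_true]
      refine ⟨0, k + 1 + j, by omega, ?_, by simp⟩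
      have hx : (1 : ℝ) ≤ (2 : ℝ) ^ δ := Real.one_le_rpow (by norm_num) hδ
      have e : (2 : ℝ) ^ (δ * (1 + s - 1)) = 2 ^ δ * 2 ^ (δ * (s - 1)) := by
        rw [← Real.rpow_add (by norm_num)]; congr 1; ring
      have hk := natCast_le_three_halves_pow (k + 1)
      push_cast at hk
      rw [e, pow_add]
      set G := (2 : ℝ) ^ (δ * (s - 1)) * (3 / 2) ^ j with hG
      have hG0 : 0 ≤ G := by positivity
      calc _ ≤ G + 2 ^ δ * k * G := add_le_add h1 h2
        _ ≤ 2 ^ δ * G + 2 ^ δ * k * G := by nlinarith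
        _ = (2 ^ δ * G) * (k + 1) := by ring
        _ ≤ (2 ^ δ * G) * (3 / 2) ^ (k + 1) := mul_le_mul_of_nonneg_left hk (by positivity)
        _ = _ := by rw [hG]; ring
    · simp only [h0, if_false, Bool.false_eq_true, zero_add]
      refine ⟨k + 1, j, by omega, h1, ?_⟩
      push_cast
      have := mul_le_mul_of_nonneg_right h1 (Real.rpow_nonneg (by norm_num : (0:ℝ) ≤ 2) δ)
      linarith

theorem runCoef_add_le {δ : ℝ} (hδ : 0 ≤ δ) {n : ℕ} (S : Fin n → Bool) :
    (runCoef δ S).1 + (runCoef δ S).2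
      ≤ (2 : ℝ) ^ (δ * ∑ i, if S i then (1 : ℝ) else 0) * (3 / 2) ^ (n + 2) := by
  obtain ⟨k, j, hkj, h1, h2⟩ := exists_runCoef_le hδ S
  set s := ∑ i, if S i then (1 : ℝ) else 0 with hs
  have hx : (1 : ℝ) ≤ (2 : ℝ) ^ δ := Real.one_le_rpow (by norm_num) hδ
  have e : (2 : ℝ) ^ (δ * s) = 2 ^ δ * 2 ^ (δ * (s - 1)) := by
    rw [← Real.rpow_add (by norm_num)]; congr 1; ring
  have hk := natCast_le_three_halves_pow (k + 1)
  push_cast at hk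
  rw [e, show n + 2 = (k + 1) + j by omega, pow_add]
  set G := (2 : ℝ) ^ (δ * (s - 1)) * (3 / 2) ^ j with hG
  have hG0 : 0 ≤ G := by positivity
  calc _ ≤ G + 2 ^ δ * k * G := add_le_add h1 h2
    _ ≤ 2 ^ δ * G + 2 ^ δ * k * G := by nlinarith
    _ = (2 ^ δ * G) * (k + 1) := by ring
    _ ≤ (2 ^ δ * G) * (3 / 2) ^ (k + 1) := mul_le_mul_of_nonneg_left hk (by positivity)
    _ = _ := by rw [hG]; ring

theorem IsSampler.eps_nonneg {n r : ℕ} {ξ ε : ℝ} {P : Subsets n r → ℝ}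
    (hP : IsSampler n r ξ ε P) : 0 ≤ ε :=
  (Finset.sum_nonneg fun S _ => hP.mem_stdSimplex.1 S).trans
    (hP.prob_le (fun _ => 0) (fun _ => by simp))

/-- A sampler misses some set of `k ≥ ξ n` positions with at least the average probability. -/
theorem IsSampler.choose_le {n r : ℕ} {ξ ε : ℝ} {P : Subsets n r → ℝ}
    (hP : IsSampler n r ξ ε P) (hn : 0 < n) {k : ℕ} (hk : ξ * n ≤ k) :
    ((n - r).choose k : ℝ) ≤ ε * n.choose k := by
  classical
  have h1 : ∀ T ∈ Finset.powersetCard k (Finset.univ : Finset (Fin n)),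
      ∑ S : Subsets n r, (if Disjoint S.1 T then P S else 0) ≤ ε := by
    intro T hT
    have hTc := (Finset.mem_powersetCard.1 hT).2
    -- For the indicator of `T`, a sample disjoint from `T` has average `0`, while the full average
    -- is `k / n ≥ ξ`. Averaging over all `T` of size `k` then counts the sets avoiding a fixed
    -- sample.
    refine le_trans ?_ (hP.prob_le (fun i => if i ∈ T then 1 else 0)
      (fun i => by split_ifs <;> simp))
    rw [Finset.sum_filter]
    refine Finset.sum_le_sum fun S _ => ?_
    have hPS := hP.mem_stdSimplex.1 S
    split_ifs with hd hc hc
    · exact le_rfl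
    · exfalso
      apply hc
      have e1 : ∑ i ∈ S.1, (if i ∈ T then (1 : ℝ) else 0) = 0 :=
        Finset.sum_eq_zero fun i hi => by
          rw [if_neg (Finset.disjoint_left.1 hd hi)]
      have e2 : ∑ i, (if i ∈ T then (1 : ℝ) else 0) = k := by
        simp [hTc]
      rw [e1, e2, zero_div, sub_nonneg, le_div_iff₀ (by exact_mod_cast hn)]
      exact hk
    · exact hPS
    · exact le_rfl
  have h2 := Finset.sum_le_sum h1
  rw [Finset.sum_const, Finset.card_powersetCard, Finset.card_univ, Fintype.card_fin,
    nsmul_eq_mul, Finset.sum_comm] at h2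
  have h3 : ∀ S : Subsets n r, ∑ T ∈ Finset.powersetCard k (Finset.univ : Finset (Fin n)),
      (if Disjoint S.1 T then P S else 0) = ((n - r).choose k : ℝ) * P S := by
    intro S
    rw [← Finset.sum_filter, Finset.sum_const, nsmul_eq_mul]
    congr 2
    have : Finset.filter (fun T => Disjoint S.1 T)
        (Finset.powersetCard k (Finset.univ : Finset (Fin n)))
        = Finset.powersetCard k (S.1)ᶜ := by
      ext T
      simp only [Finset.mem_filter, Finset.mem_powersetCard, Finset.subset_univ, true_and]
      rw [and_comm, Finset.subset_compl_iff_disjoint_left]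
    rw [this, Finset.card_powersetCard, Finset.card_compl, S.2, Fintype.card_fin]
  simp only [h3] at h2
  rw [← Finset.mul_sum, hP.mem_stdSimplex.2, mul_one] at h2
  linarith

theorem choose_le_of_descFactorial_le {n r k : ℕ}
    (h : n.descFactorial k ≤ 81 * (n - r).descFactorial k) :
    n.choose k ≤ 81 * (n - r).choose k := by
  rw [Nat.descFactorial_eq_factorial_mul_choose, Nat.descFactorial_eq_factorial_mul_choose,
    mul_left_comm] at h
  exact Nat.le_of_mul_le_mul_left h (Nat.factorial_pos k)

/-- A finite check; `k` is `(n - 2 r) / 6` rounded up. Falling factorials avoid evaluating binomial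
coefficients. -/
theorem choose_le_of_two_mul_lt {n r : ℕ} (hn : n ≤ 60) (hr : 2 * r < n) :
    n.choose ((n - 2 * r + 5) / 6) ≤ 81 * (n - r).choose ((n - 2 * r + 5) / 6) := by
  apply choose_le_of_descFactorial_le
  have : ∀ n < 61, ∀ r < 30, 2 * r < n → n.descFactorial ((n - 2 * r + 5) / 6)
      ≤ 81 * (n - r).descFactorial ((n - 2 * r + 5) / 6) := by decide +kernel
  exact this n (by omega) r (by omega) hr

theorem choose_le_of_lt {n r : ℕ} (hn : n ≤ 12) (hr : r < n) :
    n.choose ((n - r + 2) / 3) ≤ 81 * (n - r).choose ((n - r + 2) / 3) := by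
  apply choose_le_of_descFactorial_le
  have : ∀ n < 13, ∀ r < n, n.descFactorial ((n - r + 2) / 3)
      ≤ 81 * (n - r).descFactorial ((n - r + 2) / 3) := by decide +kernel
  exact this n (by omega) r hr

/-- The threshold `1 / 81` is where `3 ε ^ (1 / 4)` reaches `1`, beyond which smoothing alone makes
the entropy bound trivial. -/
theorem IsSampler.not_choose_le {n r : ℕ} {ξ ε : ℝ} {P : Subsets n r → ℝ}
    (hP : IsSampler n r ξ ε P) (hn : 0 < n) (hε : ε < 1 / 81) {k : ℕ} (hkn : k ≤ n)
    (hk : ξ * n ≤ k) : ¬ n.choose k ≤ 81 * (n - r).choose k := by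
  intro h
  have h1 := hP.choose_le hn hk
  have h2 : (n.choose k : ℝ) ≤ 81 * (n - r).choose k := by exact_mod_cast h
  have h3 : (0 : ℝ) < n.choose k := by exact_mod_cast Nat.choose_pos hkn
  nlinarith

theorem natCast_le_div_mul (a b : ℕ) (hb : 0 < b) : (a : ℝ) ≤ b * ((a + (b - 1)) / b : ℕ) := by
  have : a ≤ b * ((a + (b - 1)) / b) := by
    have h1 := Nat.div_add_mod (a + (b - 1)) b
    have h2 := Nat.mod_lt (a + (b - 1)) hb
    omega
  exact_mod_cast this

theorem IsSampler.sixty_lt {n r : ℕ} {ξ ε : ℝ} {P : Subsets n r → ℝ}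
    (hP : IsSampler n r ξ ε P) (hn : 0 < n) (hε : ε < 1 / 81) (hξ0 : 0 < ξ)
    (hξ : 6 * ξ * n + 2 * r < n) : 60 < n := by
  by_contra hcon
  push Not at hcon
  have hn' : (0 : ℝ) < n := by exact_mod_cast hn
  have hr : 2 * r < n := by
    have : (2 * r : ℝ) < n := by nlinarith
    exact_mod_cast this
  refine hP.not_choose_le hn hε (k := (n - 2 * r + 5) / 6) (by omega) ?_
    (choose_le_of_two_mul_lt hcon hr)
  have := natCast_le_div_mul (n - 2 * r) 6 (by norm_num)
  rw [Nat.cast_sub hr.le] at this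
  push_cast at this ⊢
  norm_num at this ⊢
  linarith

theorem IsSampler.twelve_lt {n r : ℕ} {ξ ε : ℝ} {P : Subsets n r → ℝ}
    (hP : IsSampler n r ξ ε P) (hn : 0 < n) (hε : ε < 1 / 81) (hξ0 : 0 < ξ)
    (hξ : 3 * ξ * n + r < n) : 12 < n := by
  by_contra hcon
  push Not at hcon
  have hn' : (0 : ℝ) < n := by exact_mod_cast hn
  have hr : r < n := by
    have : (r : ℝ) < n := by nlinarith
    exact_mod_cast this
  refine hP.not_choose_le hn hε (k := (n - r + 2) / 3) (by omega) ?_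
    (choose_le_of_lt hcon hr)
  have := natCast_le_div_mul (n - r) 3 (by norm_num)
  rw [Nat.cast_sub hr.le] at this
  push_cast at this ⊢
  norm_num at this ⊢
  linarith

/-- Some set of `n - r` positions is missed with probability at least `1 / n.choose r`. The
resulting `ε ≥ 2 ^ (-n)` keeps the block length, of order `ε ^ (-1 / 4)`, exponential in `n` with a
small base. -/
theorem IsSampler.one_le_eps_mul {n r : ℕ} {ξ ε : ℝ} {P : Subsets n r → ℝ}
    (hP : IsSampler n r ξ ε P) (hn : 0 < n) (hξ0 : 0 < ξ) (hξ : 3 * ξ * n + r < n) :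
    1 ≤ ε * 2 ^ n := by
  have hn' : (0 : ℝ) < n := by exact_mod_cast hn
  have hr : r < n := by
    have : (r : ℝ) < n := by nlinarith
    exact_mod_cast this
  have h := hP.choose_le hn (k := n - r) (by rw [Nat.cast_sub hr.le]; nlinarith)
  rw [Nat.choose_self, Nat.cast_one] at h
  refine h.trans (mul_le_mul_of_nonneg_left ?_ hP.eps_nonneg)
  exact_mod_cast Nat.choose_le_two_pow n (n - r)

end

/-! ### Near and far couplings between spectral groups -/

section

open Matrix

variable {E : Type*} [Fintype E] [DecidableEq E]

theorem IsContr.rtr_near_le {C ρ A N : Matrix E E ℂ} (hC : IsContr C) (hρ : ρ.PosSemidef)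
    (hA : Aᴴ = A) (hN : Nᴴ = N) :
    rtr (C * (A * ρ * N)) ≤ (rtr (A * ρ * A) + rtr (N * ρ * N)) / 2 := by
  have h := two_mul_rtr_le hρ (C * A) N one_pos
  have e1 : C * A * ρ * (C * A)ᴴ = C * (A * ρ * A) * Cᴴ := by
    simp only [Matrix.conjTranspose_mul, hA, Matrix.mul_assoc]
  have e2 : C * A * ρ * N = C * (A * ρ * N) := by simp only [Matrix.mul_assoc]
  have h1 := hC.rtr_conj_le (conj_posSemidef hρ hA)
  rw [e1, e2, hN] at h
  simp only [one_mul, inv_one] at h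
  linarith

/-- Cauchy-Schwarz puts the contraction next to `F`, where `ρ ≤ b • σ` and `σ` is at most `φ`. The
second term thus involves only the rank of `A`, not the weight of `ρ` on `A`; the weight `s` is
optimised later. -/
theorem IsContr.rtr_far_le {C ρ σ A F : Matrix E E ℂ} (hC : IsContr C) (hρ : ρ.PosSemidef)
    (hA : Aᴴ = A) (hA2 : A * A = A) (hF : Fᴴ = F) {b φ s : ℝ} (hb : 0 ≤ b)
    (hρσ : ρ ≤ b • σ) (hFσ : F * σ * F ≤ φ • 1) (hφ : 0 ≤ φ) (hs : 0 < s) :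
    rtr (C * (A * ρ * F)) ≤ (s * rtr (A * ρ * A) + s⁻¹ * (b * (φ * rtr A))) / 2 := by
  have h := two_mul_rtr_le hρ A (F * C * A) hs
  have e0 : rtr (A * ρ * (F * C * A)) = rtr (C * (A * ρ * F)) := by
    have : A * ρ * (F * C * A) = (A * ρ * F * C) * A := by simp only [Matrix.mul_assoc]
    rw [this, rtr_mul_comm]
    have : A * (A * ρ * F * C) = (A * A) * ρ * F * C := by simp only [Matrix.mul_assoc]
    rw [this, hA2, rtr_mul_comm]
  have e1 : (F * C * A)ᴴ * ρ * (F * C * A) = (C * A)ᴴ * (F * ρ * F) * (C * A) := by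
    simp only [Matrix.conjTranspose_mul, hF, Matrix.mul_assoc]
  have h1 : F * ρ * F ≤ (b * φ) • (1 : Matrix E E ℂ) := by
    refine (conj_herm_le hρσ hF).trans ?_
    rw [Matrix.mul_smul, Matrix.smul_mul, ← smul_smul]
    exact smul_le_smul_matrix hFσ hb
  have h2 : rtr ((C * A)ᴴ * (F * ρ * F) * (C * A)) ≤ b * (φ * rtr A) := by
    have h3 := conj_le_conj h1 (C * A)ᴴ
    rw [Matrix.conjTranspose_conjTranspose] at h3
    refine (rtr_mono h3).trans ?_
    rw [Matrix.mul_smul, Matrix.smul_mul, map_smul, Matrix.mul_one, smul_eq_mul, mul_assoc]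
    refine mul_le_mul_of_nonneg_left (mul_le_mul_of_nonneg_left ?_ hφ) hb
    rw [rtr_mul_comm, Matrix.conjTranspose_mul, hA]
    have : C * A * (A * Cᴴ) = C * (A * A) * Cᴴ := by simp only [Matrix.mul_assoc]
    rw [this, hA2]
    refine hC.rtr_conj_le ?_
    have := posSemidef_conjTranspose_mul_self A
    rwa [hA, hA2] at this
  rw [e0, e1, hA] at h
  have h4 : s⁻¹ * rtr ((C * A)ᴴ * (F * ρ * F) * (C * A)) ≤ s⁻¹ * (b * (φ * rtr A)) :=
    mul_le_mul_of_nonneg_left h2 (by positivity)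
  linarith

theorem rtr_mul_mul_mul_symm {C ρ A F : Matrix E E ℂ} (hρ : ρ.PosSemidef) (hA : Aᴴ = A)
    (hF : Fᴴ = F) : rtr (C * (F * ρ * A)) = rtr (Cᴴ * (A * ρ * F)) := by
  rw [← rtr_conjTranspose, rtr_mul_comm Cᴴ]
  simp only [Matrix.conjTranspose_mul, hA, hF, hρ.isHermitian.eq, Matrix.mul_assoc]

/-- A boundary separates groups `g` and `g + 1` exactly when `B` divides `g + o + 1`, which fixes
`o` modulo `B`. -/
theorem card_cut_le_one (B g : ℕ) :
    ((Finset.range B).filter fun o => (g + 1 + o) / B ≠ (g + o) / B).card ≤ 1 := by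
  rw [Finset.card_le_one]
  have key : ∀ o, (g + 1 + o) / B ≠ (g + o) / B → B ∣ g + o + 1 := by
    intro o h
    by_contra hd
    apply h
    rw [show g + 1 + o = g + o + 1 by ring, Nat.succ_div, if_neg hd, add_zero]
  intro o ho o' ho'
  simp only [Finset.mem_filter, Finset.mem_range] at ho ho'
  have h1 := key o ho.2
  have h2 := key o' ho'.2
  rcases le_total o o' with h | h
  · have := (Nat.dvd_sub h2 h1)
    rw [show g + o' + 1 - (g + o + 1) = o' - o by omega] at this
    have := Nat.eq_zero_of_dvd_of_lt this (by omega)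
    omega
  · have := (Nat.dvd_sub h1 h2)
    rw [show g + o + 1 - (g + o' + 1) = o - o' by omega] at this
    have := Nat.eq_zero_of_dvd_of_lt this (by omega)
    omega

/-- Splitting an operator into the blocks `sb` of consecutive groups, the couplings of adjacent
groups and the couplings of remote groups. -/
theorem specDiag_block_decomposition (U : unitaryGroup E ℂ) (grp : E → ℕ) (sb : ℕ → ℕ) {G : ℕ}
    (hG : ∀ e, grp e < G) (hGs : ∀ e, sb (grp e) < G) (ρ : Matrix E E ℂ) :
    ρ - ∑ β ∈ Finset.range G, specDiag U (fun e => if sb (grp e) = β then 1 else 0) * ρ *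
        specDiag U (fun e => if sb (grp e) = β then 1 else 0)
      = ∑ g ∈ Finset.range G,
        (specDiag U (fun e => if grp e = g then 1 else 0) * ρ *
            specDiag U (fun e => if g < grp e ∧ sb (grp e) ≠ sb g then 1 else 0)
          + specDiag U (fun e => if g < grp e ∧ sb (grp e) ≠ sb g then 1 else 0) * ρ *
            specDiag U (fun e => if grp e = g then 1 else 0)) := by
  -- The kernel identity is: for two basis vectors, either their blocks agree, or the blocks differ
  -- and the group of one of them is strictly smaller.
  have h := sum_specDiag_mul_mul_congr U (Finset.univ : Finset Unit)
    (Finset.range G ×ˢ (Finset.univ : Finset (Fin 3)))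
    (fun _ _ => 1) (fun _ _ => 1)
    (fun p e => ![if sb (grp e) = p.1 then 1 else 0, if grp e = p.1 then 1 else 0,
      if p.1 < grp e ∧ sb (grp e) ≠ sb p.1 then 1 else 0] p.2)
    (fun p e => ![if sb (grp e) = p.1 then 1 else 0,
      if p.1 < grp e ∧ sb (grp e) ≠ sb p.1 then 1 else 0, if grp e = p.1 then 1 else 0] p.2)
    (by
      intro e e'
      rw [Finset.sum_product]
      simp only [Fin.sum_univ_three, Finset.sum_add_distrib]
      simp only [Matrix.cons_val_zero, Matrix.cons_val_one, Matrix.cons_val, mul_one,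
        Finset.univ_unique, Finset.sum_singleton]
      have aux : ∀ {k : ℕ} (_ : k < G) (F : ℕ → ℝ),
          ∑ x ∈ Finset.range G, (if k = x then (1 : ℝ) else 0) * F x = F k := by
        intro k hk F
        simp [ite_mul, hk]
      have aux' : ∀ {k : ℕ} (_ : k < G) (F : ℕ → ℝ),
          ∑ x ∈ Finset.range G, F x * (if k = x then (1 : ℝ) else 0) = F k := by
        intro k hk F
        simp [mul_ite, hk]
      rw [aux (hGs e), aux (hG e), aux' (hG e')]
      rcases lt_trichotomy (grp e) (grp e') with h | h | h
      · by_cases h2 : sb (grp e) = sb (grp e')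
        · simp [h2]
        · simp [h, h2, Ne.symm h2, h.not_gt]
      · simp [h]
      · by_cases h2 : sb (grp e) = sb (grp e')
        · simp [h2]
        · simp [h, h2, Ne.symm h2, h.not_gt]) ρ
  rw [Finset.sum_product] at h
  simp only [Fin.sum_univ_three, Finset.univ_unique, Finset.sum_singleton, specDiag_one,
    Matrix.one_mul, Matrix.mul_one, Matrix.cons_val_zero, Matrix.cons_val_one,
    Matrix.cons_val] at h
  rw [sub_eq_iff_eq_add]
  conv_lhs => rw [h]
  simp only [Finset.sum_add_distrib]
  abel

end

/-! ### Pinching to blocks of spectral groups -/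

section

open Matrix

variable {E : Type*} [Fintype E] [DecidableEq E]

/-- The indicator projection of a set of basis vectors. -/
def indProj (U : unitaryGroup E ℂ) (p : E → Prop) [DecidablePred p] : Matrix E E ℂ :=
  specDiag U (fun e => if p e then 1 else 0)

section indProj

variable (U : unitaryGroup E ℂ) (p q : E → Prop) [DecidablePred p] [DecidablePred q]

theorem indProj_herm : (indProj U p)ᴴ = indProj U p := specDiag_conjTranspose U _

theorem indProj_mul (f : E → ℝ) :
    indProj U p * specDiag U f = specDiag U (fun e => if p e then f e else 0) := by
  rw [indProj, specDiag_mul]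
  refine congrArg (specDiag U) (funext fun e => ?_)
  split_ifs <;> simp

theorem indProj_idem : indProj U p * indProj U p = indProj U p := by
  unfold indProj
  rw [specDiag_mul]
  refine congrArg (specDiag U) (funext fun e => ?_)
  split_ifs <;> simp

theorem indProj_conj (f : E → ℝ) : indProj U p * specDiag U f * indProj U p
    = specDiag U (fun e => if p e then f e else 0) := by
  rw [indProj_mul, indProj, specDiag_mul]
  refine congrArg (specDiag U) (funext fun e => ?_)
  split_ifs <;> simp

theorem rtr_indProj_conj (ρ : Matrix E E ℂ) :
    rtr (indProj U p * ρ * indProj U p) = rtr (ρ * indProj U p) := by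
  rw [Matrix.mul_assoc, rtr_mul_comm, Matrix.mul_assoc, indProj_idem]

end indProj

theorem sum_rtr_group (U : unitaryGroup E ℂ) (grp : E → ℕ) {G : ℕ} (hG : ∀ e, grp e < G)
    (ρ : Matrix E E ℂ) :
    ∑ g ∈ Finset.range G, rtr (indProj U (fun e => grp e = g) * ρ *
      indProj U (fun e => grp e = g)) = rtr ρ := by
  simp only [rtr_indProj_conj]
  rw [← map_sum, ← Finset.mul_sum]
  simp only [indProj]
  rw [specDiag_sum]
  have : (fun e => ∑ i ∈ Finset.range G, if grp e = i then (1 : ℝ) else 0) = fun _ => 1 := by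
    funext e
    simp [hG]
  rw [this, specDiag_one, Matrix.mul_one]

/-- Each pair of adjacent groups is separated for at most one of the `B` offsets, so some offset has
total adjacent coupling at most `2 / B` times the trace. Groups at distance two or more are
separated by a full group of `a` dyadic bands, which gives the factor `2 ^ (-a)`. The value of `S`
balances the two terms of the far bound after summing over `x`. -/
theorem exists_offset_pinch_le {ι : Type*} [Fintype ι] (U : unitaryGroup E ℂ)
    (s : E → ℝ) (lab : E → ℕ) (hs1 : ∀ e, 4 * (1 / 2 : ℝ) ^ (lab e + 1) < s e)
    (hs2 : ∀ e, s e ≤ 4 * (1 / 2 : ℝ) ^ lab e) (ρ : ι → Matrix E E ℂ)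
    (hρ : ∀ x, (ρ x).PosSemidef) {b : ℝ} (hb : 0 ≤ b) (hρb : ∀ x, ρ x ≤ b • specDiag U s)
    (hρs : ∑ x, ρ x ≤ specDiag U s) {a B : ℕ} (ha : 0 < a) (hB : 0 < B) {S : ℝ} (hS : 0 < S)
    (hSS : S ^ 2 = Fintype.card ι * b * (1 / 2) ^ a) {G : ℕ} (hG : ∀ e, lab e / a + B < G) :
    ∃ o < B, ∀ C : ι → Matrix E E ℂ, (∀ x, IsContr (C x)) →
      ∑ x, rtr (C x * (ρ x - ∑ β ∈ Finset.range G,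
        indProj U (fun e => (lab e / a + o) / B = β) * ρ x *
          indProj U (fun e => (lab e / a + o) / B = β)))
      ≤ 2 * (∑ x, rtr (ρ x)) / B + 2 * S * ∑ e, s e := by
  set grp : E → ℕ := fun e => lab e / a with hgrp
  set A : ℕ → Matrix E E ℂ := fun g => indProj U (fun e => grp e = g) with hA
  have hAh : ∀ g, (A g)ᴴ = A g := fun g => indProj_herm U _
  have hAi : ∀ g, A g * A g = A g := fun g => indProj_idem U _
  set w : ι → ℕ → ℝ := fun x g => rtr (A g * ρ x * A g) with hw
  have hw0 : ∀ x g, 0 ≤ w x g := fun x g => rtr_nonneg (conj_posSemidef (hρ x) (hAh g))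
  set p : ℕ → ℝ := fun g => ∑ e, if grp e = g then s e else 0 with hp
  set R := ∑ x, rtr (ρ x) with hR
  have hgG : ∀ e, grp e < G := fun e => by have := hG e; simp only [hgrp]; omega
  have hwsum : ∀ x, ∑ g ∈ Finset.range G, w x g = rtr (ρ x) := fun x =>
    sum_rtr_group U grp hgG (ρ x)
  have hwsum1 : ∀ x, ∑ g ∈ Finset.range G, w x (g + 1) ≤ rtr (ρ x) := fun x => by
    have := sum_rtr_group U grp (G := G + 1) (fun e => (hgG e).trans (Nat.lt_succ_self _)) (ρ x)
    rw [Finset.sum_range_succ'] at this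
    have h0 := hw0 x 0
    simp only [hw, hA] at h0 ⊢
    linarith
  have hwp : ∀ g, ∑ x, w x g ≤ p g := by
    intro g
    have h1 := rtr_mono (conj_herm_le hρs (hAh g))
    simp only [hA] at h1
    rw [indProj_conj, rtr_specDiag, Finset.mul_sum, Finset.sum_mul, map_sum] at h1
    exact h1
  have hpsum : ∑ g ∈ Finset.range G, p g = ∑ e, s e := by
    simp only [hp]
    rw [Finset.sum_comm]
    refine Finset.sum_congr rfl fun e _ => ?_
    simp [hgG]
  set near : ℕ → ℝ := fun o => ∑ x, ∑ g ∈ Finset.range G,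
    (if (g + 1 + o) / B ≠ (g + o) / B then w x g + w x (g + 1) else 0) with hnear
  have hnsum : ∑ o ∈ Finset.range B, near o ≤ ∑ o ∈ Finset.range B, 2 * R / B := by
    rw [Finset.sum_const, Finset.card_range, nsmul_eq_mul,
      mul_div_cancel₀ _ (by exact_mod_cast hB.ne')]
    simp only [hnear]
    rw [Finset.sum_comm, hR, Finset.mul_sum]
    refine Finset.sum_le_sum fun x _ => ?_
    rw [Finset.sum_comm]
    have h1 : ∀ g ∈ Finset.range G, ∑ o ∈ Finset.range B,
        (if (g + 1 + o) / B ≠ (g + o) / B then w x g + w x (g + 1) else 0)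
        ≤ w x g + w x (g + 1) := by
      intro g _
      rw [← Finset.sum_filter, Finset.sum_const, nsmul_eq_mul]
      have h2 : (((Finset.range B).filter fun o => (g + 1 + o) / B ≠ (g + o) / B).card : ℝ)
          ≤ 1 := by exact_mod_cast card_cut_le_one B g
      have := mul_le_mul_of_nonneg_right h2 (add_nonneg (hw0 x g) (hw0 x (g + 1)))
      linarith
    refine (Finset.sum_le_sum h1).trans ?_
    rw [Finset.sum_add_distrib, hwsum]
    have := hwsum1 x
    linarith
  -- The quantity `near` is free of the contractions, so one offset serves all of them.
  obtain ⟨o, ho, hno⟩ := Finset.exists_le_of_sum_le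
    (Finset.nonempty_range_iff.2 hB.ne') hnsum
  refine ⟨o, Finset.mem_range.1 ho, fun C hC => ?_⟩
  set sb : ℕ → ℕ := fun g => (g + o) / B with hsb
  have hsbG : ∀ e, sb (grp e) < G := fun e => by
    have := hG e
    have h1 : (grp e + o) / B ≤ grp e + o := Nat.div_le_self _ _
    have h2 := Finset.mem_range.1 ho
    simp only [hsb, hgrp] at h1 ⊢
    omega
  set F : ℕ → Matrix E E ℂ := fun g => indProj U (fun e => g + 2 ≤ grp e ∧ sb (grp e) ≠ sb g)
    with hF
  set N : ℕ → Matrix E E ℂ := fun g => if sb (g + 1) ≠ sb g then A (g + 1) else 0 with hN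
  have hFh : ∀ g, (F g)ᴴ = F g := fun g => indProj_herm U _
  have hNh : ∀ g, (N g)ᴴ = N g := fun g => by
    simp only [hN]; split_ifs
    · exact hAh _
    · simp
  have hM : ∀ g, specDiag U (fun e => if g < grp e ∧ sb (grp e) ≠ sb g then 1 else 0)
      = N g + F g := by
    intro g
    have h1 : N g = specDiag U (fun e => if grp e = g + 1 ∧ sb (g + 1) ≠ sb g then 1 else 0) := by
      simp only [hN, hA, indProj]
      split_ifs with h
      · simp [h]
      · simp [h, specDiag]
    have h2 := specDiag_sum U (Finset.univ : Finset (Fin 2))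
      (fun i e => ![if grp e = g + 1 ∧ sb (g + 1) ≠ sb g then (1 : ℝ) else 0,
        if g + 2 ≤ grp e ∧ sb (grp e) ≠ sb g then 1 else 0] i)
    simp only [Fin.sum_univ_two, Matrix.cons_val_zero, Matrix.cons_val_one] at h2
    rw [h1]
    simp only [hF, indProj]
    rw [h2]
    refine congrArg (specDiag U) (funext fun e => ?_)
    rcases lt_trichotomy (grp e) (g + 1) with h | h | h
    · simp [show ¬ g < grp e by omega, show ¬ grp e = g + 1 by omega,
        show ¬ g + 2 ≤ grp e by omega]
    · simp [h]
    · simp [show g < grp e by omega, show ¬ grp e = g + 1 by omega,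
        show g + 2 ≤ grp e by omega]
  have hdec : ∀ x, ρ x - ∑ β ∈ Finset.range G,
        indProj U (fun e => sb (grp e) = β) * ρ x * indProj U (fun e => sb (grp e) = β)
      = ∑ g ∈ Finset.range G, (A g * ρ x * (N g + F g) + (N g + F g) * ρ x * A g) := by
    intro x
    have := specDiag_block_decomposition U grp sb hgG hsbG (ρ x)
    simp only [hM] at this
    exact this
  -- This bounds the eigenvalues in groups from `g + 2` on. Those in group `g` exceed `4 * (1 / 2) ^
  -- (a * (g + 1))`, so the ratio is below `2 ^ (-a)`; for the adjacent group there would be no gap.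
  set φ : ℕ → ℝ := fun g => 4 * (1 / 2 : ℝ) ^ (a * (g + 2)) with hφ
  have hFσ : ∀ g, F g * specDiag U s * F g ≤ φ g • 1 := by
    intro g
    simp only [hF]
    rw [indProj_conj, ← specDiag_one U, specDiag_smul]
    refine specDiag_mono U fun e => ?_
    split_ifs with h
    · rw [mul_one]
      refine (hs2 e).trans ?_
      simp only [hφ]
      refine mul_le_mul_of_nonneg_left ?_ (by norm_num)
      refine pow_le_pow_of_le_one (by norm_num) (by norm_num) ?_
      calc a * (g + 2) ≤ a * grp e := Nat.mul_le_mul_left _ h.1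
        _ ≤ lab e := Nat.mul_div_le _ _
    · simp only [hφ]; positivity
  have hφA : ∀ g, φ g * rtr (A g) ≤ (1 / 2 : ℝ) ^ a * p g := by
    intro g
    simp only [hA, hp, indProj]
    rw [rtr_specDiag, Finset.mul_sum, Finset.mul_sum]
    refine Finset.sum_le_sum fun e _ => ?_
    split_ifs with h
    · simp only [hφ]
      have h1 := hs1 e
      have h2 : lab e + 1 ≤ a * (g + 1) := by
        rw [← h]
        have := Nat.lt_mul_div_succ (lab e) ha
        exact this
      have h3 : (1 / 2 : ℝ) ^ (a * (g + 1)) ≤ (1 / 2 : ℝ) ^ (lab e + 1) :=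
        pow_le_pow_of_le_one (by norm_num) (by norm_num) h2
      rw [show a * (g + 2) = a + a * (g + 1) by ring, pow_add, mul_one]
      have h4 : (0 : ℝ) < (1 / 2 : ℝ) ^ a := by positivity
      nlinarith
    · simp
  have hφ0 : ∀ g, 0 ≤ φ g := fun g => by simp only [hφ]; positivity
  have hterm : ∀ x g, rtr (C x * (A g * ρ x * (N g + F g) + (N g + F g) * ρ x * A g))
      ≤ (if (g + 1 + o) / B ≠ (g + o) / B then w x g + w x (g + 1) else 0)
        + (S * w x g + S⁻¹ * (b * ((1 / 2 : ℝ) ^ a * p g))) := by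
    intro x g
    have e1 : C x * (A g * ρ x * (N g + F g) + (N g + F g) * ρ x * A g)
        = C x * (A g * ρ x * N g) + C x * (A g * ρ x * F g) + C x * (N g * ρ x * A g)
          + C x * (F g * ρ x * A g) := by
      simp only [Matrix.mul_add, Matrix.add_mul]; abel
    have hfar : ∀ D, IsContr D → rtr (D * (A g * ρ x * F g))
        ≤ (S * w x g + S⁻¹ * (b * ((1 / 2 : ℝ) ^ a * p g))) / 2 := by
      intro D hD
      refine (hD.rtr_far_le (hρ x) (hAh g) (hAi g) (hFh g) hb (hρb x) (hFσ g) (hφ0 g) hS).trans ?_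
      have h1 : S⁻¹ * (b * (φ g * rtr (A g))) ≤ S⁻¹ * (b * ((1 / 2 : ℝ) ^ a * p g)) :=
        mul_le_mul_of_nonneg_left (mul_le_mul_of_nonneg_left (hφA g) hb) (by positivity)
      simp only [hw]
      linarith
    have hnr : ∀ D, IsContr D → rtr (D * (A g * ρ x * N g))
        ≤ (if (g + 1 + o) / B ≠ (g + o) / B then w x g + w x (g + 1) else 0) / 2 := by
      intro D hD
      by_cases h : (g + 1 + o) / B ≠ (g + o) / B
      · have hNA : N g = A (g + 1) := by simp only [hN, hsb]; rw [if_pos h]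
        rw [if_pos h, hNA]
        exact hD.rtr_near_le (hρ x) (hAh g) (hAh _)
      · have hNA : N g = 0 := by simp only [hN, hsb]; rw [if_neg h]
        rw [if_neg h, hNA]
        simp
    rw [e1, map_add, map_add, map_add, rtr_mul_mul_mul_symm (hρ x) (hAh g) (hNh g),
      rtr_mul_mul_mul_symm (hρ x) (hAh g) (hFh g)]
    have h1 := hfar _ (hC x)
    have h2 := hfar _ (hC x).conjTranspose
    have h3 := hnr _ (hC x)
    have h4 := hnr _ (hC x).conjTranspose
    linarith
  have hfin : ∑ x, rtr (C x * (ρ x - ∑ β ∈ Finset.range G,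
        indProj U (fun e => sb (grp e) = β) * ρ x * indProj U (fun e => sb (grp e) = β)))
      ≤ near o + ∑ x, ∑ g ∈ Finset.range G,
        (S * w x g + S⁻¹ * (b * ((1 / 2 : ℝ) ^ a * p g))) := by
    simp only [hnear]
    rw [← Finset.sum_add_distrib]
    refine Finset.sum_le_sum fun x _ => ?_
    rw [hdec, Finset.mul_sum, map_sum, ← Finset.sum_add_distrib]
    exact Finset.sum_le_sum fun g _ => hterm x g
  refine hfin.trans (add_le_add hno ?_)
  rw [Finset.sum_comm]
  rw [← hpsum, Finset.mul_sum]
  refine Finset.sum_le_sum fun g _ => ?_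
  rw [Finset.sum_add_distrib, ← Finset.mul_sum, Finset.sum_const, Finset.card_univ, nsmul_eq_mul]
  have h1 : (Fintype.card ι : ℝ) * (S⁻¹ * (b * ((1 / 2 : ℝ) ^ a * p g))) = S * p g := by
    have : (Fintype.card ι : ℝ) * (S⁻¹ * (b * ((1 / 2 : ℝ) ^ a * p g)))
        = S⁻¹ * (Fintype.card ι * b * (1 / 2) ^ a) * p g := by ring
    rw [this, ← hSS]
    field_simp
  rw [h1]
  have := mul_le_mul_of_nonneg_left (hwp g) hS.le
  linarith

end

/-! ### The pinching inequality, gentle discarding and dyadic labels -/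

section

open Matrix

variable {E : Type*} [Fintype E] [DecidableEq E]

/-- The pinching inequality. -/
theorem sum_mul_mul_sum_le {W : Type*} (I : Finset W) {ρ : Matrix E E ℂ} (hρ : ρ.PosSemidef)
    {A : W → Matrix E E ℂ} (hA : ∀ w, (A w)ᴴ = A w) :
    (∑ w ∈ I, A w) * ρ * (∑ w ∈ I, A w) ≤ (I.card : ℝ) • ∑ w ∈ I, A w * ρ * A w := by
  have h1 : (∑ i ∈ I, ∑ j ∈ I, (A i - A j) * ρ * (A i - A j)).PosSemidef :=
    posSemidef_sum _ fun i _ => posSemidef_sum _ fun j _ => conj_posSemidef hρ (by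
      rw [Matrix.conjTranspose_sub, hA, hA])
  have h2 : ∑ i ∈ I, ∑ j ∈ I, (A i - A j) * ρ * (A i - A j)
      = (2 : ℝ) • ((I.card : ℝ) • ∑ w ∈ I, A w * ρ * A w
        - (∑ w ∈ I, A w) * ρ * (∑ w ∈ I, A w)) := by
    simp only [Matrix.sub_mul, Matrix.mul_sub, Finset.sum_sub_distrib, Finset.sum_const]
    rw [← Finset.smul_sum]
    have h3 : ∑ i ∈ I, ∑ j ∈ I, A i * ρ * A j = (∑ w ∈ I, A w) * ρ * (∑ w ∈ I, A w) := by
      rw [Finset.sum_mul, Finset.sum_mul]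
      refine Finset.sum_congr rfl fun i _ => ?_
      rw [Finset.mul_sum]
    have h4 : ∑ i ∈ I, ∑ j ∈ I, A j * ρ * A i = (∑ w ∈ I, A w) * ρ * (∑ w ∈ I, A w) := by
      rw [Finset.sum_comm, h3]
    rw [h3, h4, two_smul, Nat.cast_smul_eq_nsmul]
    abel
  rw [h2] at h1
  have h5 := smul_posSemidef h1 (c := 1 / 2) (by norm_num)
  rw [smul_smul] at h5
  norm_num at h5
  exact Matrix.le_iff.2 h5

section Gentle

variable {W : Type*} [Fintype W] [DecidableEq W] {R : W → Matrix E E ℂ}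

theorem herm_sum (hR : ∀ w, (R w)ᴴ = R w) (I : Finset W) :
    (∑ w ∈ I, R w)ᴴ = ∑ w ∈ I, R w := by
  rw [Matrix.conjTranspose_sum]
  exact Finset.sum_congr rfl fun w _ => hR w

theorem rtr_sum_proj_conj (hRR : ∀ w w', R w * R w' = if w = w' then R w else 0)
    (ρ : Matrix E E ℂ) (I : Finset W) :
    rtr ((∑ w ∈ I, R w) * ρ * (∑ w ∈ I, R w)) = ∑ w ∈ I, rtr (R w * ρ * R w) := by
  have h1 : (∑ w ∈ I, R w) * (∑ w ∈ I, R w) = ∑ w ∈ I, R w := by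
    rw [Finset.sum_mul]
    refine Finset.sum_congr rfl fun w hw => ?_
    rw [Finset.mul_sum]
    simp [hRR, hw]
  rw [rtr_mul_comm, ← Matrix.mul_assoc, h1, Finset.sum_mul, map_sum]
  refine Finset.sum_congr rfl fun w _ => ?_
  rw [rtr_mul_comm (R w * ρ), ← Matrix.mul_assoc, hRR, if_pos rfl]

/-- Discarding projections of small weight in every block. -/
theorem IsContr.sum_rtr_discard_le (hR : ∀ w, (R w)ᴴ = R w)
    (hRR : ∀ w w', R w * R w' = if w = w' then R w else 0)
    {ρ C : Matrix E E ℂ} (hρ : ρ.PosSemidef) (hC : IsContr C)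
    (blk : W → ℕ) (good : W → Prop) [DecidablePred good] (G : ℕ) (hG : ∀ w, blk w < G)
    {s : ℝ} (hs : 0 < s) :
    ∑ β ∈ Finset.range G, rtr (C *
      ((∑ w with blk w = β, R w) * ρ * (∑ w with blk w = β, R w)
      - (∑ w with blk w = β ∧ good w, R w) * ρ * (∑ w with blk w = β ∧ good w, R w)))
    ≤ s * ∑ w with ¬ good w, rtr (R w * ρ * R w) + s⁻¹ * ∑ w, rtr (R w * ρ * R w) := by
  have hw0 : ∀ w, 0 ≤ rtr (R w * ρ * R w) := fun w => rtr_nonneg (conj_posSemidef hρ (hR w))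
  have hsum : ∀ (p : W → Prop) [DecidablePred p] (f : W → ℝ),
      ∑ β ∈ Finset.range G, ∑ w with blk w = β ∧ p w, f w = ∑ w with p w, f w := by
    intro p _ f
    simp only [Finset.sum_filter]
    rw [Finset.sum_comm]
    refine Finset.sum_congr rfl fun w _ => ?_
    by_cases hp : p w
    · simp [hp, hG]
    · simp [hp]
  have hterm : ∀ β ∈ Finset.range G, rtr (C *
      ((∑ w with blk w = β, R w) * ρ * (∑ w with blk w = β, R w)
      - (∑ w with blk w = β ∧ good w, R w) * ρ * (∑ w with blk w = β ∧ good w, R w)))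
      ≤ s * ∑ w with blk w = β ∧ ¬ good w, rtr (R w * ρ * R w)
        + s⁻¹ * ∑ w with blk w = β ∧ True, rtr (R w * ρ * R w) := by
    intro β _
    set Q := ∑ w with blk w = β, R w with hQ
    set Z := ∑ w with blk w = β ∧ good w, R w with hZ
    set V := ∑ w with blk w = β ∧ ¬ good w, R w with hV
    have hQZV : Q = Z + V := by
      rw [hQ, hZ, hV, ← Finset.filter_filter, ← Finset.filter_filter,
        Finset.sum_filter_add_sum_filter_not]
    have hQh : Qᴴ = Q := herm_sum hR _
    have hZh : Zᴴ = Z := herm_sum hR _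
    have hVh : Vᴴ = V := herm_sum hR _
    -- Each remaining term carries a discarded projection `V` on one side, so weighted
    -- Cauchy-Schwarz makes only the discarded weight appear with the factor `s`.
    have e1 : C * (Q * ρ * Q - Z * ρ * Z) = C * (V * ρ * Q) + C * (Z * ρ * V) := by
      rw [hQZV]
      simp only [Matrix.mul_add, Matrix.add_mul, Matrix.mul_sub]
      abel
    have key : ∀ D N, IsContr D → Nᴴ = N → 2 * rtr (D * (V * ρ * N))
        ≤ s * rtr (V * ρ * V) + s⁻¹ * rtr (N * ρ * N) := by
      intro D N hD hN
      have h := two_mul_rtr_le hρ (D * V) N hs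
      have e2 : D * V * ρ * (D * V)ᴴ = D * (V * ρ * V) * Dᴴ := by
        simp only [Matrix.conjTranspose_mul, hVh, Matrix.mul_assoc]
      have e3 : D * V * ρ * N = D * (V * ρ * N) := by simp only [Matrix.mul_assoc]
      have h1 := mul_le_mul_of_nonneg_left (hD.rtr_conj_le (conj_posSemidef hρ hVh)) hs.le
      rw [e2, e3, hN] at h
      linarith
    have hZQ : rtr (Z * ρ * Z) ≤ rtr (Q * ρ * Q) := by
      rw [hZ, hQ, rtr_sum_proj_conj hRR, rtr_sum_proj_conj hRR]
      refine Finset.sum_le_sum_of_subset_of_nonneg ?_ fun w _ _ => hw0 w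
      intro w
      simp only [Finset.mem_filter]
      tauto
    have h1 := key C Q hC hQh
    have h2 := key Cᴴ Z hC.conjTranspose hZh
    have h3 := mul_le_mul_of_nonneg_left hZQ (inv_pos.2 hs).le
    rw [e1, map_add, rtr_mul_mul_mul_symm hρ hVh hZh]
    have h4 : rtr (V * ρ * V) = ∑ w with blk w = β ∧ ¬ good w, rtr (R w * ρ * R w) := by
      rw [hV, rtr_sum_proj_conj hRR]
    have h5 : rtr (Q * ρ * Q) = ∑ w with blk w = β ∧ True, rtr (R w * ρ * R w) := by
      rw [hQ, rtr_sum_proj_conj hRR]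
      simp
    rw [← h4, ← h5]
    linarith
  refine (Finset.sum_le_sum hterm).trans ?_
  rw [Finset.sum_add_distrib, ← Finset.mul_sum, ← Finset.mul_sum, hsum, hsum]
  simp

end Gentle

theorem exists_dyadic_label {s : ℝ} (h0 : 0 < s) (h4 : s ≤ 4) :
    ∃ t : ℕ, 4 * (1 / 2 : ℝ) ^ (t + 1) < s ∧ s ≤ 4 * (1 / 2 : ℝ) ^ t := by
  obtain ⟨t, h1, h2⟩ := exists_nat_pow_near_of_lt_one (x := s / 4) (y := (1 / 2 : ℝ))
    (by positivity) (by linarith) (by norm_num) (by norm_num)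
  exact ⟨t, by linarith, by linarith⟩

theorem card_block_le (M a B o β : ℕ) (ha : 0 < a) (hB : 0 < B) :
    (Finset.univ.filter fun t : Fin M => ((t : ℕ) / a + o) / B = β).card ≤ a * B := by
  have h1 : (Finset.univ.filter fun t : Fin M => ((t : ℕ) / a + o) / B = β).card
      ≤ (Finset.Ico (a * B * β) (a * B * β + a * B)).card := by
    refine Finset.card_le_card_of_injOn (fun t => (t : ℕ) + o * a) ?_ ?_
    · intro t ht
      simp only [Finset.coe_filter, Finset.mem_univ, true_and, Set.mem_ofPred_eq] at ht
      rw [← Nat.add_mul_div_right _ _ ha, Nat.div_div_eq_div_mul] at ht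
      simp only [Finset.coe_Ico, Set.mem_Ico]
      have h2 := Nat.mul_div_le ((t : ℕ) + o * a) (a * B)
      have h3 := Nat.lt_mul_div_succ ((t : ℕ) + o * a) (Nat.mul_pos ha hB)
      rw [ht] at h2 h3
      exact ⟨h2, by rw [Nat.mul_succ] at h3; exact h3⟩
    · intro t _ t' _ h
      exact Fin.ext (by simpa using h)
  simpa using h1

end

/-! ### Cells: spectral trees on the dyadic bands of a dominating operator -/

section

open Matrix

variable {E : Type*} [Fintype E] [DecidableEq E]

theorem indProj_posSemidef (U : unitaryGroup E ℂ) (p : E → Prop) [DecidablePred p] :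
    (indProj U p).PosSemidef :=
  specDiag_posSemidef U fun e => by split_ifs <;> norm_num

theorem indProj_mul_indProj (U : unitaryGroup E ℂ) (p q : E → Prop) [DecidablePred p]
    [DecidablePred q] :
    indProj U p * indProj U q = indProj U (fun e => p e ∧ q e) := by
  unfold indProj
  rw [specDiag_mul]
  refine congrArg (specDiag U) (funext fun e => ?_)
  by_cases hp : p e <;> by_cases hq : q e <;> simp [hp, hq]

/-- A common refinement, by projections `R x w` with `w = (t, v)`, of the spectral projections of an
operator into trees. -/
theorem exists_cells {X : Type*} [Fintype X] [DecidableEq X] {n m M : ℕ} {δ : ℝ} (hδ : 0 ≤ δ)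
    (hδm : (2 : ℝ) ^ (-(δ * m)) * Fintype.card X ≤ 1)
    (U : unitaryGroup E ℂ) (s : E → ℝ) (lab : E → ℕ) (hM : ∀ e, lab e < M)
    (hs2 : ∀ e, s e ≤ 4 * (1 / 2 : ℝ) ^ lab e) (ρ : (Fin n → X) → Matrix E E ℂ)
    (hρ : ∀ x, (ρ x).PosSemidef) {b : ℝ} (hb : 0 ≤ b) (hρb : ∀ x, ρ x ≤ b • specDiag U s)
    (hρs : ∑ x, ρ x ≤ specDiag U s) :
    ∃ R : (Fin n → X) → Fin M × (Fin n → Fin (m + 1)) → Matrix E E ℂ,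
      (∀ x w, (R x w)ᴴ = R x w) ∧
      (∀ x w w', R x w * R x w' = if w = w' then R x w else 0) ∧
      (∀ x (f : ℕ → ℕ) (β : ℕ), ∑ w with f (w.1 : ℕ) = β, R x w
        = indProj U (fun e => f (lab e) = β)) ∧
      (∀ x, ∑ w, R x w = 1) ∧
      (∀ (S : Fin n → Bool) (y : Fin n → X),
        ∑ w, ((2 : ℝ) ^ (δ * ∑ i, if S i then ((w.2 i : ℕ) : ℝ) else 0)) •
            ∑ x, (if ∀ i, S i → x i = y i then R x w * ρ x * R x w else 0)
          ≤ ((2 : ℝ) ^ (δ * ∑ i, if S i then (1 : ℝ) else 0) * (3 / 2) ^ (n + 2)) •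
            specDiag U (fun e => 4 * (1 / 2 : ℝ) ^ lab e)) ∧
      (∀ q : ℝ, ∑ w, (if δ * ∑ i, ((w.2 i : ℕ) : ℝ) < q then
          ∑ x, rtr (R x w * ρ x * R x w) else 0)
        ≤ b * 2 ^ q * (∑ e, 4 * (1 / 2 : ℝ) ^ lab e + n * 2 ^ δ * ∑ x, rtr (ρ x))) := by
  set c : Fin M → ℝ := fun t => 4 * (1 / 2 : ℝ) ^ (t : ℕ) with hc
  have hc0 : ∀ t, 0 < c t := fun t => by simp only [hc]; positivity
  set P : Fin M → Matrix E E ℂ := fun t => indProj U (fun e => lab e = t) with hP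
  have hPh : ∀ t, (P t)ᴴ = P t := fun t => indProj_herm U _
  have hP2 : ∀ t, P t * P t = P t := fun t => indProj_idem U _
  have hPσ : ∀ t, P t * specDiag U s * P t ≤ c t • P t := by
    intro t
    simp only [hP]
    rw [indProj_conj, indProj, specDiag_smul]
    refine specDiag_mono U fun e => ?_
    split_ifs with h
    · simp only [hc, mul_one, ← h]
      exact hs2 e
    · simp
  have hPρ : ∀ t, P t * (∑ x, ρ x) * P t ≤ c t • P t := fun t =>
    (conj_herm_le hρs (hPh t)).trans (hPσ t)
  have hPρb : ∀ t x, P t * ρ x * P t ≤ (b * c t) • P t := fun t x => by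
    refine (conj_herm_le (hρb x) (hPh t)).trans ?_
    rw [Matrix.mul_smul, Matrix.smul_mul, ← smul_smul]
    exact smul_le_smul_matrix (hPσ t) hb
  choose Q hQ using fun t => exists_isSpectralTree (m := m) hδm n (hc0 t) (hPh t) (hP2 t) ρ hρ
    (hPρ t)
  have hPP : ∀ t t', t ≠ t' → P t * P t' = 0 := by
    intro t t' h
    simp only [hP]
    rw [indProj_mul_indProj]
    have : (fun e => if lab e = (t : ℕ) ∧ lab e = (t' : ℕ) then (1 : ℝ) else 0) = fun _ => 0 := by
      funext e
      rw [if_neg]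
      rintro ⟨h1, h2⟩
      exact h (Fin.ext (h1.symm.trans h2))
    rw [indProj, this]
    simp [specDiag]
  have hcP : ∑ t, c t • P t = specDiag U (fun e => 4 * (1 / 2 : ℝ) ^ lab e) := by
    simp only [hP, indProj, specDiag_smul]
    rw [specDiag_sum]
    refine congrArg (specDiag U) (funext fun e => ?_)
    rw [Finset.sum_eq_single (⟨lab e, hM e⟩ : Fin M)]
    · simp [hc]
    · intro t _ ht
      rw [if_neg, mul_zero]
      exact fun h => ht (Fin.ext h.symm)
    · simp
  have hblk : ∀ x (f : ℕ → ℕ) (β : ℕ),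
      ∑ w : Fin M × (Fin n → Fin (m + 1)) with f (w.1 : ℕ) = β, Q w.1 x w.2
        = indProj U (fun e => f (lab e) = β) := by
    intro x f β
    rw [Finset.sum_filter, Fintype.sum_prod_type]
    have : ∀ t : Fin M, ∑ v, (if f (t : ℕ) = β then Q t x v else 0)
        = specDiag U (fun e => if lab e = t ∧ f (lab e) = β then 1 else 0) := by
      intro t
      by_cases h : f t = β
      · simp only [h, if_true]
        rw [(hQ t).sum_eq]
        simp only [hP, indProj]
        refine congrArg (specDiag U) (funext fun e => ?_)
        by_cases h2 : lab e = t
        · simp [h2, h]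
        · simp [h2]
      · have h0 : (fun e => if lab e = t ∧ f (lab e) = β then (1 : ℝ) else 0) = fun _ => 0 := by
          funext e
          rw [if_neg]
          rintro ⟨h1, h2⟩
          exact h (h1 ▸ h2)
        rw [h0]
        simp [h, specDiag]
    rw [Finset.sum_congr rfl fun t _ => this t, specDiag_sum, indProj]
    refine congrArg (specDiag U) (funext fun e => ?_)
    rw [Finset.sum_eq_single (⟨lab e, hM e⟩ : Fin M)]
    · simp
    · intro t _ ht
      rw [if_neg]
      exact fun h => ht (Fin.ext h.1.symm)
    · simp
  refine ⟨fun x w => Q w.1 x w.2, fun x w => (hQ _).herm _ _, ?_, hblk, ?_, ?_, ?_⟩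
  · rintro x ⟨t, v⟩ ⟨t', v'⟩
    by_cases h : t = t'
    · subst h
      simp [(hQ t).orth]
    · have : Q t x v * Q t' x v' = 0 := by
        rw [← (hQ t).mul_proj, ← (hQ t').proj_mul, Matrix.mul_assoc,
          ← Matrix.mul_assoc (P t), hPP t t' h]
        simp
      simp [this, h]
  · intro x
    have := hblk x (fun _ => 0) 0
    simpa [indProj, specDiag_one] using this
  · intro S y
    rw [Fintype.sum_prod_type, ← hcP, Finset.smul_sum]
    refine Finset.sum_le_sum fun t _ => ((hQ t).sample_le S y).trans ?_
    obtain ⟨h1, h2⟩ := runCoef_nonneg δ S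
    have h3 := smul_le_smul_matrix (hPρ t) h2
    refine (add_le_add_right h3 _).trans ?_
    rw [smul_smul, ← add_smul, smul_smul, ← add_mul]
    refine smul_le_smul_right_matrix (indProj_posSemidef U _) ?_
    exact mul_le_mul_of_nonneg_right (runCoef_add_le hδ S) (hc0 t).le
  · intro q
    rw [Fintype.sum_prod_type]
    have h1 : ∀ t, ∑ v : Fin n → Fin (m + 1), (if δ * ∑ i, ((v i : ℕ) : ℝ) < q then
        ∑ x, rtr (Q t x v * ρ x * Q t x v) else 0)
        ≤ b * 2 ^ q * (c t * rtr (P t) + n * (2 : ℝ) ^ δ * rtr (P t * (∑ x, ρ x) * P t)) := by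
      intro t
      -- The threshold is scaled by `c t` so that the ratio is `b 2 ^ q` for every band.
      have h2 := (hQ t).low_weight (b * c t) (c t * 2 ^ (-q)) (mul_nonneg hb (hc0 t).le)
        (mul_pos (hc0 t) (by positivity)) (hPρb t)
      have h3 : ∀ v : Fin n → Fin (m + 1),
          (c t * (2 : ℝ) ^ (-q) < c t * (2 : ℝ) ^ (-(δ * ∑ i, ((v i : ℕ) : ℝ)))) ↔
          δ * ∑ i, ((v i : ℕ) : ℝ) < q := by
        intro v
        rw [mul_lt_mul_iff_right₀ (hc0 t), Real.rpow_lt_rpow_left_iff (by norm_num), neg_lt_neg_iff]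
      simp only [h3] at h2
      refine h2.trans (le_of_eq ?_)
      congr 1
      have := hc0 t
      rw [Real.rpow_neg (by norm_num)]
      field_simp
    refine (Finset.sum_le_sum fun t _ => h1 t).trans (le_of_eq ?_)
    rw [← Finset.mul_sum, Finset.sum_add_distrib, ← Finset.mul_sum]
    have h4 : ∑ t, c t * rtr (P t) = ∑ e, 4 * (1 / 2 : ℝ) ^ lab e := by
      rw [← rtr_specDiag U, ← hcP, map_sum]
      simp
    have h5 : ∑ t, rtr (P t * (∑ x, ρ x) * P t) = ∑ x, rtr (ρ x) := by
      have := sum_rtr_group U lab hM (∑ x, ρ x)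
      rw [Finset.sum_range, map_sum] at this
      exact this
    rw [h4, h5]

theorem exists_dominating_specDiag {ι : Type*} [Fintype ι] [Nonempty E]
    (ρ : ι → Matrix E E ℂ) (hρ : ∀ x, (ρ x).PosSemidef) (hρ1 : ∑ x, rtr (ρ x) ≤ 1)
    {σ₀ : Matrix E E ℂ} (hσ : σ₀.PosSemidef) (hσ1 : rtr σ₀ = 1) {b : ℝ} (hb : 0 ≤ b)
    (hρσ : ∀ x, ρ x ≤ b • σ₀) :
    ∃ (U : unitaryGroup E ℂ) (s : E → ℝ) (lab : E → ℕ),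
      (∀ e, 4 * (1 / 2 : ℝ) ^ (lab e + 1) < s e) ∧ (∀ e, s e ≤ 4 * (1 / 2 : ℝ) ^ lab e) ∧
      (∀ x, ρ x ≤ b • specDiag U s) ∧ ∑ x, ρ x ≤ specDiag U s ∧ ∑ e, s e ≤ 3 := by
  set d : ℝ := (Fintype.card E : ℝ)⁻¹ with hd
  have hcard : (0 : ℝ) < Fintype.card E := by exact_mod_cast Fintype.card_pos
  have hd0 : 0 < d := by positivity
  have hρs : (∑ x, ρ x).PosSemidef := posSemidef_sum _ fun x _ => hρ x
  -- The first term dominates the marginal and the second each `ρ x`. The normalised identity makes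
  -- all eigenvalues positive, so that dyadic labels exist. Each has trace at most one.
  set σ : Matrix E E ℂ := ∑ x, ρ x + σ₀ + d • 1 with hσdef
  have h1 : (d • (1 : Matrix E E ℂ)).PosSemidef := smul_posSemidef PosSemidef.one hd0.le
  have hσp : σ.PosSemidef := (hρs.add hσ).add h1
  obtain ⟨U, s, hs⟩ := exists_eq_specDiag hσp.isHermitian
  have hds : ∀ e, d ≤ s e := by
    refine le_of_specDiag_le U (f := fun _ => d) ?_
    have : specDiag U (fun _ => d) = d • 1 := by
      rw [← specDiag_one U, specDiag_smul]; simp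
    rw [this, ← hs, Matrix.le_iff, hσdef, add_sub_cancel_right]
    exact hρs.add hσ
  have hs3 : ∑ e, s e ≤ 3 := by
    rw [← rtr_specDiag U, ← hs, hσdef, map_add, map_add, map_sum, map_smul, hσ1]
    have : rtr (1 : Matrix E E ℂ) = Fintype.card E := by
      rw [rtr_apply, Matrix.trace_one]; simp
    rw [this, smul_eq_mul, hd, inv_mul_cancel₀ hcard.ne']
    linarith
  have hs0 : ∀ e, 0 < s e := fun e => hd0.trans_le (hds e)
  have hs4 : ∀ e, s e ≤ 4 := fun e => by
    have := Finset.single_le_sum (fun e _ => (hs0 e).le) (Finset.mem_univ e)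
    linarith
  choose lab hl1 hl2 using fun e => exists_dyadic_label (hs0 e) (hs4 e)
  refine ⟨U, s, lab, hl1, hl2, fun x => ?_, ?_, hs3⟩
  · refine (hρσ x).trans (smul_le_smul_matrix ?_ hb)
    rw [← hs, Matrix.le_iff, hσdef, show ∑ x, ρ x + σ₀ + d • 1 - σ₀ = ∑ x, ρ x + d • 1 by abel]
    exact hρs.add h1
  · rw [← hs, Matrix.le_iff, hσdef, add_assoc, add_sub_cancel_left]
    exact hσ.add h1

end

/-! ### Typical cells and the sampled family -/

section

open Matrix

variable {E : Type*} [Fintype E] [DecidableEq E]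

/-- The values `v i / m` are representative on the sample `S`, and their total exceeds `q / δ`. -/
def IsTypical {n r m : ℕ} (ξ δ q : ℝ) (S : Subsets n r) (v : Fin n → Fin (m + 1)) : Prop :=
  q ≤ δ * ∑ i, ((v i : ℕ) : ℝ) ∧
    ¬ (∑ i ∈ S.1, ((v i : ℕ) : ℝ) / m) / r ≤ (∑ i, ((v i : ℕ) : ℝ) / m) / n - ξ

theorem IsTypical.le_sum {n r m : ℕ} {ξ δ q : ℝ} {S : Subsets n r} {v : Fin n → Fin (m + 1)}
    (h : IsTypical ξ δ q S v) (hn : 0 < n) (hr : 0 < r) (hm : 0 < m) (hδ : 0 ≤ δ) :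
    r / n * q - ξ * (δ * m) * r ≤ δ * ∑ i ∈ S.1, ((v i : ℕ) : ℝ) := by
  obtain ⟨h1, h2⟩ := h
  have hn' : (0 : ℝ) < n := by exact_mod_cast hn
  have hr' : (0 : ℝ) < r := by exact_mod_cast hr
  have hm' : (0 : ℝ) < m := by exact_mod_cast hm
  rw [not_le, ← Finset.sum_div, ← Finset.sum_div] at h2
  set A := ∑ i ∈ S.1, ((v i : ℕ) : ℝ)
  set T := ∑ i, ((v i : ℕ) : ℝ)
  have h3 : r / n * T - ξ * m * r ≤ A := by
    have := mul_le_mul_of_nonneg_left h2.le (mul_pos hr' hm').le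
    have e1 : (r * m : ℝ) * (T / m / n - ξ) = r / n * T - ξ * m * r := by field_simp
    have e2 : (r * m : ℝ) * (A / m / r) = A := by field_simp
    linarith
  have h4 := mul_le_mul_of_nonneg_left h3 hδ
  have h5 : r / n * q ≤ r / n * (δ * T) := mul_le_mul_of_nonneg_left h1 (by positivity)
  have e : δ * (r / n * T - ξ * m * r) = r / n * (δ * T) - ξ * (δ * m) * r := by ring
  linarith

open Classical in
-- For a fixed cell, atypicality means either a small total, independently of `S`, or a failure of
-- the sampler on the values `v i / m`.
theorem IsSampler.sum_not_isTypical_le {n r m : ℕ} {ξ ε δ q : ℝ} {P : Subsets n r → ℝ}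
    (hP : IsSampler n r ξ ε P) (hm : 0 < m) (v : Fin n → Fin (m + 1)) :
    ∑ S, P S * (if IsTypical ξ δ q S v then 0 else 1)
      ≤ (if δ * ∑ i, ((v i : ℕ) : ℝ) < q then 1 else 0) + ε := by
  have hm' : (0 : ℝ) < m := by exact_mod_cast hm
  have h1 := hP.prob_le (fun i => ((v i : ℕ) : ℝ) / m) fun i => ⟨by positivity, by
    rw [div_le_one hm']
    exact_mod_cast Nat.lt_succ_iff.1 (v i).2⟩
  by_cases h : δ * ∑ i, ((v i : ℕ) : ℝ) < q
  · rw [if_pos h]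
    have h2 : ∑ S, P S * (if IsTypical ξ δ q S v then (0 : ℝ) else 1) ≤ ∑ S, P S :=
      Finset.sum_le_sum fun S _ => by
        have := hP.mem_stdSimplex.1 S
        split_ifs <;> linarith
    have h3 := hP.mem_stdSimplex.2
    have h4 : 0 ≤ ε := le_trans (Finset.sum_nonneg fun S _ => hP.mem_stdSimplex.1 S) h1
    linarith
  · rw [if_neg h, zero_add]
    refine le_trans (le_of_eq ?_) h1
    rw [Finset.sum_filter]
    refine Finset.sum_congr rfl fun S _ => ?_
    simp only [IsTypical, not_lt.1 h, true_and]
    split_ifs <;> first | contradiction | simp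

set_option maxHeartbeats 800000 in
open Classical in
-- The operators `ρ' S x` are obtained from `ρ x` by pinching to blocks and keeping only the cells
-- typical for `S`. In the operator bound, `a B (m + 1) ^ n` counts the cells of a block, and
-- typicality turns the weighted estimate of the trees into an unweighted one. In the distance, the
-- three terms come from adjacent groups, remote groups and discarded cells.
theorem exists_sampled_family {X : Type*} [Fintype X] [DecidableEq X] [Nonempty E]
    {n r m a B : ℕ} (hn : 0 < n) (hr : 0 < r) (hm : 0 < m) (ha : 0 < a) (hB : 0 < B)
    {ξ ε : ℝ} {P : Subsets n r → ℝ} (hP : IsSampler n r ξ ε P) {δ h q T η : ℝ} (hδ : 0 ≤ δ)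
    (hδm : (2 : ℝ) ^ (-(δ * m)) * Fintype.card X ≤ 1)
    (ρ : (Fin n → X) → Matrix E E ℂ) (hρ : ∀ x, (ρ x).PosSemidef) (hρ1 : ∑ x, rtr (ρ x) ≤ 1)
    {σ₀ : Matrix E E ℂ} (hσ : σ₀.PosSemidef) (hσ1 : rtr σ₀ = 1)
    (hρσ : ∀ x, ρ x ≤ ((2 : ℝ) ^ (-h)) • σ₀) (hT : 0 < T)
    (hTT : T ^ 2 = Fintype.card (Fin n → X) * (2 : ℝ) ^ (-h) * (1 / 2) ^ a) (hη : 0 < η)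
    (hη' : (2 : ℝ) ^ (-h) * 2 ^ q * (6 + n * 2 ^ δ) + ε ≤ η) :
    ∃ σ : Matrix E E ℂ, σ.PosSemidef ∧ 0 < rtr σ ∧ rtr σ ≤ 6 ∧
      ∃ ρ' : Subsets n r → (Fin n → X) → Matrix E E ℂ, (∀ S x, (ρ' S x).PosSemidef) ∧
        (∀ S, ∑ x, rtr (ρ' S x) ≤ 1) ∧
        (∀ S (y : Fin n → X), ∑ x, (if ∀ i ∈ S.1, x i = y i then ρ' S x else 0)
          ≤ (a * B * (m + 1) ^ n * ((2 : ℝ) ^ (-(r / n * q - ξ * (δ * m) * r)) *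
              (2 ^ (δ * r) * (3 / 2) ^ (n + 2)))) • σ) ∧
        ∀ C : Subsets n r → (Fin n → X) → Matrix E E ℂ, (∀ S x, IsContr (C S x)) →
          ∑ S, P S * ∑ x, rtr (C S x * (ρ x - ρ' S x)) ≤ 2 / B + 6 * T + 2 * √η := by
  have hb : (0 : ℝ) ≤ 2 ^ (-h) := by positivity
  obtain ⟨U, s, lab, hs1, hs2, hρb, hρs, hs3⟩ :=
    exists_dominating_specDiag ρ hρ hρ1 hσ hσ1 hb hρσ
  set M := Finset.univ.sup lab + 1 with hMdef
  have hM : ∀ e, lab e < M := fun e => Nat.lt_succ_of_le (Finset.le_sup (Finset.mem_univ e))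
  obtain ⟨o, ho, hpinch⟩ := exists_offset_pinch_le U s lab hs1 hs2 ρ hρ hb hρb hρs ha hB hT hTT
    (G := M + B) (fun e => by
      have := hM e
      have := Nat.div_le_self (lab e) a
      omega)
  obtain ⟨R, hR, hRR, hRblk, hRone, hRS, hRlow⟩ :=
    exists_cells (m := m) hδ hδm U s lab hM hs2 ρ hρ hb hρb hρs
  set blk : Fin M × (Fin n → Fin (m + 1)) → ℕ := fun w => ((w.1 : ℕ) / a + o) / B with hblk
  have hblkG : ∀ w, blk w < M + B := fun w => by
    have h1 := Nat.div_le_self ((w.1 : ℕ) / a + o) B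
    have h2 := Nat.div_le_self (w.1 : ℕ) a
    have := w.1.2
    simp only [hblk]
    omega
  set good : Subsets n r → Fin M × (Fin n → Fin (m + 1)) → Prop :=
    fun S w => IsTypical ξ δ q S w.2 with hgood
  set Z : Subsets n r → (Fin n → X) → ℕ → Matrix E E ℂ :=
    fun S x β => ∑ w with blk w = β ∧ good S w, R x w with hZ
  have hZh : ∀ S x β, (Z S x β)ᴴ = Z S x β := fun S x β => herm_sum (hR x) _
  have hk0 : ∀ x w, 0 ≤ rtr (R x w * ρ x * R x w) := fun x w =>
    rtr_nonneg (conj_posSemidef (hρ x) (hR x w))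
  have hksum : ∀ x, ∑ w, rtr (R x w * ρ x * R x w) = rtr (ρ x) := fun x => by
    rw [← rtr_sum_proj_conj (hRR x), hRone]
    simp
  have hsb4 : ∀ e, 4 * (1 / 2 : ℝ) ^ lab e ≤ 2 * s e := fun e => by
    have := hs1 e
    rw [pow_succ] at this
    linarith
  have hsb6 : ∑ e, 4 * (1 / 2 : ℝ) ^ lab e ≤ 6 := by
    refine (Finset.sum_le_sum fun e _ => hsb4 e).trans ?_
    rw [← Finset.mul_sum]
    linarith
  refine ⟨specDiag U (fun e => 4 * (1 / 2 : ℝ) ^ lab e),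
    specDiag_posSemidef U fun e => by positivity, ?_, ?_,
    fun S x => ∑ β ∈ Finset.range (M + B), Z S x β * ρ x * Z S x β, ?_, ?_, ?_, ?_⟩
  · rw [rtr_specDiag]
    exact Finset.sum_pos (fun e _ => by positivity) Finset.univ_nonempty
  · rwa [rtr_specDiag]
  · exact fun S x => posSemidef_sum _ fun β _ => conj_posSemidef (hρ x) (hZh S x β)
  · intro S
    refine le_trans (Finset.sum_le_sum fun x _ => ?_) hρ1
    rw [map_sum, ← hksum]
    simp only [hZ, rtr_sum_proj_conj (hRR x)]
    simp only [Finset.sum_filter]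
    rw [Finset.sum_comm]
    refine Finset.sum_le_sum fun w _ => ?_
    by_cases hg : good S w
    · simp [hg, hblkG]
    · simp [hg, hk0]
  · intro S y
    obtain ⟨t₀, ht₀⟩ : ∃ t₀ : ℝ, t₀ = r / n * q - ξ * (δ * m) * r := ⟨_, rfl⟩
    obtain ⟨N, hN⟩ : ∃ N : ℝ, N = a * B * (m + 1) ^ n := ⟨_, rfl⟩
    have hN0 : 0 ≤ N := by rw [hN]; positivity
    rw [← ht₀, ← hN]
    have hcard : ∀ β, ((Finset.univ.filter fun w => blk w = β ∧ good S w).card : ℝ) ≤ N := by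
      intro β
      have h1 : (Finset.univ.filter fun w => blk w = β ∧ good S w).card
          ≤ ((Finset.univ.filter fun t : Fin M => ((t : ℕ) / a + o) / B = β) ×ˢ
            (Finset.univ : Finset (Fin n → Fin (m + 1)))).card := by
        refine Finset.card_le_card fun w => ?_
        simp only [Finset.mem_filter, Finset.mem_univ, true_and, Finset.mem_product, and_true,
          hblk]
        exact fun h => h.1
      rw [Finset.card_product] at h1
      have h2 := Nat.mul_le_mul_right (Finset.univ : Finset (Fin n → Fin (m + 1))).card
        (card_block_le M a B o β ha hB)
      have h3 := h1.trans h2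
      rw [Finset.card_univ, Fintype.card_fun, Fintype.card_fin, Fintype.card_fin] at h3
      rw [hN]
      exact_mod_cast h3
    set S' : Fin n → Bool := fun i => decide (i ∈ S.1) with hS'
    have hSsum : ∀ f : Fin n → ℝ, (∑ i, if S' i then f i else 0) = ∑ i ∈ S.1, f i := by
      intro f
      simp [hS', Finset.sum_ite_mem]
    have hx : ∀ x, ∑ β ∈ Finset.range (M + B), Z S x β * ρ x * Z S x β
        ≤ (N * (2 : ℝ) ^ (-t₀)) •
          ∑ w, ((2 : ℝ) ^ (δ * ∑ i, if S' i then ((w.2 i : ℕ) : ℝ) else 0)) •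
            (R x w * ρ x * R x w) := by
      intro x
      have hp : ∀ w, (R x w * ρ x * R x w).PosSemidef := fun w =>
        conj_posSemidef (hρ x) (hR x w)
      have h1 : ∀ β ∈ Finset.range (M + B), Z S x β * ρ x * Z S x β
          ≤ N • ∑ w with blk w = β ∧ good S w, R x w * ρ x * R x w := fun β _ =>
        (sum_mul_mul_sum_le _ (hρ x) (hR x)).trans
          (smul_le_smul_right_matrix (posSemidef_sum _ fun w _ => hp w) (hcard β))
      refine (Finset.sum_le_sum h1).trans ?_
      rw [← Finset.smul_sum, ← smul_smul]
      refine smul_le_smul_matrix ?_ (by positivity)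
      simp only [Finset.sum_filter]
      rw [Finset.sum_comm, Finset.smul_sum]
      refine Finset.sum_le_sum fun w _ => ?_
      rw [smul_smul, hSsum, ← Real.rpow_add (by norm_num)]
      by_cases hg : good S w
      · have h2 := hg.le_sum hn hr hm hδ
        simp only [hg, and_true]
        rw [Finset.sum_ite_eq, if_pos (Finset.mem_range.2 (hblkG w))]
        conv_lhs => rw [← one_smul ℝ (R x w * ρ x * R x w)]
        refine smul_le_smul_right_matrix (hp w) (Real.one_le_rpow (by norm_num) ?_)
        linarith
      · simp only [hg, and_false, if_false, Finset.sum_const_zero]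
        exact (smul_posSemidef (hp w) (by positivity)).nonneg
    have h2 : ∑ x, (if ∀ i ∈ S.1, x i = y i then
          ∑ β ∈ Finset.range (M + B), Z S x β * ρ x * Z S x β else 0)
        ≤ (N * (2 : ℝ) ^ (-t₀)) •
          ∑ w, ((2 : ℝ) ^ (δ * ∑ i, if S' i then ((w.2 i : ℕ) : ℝ) else 0)) •
            ∑ x, (if ∀ i, S' i → x i = y i then R x w * ρ x * R x w else 0) := by
      simp only [Finset.smul_sum]
      rw [Finset.sum_comm]
      refine Finset.sum_le_sum fun x _ => ?_
      have hiff : (∀ i, S' i = true → x i = y i) ↔ ∀ i ∈ S.1, x i = y i := by simp [hS']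
      by_cases hxy : ∀ i ∈ S.1, x i = y i
      · rw [if_pos hxy]
        simp only [hiff, if_pos hxy]
        rw [← Finset.smul_sum]
        exact hx x
      · rw [if_neg hxy]
        simp only [hiff, hxy, if_false, smul_zero, Finset.sum_const_zero, le_refl]
    refine h2.trans ((smul_le_smul_matrix (hRS S' y) (by positivity)).trans (le_of_eq ?_))
    rw [smul_smul, hSsum]
    simp only [Finset.sum_const, S.2, nsmul_eq_mul, mul_one, mul_assoc]
  · intro C hC
    -- This weight equalises `u η` and `u⁻¹`, giving `2 √η`.
    set u : ℝ := (√η)⁻¹ with hu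
    have hη0 : 0 < √η := Real.sqrt_pos.2 hη
    have hu0 : 0 < u := inv_pos.2 hη0
    have hB' : (0 : ℝ) < B := by exact_mod_cast hB
    have hS : ∀ S, ∑ x, rtr (C S x * (ρ x - ∑ β ∈ Finset.range (M + B), Z S x β * ρ x * Z S x β))
        ≤ 2 / B + 6 * T + u⁻¹
          + u * ∑ w, (if IsTypical ξ δ q S w.2 then (0 : ℝ) else 1) *
            ∑ x, rtr (R x w * ρ x * R x w) := by
      intro S
      have h1 := hpinch (C S) (hC S)
      have h2 : ∀ x ∈ Finset.univ, rtr (C S x * (ρ x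
          - ∑ β ∈ Finset.range (M + B), Z S x β * ρ x * Z S x β))
          ≤ rtr (C S x * (ρ x - ∑ β ∈ Finset.range (M + B),
              indProj U (fun e => (lab e / a + o) / B = β) * ρ x *
                indProj U (fun e => (lab e / a + o) / B = β)))
            + (u * ∑ w with ¬ good S w, rtr (R x w * ρ x * R x w) + u⁻¹ * rtr (ρ x)) := by
        intro x _
        have h3 := (hC S x).sum_rtr_discard_le (hR x) (hRR x) (hρ x) blk (good S) (M + B) hblkG hu0
        have h4 : ∀ β, ∑ w with blk w = β, R x w = indProj U (fun e => (lab e / a + o) / B = β) :=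
          fun β => hRblk x (fun t => (t / a + o) / B) β
        rw [hksum, ← map_sum, ← Finset.mul_sum, Finset.sum_sub_distrib] at h3
        simp only [h4] at h3
        refine le_trans (le_of_eq ?_) (add_le_add_right h3 _)
        rw [← map_add, ← Matrix.mul_add]
        simp only [hZ, sub_add_sub_cancel]
      refine (Finset.sum_le_sum h2).trans ?_
      rw [Finset.sum_add_distrib, Finset.sum_add_distrib, ← Finset.mul_sum, ← Finset.mul_sum]
      have h5 : ∑ x, ∑ w with ¬ good S w, rtr (R x w * ρ x * R x w)
          = ∑ w, (if IsTypical ξ δ q S w.2 then (0 : ℝ) else 1) *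
            ∑ x, rtr (R x w * ρ x * R x w) := by
        simp only [Finset.sum_filter]
        rw [Finset.sum_comm]
        refine Finset.sum_congr rfl fun w _ => ?_
        by_cases hg : IsTypical ξ δ q S w.2
        · simp [hgood, hg]
        · simp [hgood, hg]
      rw [h5]
      have h6 : 2 * (∑ x, rtr (ρ x)) / B ≤ 2 / B := by gcongr; linarith
      have h7 : 2 * T * ∑ e, s e ≤ 6 * T := by nlinarith
      have h8 : u⁻¹ * ∑ x, rtr (ρ x) ≤ u⁻¹ := by
        have := mul_le_mul_of_nonneg_left hρ1 (inv_pos.2 hu0).le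
        linarith
      linarith
    have hP0 := hP.mem_stdSimplex.1
    have hP1 := hP.mem_stdSimplex.2
    refine (Finset.sum_le_sum fun S _ => mul_le_mul_of_nonneg_left (hS S) (hP0 S)).trans ?_
    have hbad : ∑ S, P S * ∑ w : Fin M × (Fin n → Fin (m + 1)),
        (if IsTypical ξ δ q S w.2 then (0 : ℝ) else 1) * ∑ x, rtr (R x w * ρ x * R x w) ≤ η := by
      simp only [Finset.mul_sum (s := Finset.univ (α := Fin M × (Fin n → Fin (m + 1))))]
      rw [Finset.sum_comm]
      simp only [← mul_assoc]
      simp only [← Finset.sum_mul (s := Finset.univ (α := Subsets n r))]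
      have h1 : ∀ w : Fin M × (Fin n → Fin (m + 1)), 0 ≤ ∑ x, rtr (R x w * ρ x * R x w) :=
        fun w => Finset.sum_nonneg fun x _ => hk0 x w
      refine (Finset.sum_le_sum fun w _ => mul_le_mul_of_nonneg_right
        (hP.sum_not_isTypical_le (δ := δ) (q := q) hm w.2) (h1 w)).trans ?_
      simp only [add_mul, Finset.sum_add_distrib, ite_mul, one_mul, zero_mul]
      rw [← Finset.mul_sum, Finset.sum_comm (f := fun w x => rtr (R x w * ρ x * R x w))]
      simp only [hksum]
      have h2 := hRlow q
      have h3 : (2 : ℝ) ^ (-h) * 2 ^ q *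
          (∑ e, 4 * (1 / 2 : ℝ) ^ lab e + n * 2 ^ δ * ∑ x, rtr (ρ x))
          ≤ 2 ^ (-h) * 2 ^ q * (6 + n * 2 ^ δ) := by
        refine mul_le_mul_of_nonneg_left (add_le_add hsb6 ?_) (by positivity)
        exact mul_le_of_le_one_right (by positivity) hρ1
      have h4 : ε * ∑ x, rtr (ρ x) ≤ ε := mul_le_of_le_one_right hP.eps_nonneg hρ1
      linarith
    simp only [mul_add (P _), Finset.sum_add_distrib, ← Finset.sum_mul, hP1, one_mul,
      mul_left_comm (P _) u, ← Finset.mul_sum]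
    have h9 := mul_le_mul_of_nonneg_left hbad hu0.le
    have h10 : u * η = √η := by
      rw [hu, inv_mul_eq_div, Real.div_sqrt]
    have h11 : u⁻¹ = √η := inv_inv _
    rw [h11]
    linarith

end

/-! ### Classical-quantum operators and the sampled state -/

section

open Matrix

variable {A E : Type*} [Fintype A] [DecidableEq A] [Fintype E] [DecidableEq E]

theorem isDensity_of_rtr {σ : Matrix E E ℂ} (h : σ.PosSemidef) (h1 : rtr σ = 1) : IsDensity σ := by
  refine ⟨h, Complex.ext h1 ?_⟩
  have := (Complex.le_def.1 h.trace_nonneg).2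
  simpa using this.symm

/-- The diagonal block of an operator on `A ⊗ E` at a basis vector of `A`. -/
def block (M : Matrix (A × E) (A × E) ℂ) (a : A) : Matrix E E ℂ :=
  M.submatrix (Prod.mk a) (Prod.mk a)

theorem cqOperator_apply (ρ : A → Matrix E E ℂ) (p q : A × E) :
    cqOperator ρ p q = if p.1 = q.1 then ρ p.1 p.2 q.2 else 0 := by
  rw [cqOperator, Matrix.sum_apply]
  simp only [Matrix.kroneckerMap_apply, Matrix.single_apply]
  rw [Finset.sum_eq_single p.1]
  · simp
  · intro a _ ha
    simp [ha]
  · simp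

theorem block_mul_cqOperator (C : Matrix (A × E) (A × E) ℂ) (ρ : A → Matrix E E ℂ) (a : A) :
    block (C * cqOperator ρ) a = block C a * ρ a := by
  ext e e'
  simp only [block, Matrix.submatrix_apply, Matrix.mul_apply, cqOperator_apply]
  rw [Fintype.sum_prod_type, Finset.sum_eq_single a]
  · simp
  · intro b _ hb
    simp [hb]
  · simp

theorem rtr_eq_sum_block (M : Matrix (A × E) (A × E) ℂ) : rtr M = ∑ a, rtr (block M a) := by
  simp only [rtr_apply, Matrix.trace, block, Matrix.diag_apply, Matrix.submatrix_apply]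
  rw [Fintype.sum_prod_type, Complex.re_sum]

theorem block_cqOperator (ρ : A → Matrix E E ℂ) (a : A) : block (cqOperator ρ) a = ρ a := by
  ext e e'
  simp [block, cqOperator_apply]

theorem rtr_cqOperator (ρ : A → Matrix E E ℂ) : rtr (cqOperator ρ) = ∑ a, rtr (ρ a) := by
  simp only [rtr_eq_sum_block, block_cqOperator]

theorem rtr_mul_cqOperator (C : Matrix (A × E) (A × E) ℂ) (ρ : A → Matrix E E ℂ) :
    rtr (C * cqOperator ρ) = ∑ a, rtr (block C a * ρ a) := by
  simp only [rtr_eq_sum_block, block_mul_cqOperator]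

theorem cqOperator_sub (ρ ρ' : A → Matrix E E ℂ) :
    cqOperator ρ - cqOperator ρ' = cqOperator (fun a => ρ a - ρ' a) := by
  ext p q
  simp only [Matrix.sub_apply, cqOperator_apply]
  split_ifs <;> simp

theorem cqOperator_smul (c : ℝ) (ρ : A → Matrix E E ℂ) :
    c • cqOperator ρ = cqOperator (fun a => c • ρ a) := by
  ext p q
  simp only [Matrix.smul_apply, cqOperator_apply]
  split_ifs <;> simp

theorem cqOperator_mul (ρ ρ' : A → Matrix E E ℂ) :
    cqOperator ρ * cqOperator ρ' = cqOperator (fun a => ρ a * ρ' a) := by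
  ext p q
  rw [cqOperator_apply, Matrix.mul_apply, Fintype.sum_prod_type]
  simp only [cqOperator_apply]
  rw [Finset.sum_eq_single p.1]
  · by_cases h : p.1 = q.1 <;> simp [h, Matrix.mul_apply]
  · intro b _ hb
    simp [hb.symm]
  · simp

theorem cqOperator_conjTranspose (ρ : A → Matrix E E ℂ) :
    (cqOperator ρ)ᴴ = cqOperator (fun a => (ρ a)ᴴ) := by
  ext p q
  rw [Matrix.conjTranspose_apply, cqOperator_apply, cqOperator_apply]
  by_cases h : p.1 = q.1
  · simp [h]
  · simp [h, Ne.symm h]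

theorem one_kronecker_eq (σ : Matrix E E ℂ) :
    (1 : Matrix A A ℂ) ⊗ₖ σ = cqOperator (fun _ => σ) := by
  ext p q
  rw [cqOperator_apply, Matrix.kroneckerMap_apply, Matrix.one_apply]
  split_ifs <;> simp

theorem cqOperator_one : cqOperator (fun _ : A => (1 : Matrix E E ℂ)) = 1 := by
  rw [← one_kronecker_eq, Matrix.one_kronecker_one]

theorem cqOperator_posSemidef {ρ : A → Matrix E E ℂ} (h : ∀ a, (ρ a).PosSemidef) :
    (cqOperator ρ).PosSemidef := by
  choose R hR using fun a => exists_eq_conjTranspose_mul_self (h a)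
  have : cqOperator ρ = (cqOperator R)ᴴ * cqOperator R := by
    rw [cqOperator_conjTranspose, cqOperator_mul]
    exact congrArg cqOperator (funext hR)
  rw [this]
  exact posSemidef_conjTranspose_mul_self _

theorem cqOperator_mono {ρ ρ' : A → Matrix E E ℂ} (h : ∀ a, ρ a ≤ ρ' a) :
    cqOperator ρ ≤ cqOperator ρ' := by
  rw [Matrix.le_iff, cqOperator_sub]
  exact cqOperator_posSemidef fun a => h a

theorem block_posSemidef {M : Matrix (A × E) (A × E) ℂ} (h : M.PosSemidef) (a : A) :
    (block M a).PosSemidef := h.submatrix _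

theorem block_mono {M N : Matrix (A × E) (A × E) ℂ} (h : M ≤ N) (a : A) :
    block M a ≤ block N a := by
  rw [Matrix.le_iff] at h ⊢
  exact h.submatrix _

theorem IsContr.cqOperator {C : A → Matrix E E ℂ} (h : ∀ a, IsContr (C a)) :
    IsContr (cqOperator C) := by
  constructor
  · rw [cqOperator_conjTranspose, cqOperator_mul, ← cqOperator_one]
    exact cqOperator_mono fun a => (h a).left
  · rw [cqOperator_conjTranspose, cqOperator_mul, ← cqOperator_one]
    exact cqOperator_mono fun a => (h a).right

/-- The block of `Cᴴ * C` sums over a whole column of blocks of `C`; the diagonal one is a single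
positive summand. -/
theorem block_conjTranspose_mul_le (C : Matrix (A × E) (A × E) ℂ) (a : A) :
    (block C a)ᴴ * block C a ≤ block (Cᴴ * C) a := by
  have h : block (Cᴴ * C) a
      = ∑ b, (C.submatrix (Prod.mk b) (Prod.mk a))ᴴ * C.submatrix (Prod.mk b) (Prod.mk a) := by
    ext e e'
    simp only [block, Matrix.submatrix_apply, Matrix.mul_apply, Matrix.sum_apply,
      Matrix.conjTranspose_apply]
    rw [Fintype.sum_prod_type]
  rw [h, ← Finset.add_sum_erase _ _ (Finset.mem_univ a), Matrix.le_iff]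
  simp only [block, add_sub_cancel_left]
  exact posSemidef_sum _ fun b _ => posSemidef_conjTranspose_mul_self _

theorem block_one (a : A) : block (1 : Matrix (A × E) (A × E) ℂ) a = 1 := by
  rw [← cqOperator_one, block_cqOperator]

theorem IsContr.block {C : Matrix (A × E) (A × E) ℂ} (h : IsContr C) (a : A) :
    IsContr (block C a) := by
  constructor
  · refine (block_conjTranspose_mul_le C a).trans ?_
    rw [← block_one a]
    exact block_mono h.left a
  · have h1 := block_conjTranspose_mul_le Cᴴ a
    rw [Matrix.conjTranspose_conjTranspose] at h1
    have h2 : QSampling.block Cᴴ a = (QSampling.block C a)ᴴ := rfl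
    rw [h2, Matrix.conjTranspose_conjTranspose] at h1
    refine h1.trans ?_
    rw [← block_one a]
    exact block_mono h.right a

theorem IsContr.neg {C : Matrix E E ℂ} (h : IsContr C) : IsContr (-C) :=
  ⟨by simpa using h.left, by simpa using h.right⟩

theorem IsContr.rtr_mul_le_rtr {C ρ : Matrix E E ℂ} (h : IsContr C) (hρ : ρ.PosSemidef) :
    rtr (C * ρ) ≤ rtr ρ := by
  have h1 := two_mul_rtr_le hρ C 1 one_pos
  have h2 := h.rtr_conj_le hρ
  simp at h1
  linarith

/-- Pinching to the classical basis does not increase the distance to a classical operator. -/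
theorem sum_rtr_block_sub_le {C : A → Matrix E E ℂ} (hC : ∀ a, IsContr (C a))
    (M : Matrix (A × E) (A × E) ℂ) (ρ : A → Matrix E E ℂ) :
    ∑ a, rtr (C a * (block M a - ρ a)) ≤ traceNorm (M - cqOperator ρ) := by
  refine le_trans (le_of_eq ?_) ((IsContr.cqOperator hC).rtr_mul_le _)
  rw [rtr_mul_comm, rtr_eq_sum_block]
  refine Finset.sum_congr rfl fun a _ => ?_
  rw [block_mul_cqOperator, rtr_mul_comm]
  congr 2
  conv_lhs => rw [← block_cqOperator ρ a]
  rfl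

section Sampled

variable {X : Type*} [Fintype X] [DecidableEq X] {n r : ℕ}

theorem substring_eq_iff (S : Subsets n r) (x y : Fin n → X) :
    substring S x = substring S y ↔ ∀ i ∈ S.1, x i = y i := by
  have h := Finset.range_orderEmbOfFin S.1 S.2
  constructor
  · intro hxy i hi
    have : i ∈ Set.range (S.1.orderEmbOfFin S.2) := by rw [h]; exact hi
    obtain ⟨j, rfl⟩ := this
    exact congrFun hxy j
  · intro hxy
    funext j
    exact hxy _ (Finset.orderEmbOfFin_mem S.1 S.2 j)

/-- The candidate for smoothing applies `ρ' S` in place of `ρ` on each branch, and the state on `S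
E` is the product of `P` with the normalised `σ`. The factor `P S` then cancels from the operator
inequality. -/
theorem le_smoothMinEntropy_sampledState {P : Subsets n r → ℝ}
    (hP : P ∈ stdSimplex ℝ (Subsets n r)) (ρ : (Fin n → X) → Matrix E E ℂ)
    (ρ' : Subsets n r → (Fin n → X) → Matrix E E ℂ) (hρ' : ∀ S x, (ρ' S x).PosSemidef)
    (hρ1 : ∀ S, ∑ x, rtr (ρ' S x) ≤ 1) {ε : ℝ}
    (hC : ∀ C : Subsets n r → (Fin n → X) → Matrix E E ℂ, (∀ S x, IsContr (C S x)) →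
      ∑ S, P S * ∑ x, rtr (C S x * (ρ' S x - ρ x)) ≤ ε)
    {σ : Matrix E E ℂ} (hσ : σ.PosSemidef) (hσ0 : 0 < rtr σ) {c g : ℝ}
    (hcg : c * rtr σ ≤ 2 ^ (-g))
    (hle : ∀ S (y : Fin n → X), ∑ x, (if ∀ i ∈ S.1, x i = y i then ρ' S x else 0) ≤ c • σ) :
    (g : EReal) ≤ smoothMinEntropy ε (sampledState P ρ) := by
  set N : (Fin r → X) → Subsets n r → Matrix E E ℂ :=
    fun y S => P S • ∑ x with substring S x = y, ρ' S x with hN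
  have hsum : ∀ (f : Subsets n r → (Fin n → X) → ℝ),
      ∑ y, ∑ S, P S * ∑ x with substring S x = y, f S x = ∑ S, P S * ∑ x, f S x := by
    intro f
    rw [Finset.sum_comm]
    refine Finset.sum_congr rfl fun S _ => ?_
    rw [← Finset.mul_sum, Finset.sum_fiberwise]
  refine le_iSup₂_of_le (cqOperator fun y => cqOperator (N y)) ⟨?_, ?_, ?_⟩ ?_
  · exact cqOperator_posSemidef fun y => cqOperator_posSemidef fun S =>
      smul_posSemidef (posSemidef_sum _ fun x _ => hρ' S x) (hP.1 S)
  · rw [← rtr_apply, rtr_cqOperator]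
    simp only [rtr_cqOperator, hN, map_smul, map_sum, smul_eq_mul]
    rw [hsum, ← hP.2]
    exact Finset.sum_le_sum fun S _ => mul_le_of_le_one_right (hP.1 S) (hρ1 S)
  · rw [traceNorm_le_iff]
    intro C hCC
    rw [sampledState, cqOperator_sub, rtr_mul_cqOperator]
    simp only [cqOperator_sub, rtr_mul_cqOperator]
    refine le_trans (le_of_eq ?_) (hC (fun S x => block (block C (substring S x)) S)
      fun S x => (hCC.block _).block _)
    rw [← hsum]
    refine Finset.sum_congr rfl fun y _ => Finset.sum_congr rfl fun S _ => ?_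
    simp only [hN]
    rw [← smul_sub, ← Finset.sum_sub_distrib, Matrix.mul_smul, map_smul, smul_eq_mul,
      Finset.mul_sum, map_sum]
    congr 1
    refine Finset.sum_congr rfl fun x hx => ?_
    rw [(Finset.mem_filter.1 hx).2]
  · set σ' : Matrix E E ℂ := (rtr σ)⁻¹ • σ with hσ'
    have hσp' : σ'.PosSemidef := smul_posSemidef hσ (inv_pos.2 hσ0).le
    have hσ1' : rtr σ' = 1 := by
      rw [hσ', map_smul, smul_eq_mul, inv_mul_cancel₀ hσ0.ne']
    have hcσ : c • σ ≤ (2 : ℝ) ^ (-g) • σ' := by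
      have : c • σ = (c * rtr σ) • σ' := by
        rw [hσ', smul_smul, mul_assoc, mul_inv_cancel₀ hσ0.ne', mul_one]
      rw [this]
      exact smul_le_smul_right_matrix hσp' hcg
    refine le_iSup₂_of_le (cqOperator fun S => P S • σ') (isDensity_of_rtr ?_ ?_)
      (le_iSup₂_of_le g ?_ le_rfl)
    · exact cqOperator_posSemidef fun S => smul_posSemidef hσp' (hP.1 S)
    · rw [rtr_cqOperator]
      simp only [map_smul, hσ1', smul_eq_mul, mul_one]
      exact hP.2
    · rw [one_kronecker_eq, cqOperator_smul]
      refine cqOperator_mono fun y => ?_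
      rw [cqOperator_smul]
      refine cqOperator_mono fun S => ?_
      rw [smul_comm]
      refine smul_le_smul_matrix ?_ (hP.1 S)
      by_cases hy : ∃ x₀ : Fin n → X, substring S x₀ = y
      · obtain ⟨x₀, rfl⟩ := hy
        refine le_trans (le_of_eq ?_) ((hle S x₀).trans hcσ)
        rw [Finset.sum_filter]
        simp only [substring_eq_iff]
      · rw [Finset.sum_eq_zero]
        · exact (smul_posSemidef hσp' (by positivity)).nonneg
        · intro x hx
          exact absurd ⟨x, (Finset.mem_filter.1 hx).2⟩ hy

theorem card_agree (S : Subsets n r) (y : Fin n → X) :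
    (Finset.univ.filter fun x : Fin n → X => ∀ i ∈ S.1, x i = y i).card
      = Fintype.card X ^ (n - r) := by
  have h : (Finset.univ.filter fun x : Fin n → X => ∀ i ∈ S.1, x i = y i)
      = Fintype.piFinset (fun i => if i ∈ S.1 then {y i} else Finset.univ) := by
    ext x
    simp only [Finset.mem_filter, Finset.mem_univ, true_and, Fintype.mem_piFinset]
    refine forall_congr' fun i => ?_
    by_cases hi : i ∈ S.1 <;> simp [hi]
  rw [h, Fintype.card_piFinset]
  have : ∀ i, (if i ∈ S.1 then ({y i} : Finset X) else Finset.univ).card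
      = if i ∈ S.1 then 1 else Fintype.card X := fun i => by
    split_ifs <;> simp
  simp only [this]
  rw [Finset.prod_ite]
  simp only [Finset.prod_const_one, one_mul, Finset.prod_const]
  congr 1
  rw [Finset.filter_not, Finset.card_sdiff]
  simp [S.2]

end Sampled

end

/-! ### Numerical estimates -/

section

theorem cubic_le_three_halves_pow {n : ℕ} (hn : 61 ≤ n) :
    (61 * (17 * n ^ 2) * (n + 6) : ℝ) ≤ (3 / 2) ^ n := by
  induction n, hn using Nat.le_induction with
  | base => norm_num
  | succ n hn ih =>
    have h : (61 : ℝ) ≤ n := by exact_mod_cast hn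
    rw [pow_succ (3 / 2 : ℝ)]
    push_cast
    have h2 : (0 : ℝ) ≤ n ^ 2 := by positivity
    nlinarith [mul_nonneg h2 (sub_nonneg.2 h), mul_nonneg (by linarith : (0 : ℝ) ≤ n)
      (sub_nonneg.2 h)]

theorem cubic_le_four_pow {n : ℕ} (hn : 13 ≤ n) :
    (1824 * n ^ 2 * (n + 6) : ℝ) ≤ 4 ^ n := by
  induction n, hn using Nat.le_induction with
  | base => norm_num
  | succ n hn ih =>
    have h : (13 : ℝ) ≤ n := by exact_mod_cast hn
    rw [pow_succ (4 : ℝ)]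
    push_cast
    have h2 : (0 : ℝ) ≤ n ^ 2 := by positivity
    nlinarith [mul_nonneg h2 (sub_nonneg.2 h), mul_nonneg (by linarith : (0 : ℝ) ≤ n)
      (sub_nonneg.2 h)]

/-- An explicit bound on `2 ^ (K / m)` when `m` is the integer part of `K`. -/
theorem two_rpow_div_le {K c : ℝ} {m k : ℕ} (hk : 0 < k) (hkm : k ≤ m) (hm : K < m + 1)
    (hc : 0 ≤ c) (h : (2 : ℝ) ^ (k + 1) ≤ c ^ k) : (2 : ℝ) ^ (K / m) ≤ c := by
  have hk' : (0 : ℝ) < k := by exact_mod_cast hk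
  have hm' : (k : ℝ) ≤ m := by exact_mod_cast hkm
  have hm0 : (0 : ℝ) < m := hk'.trans_le hm'
  have h1 : K / m ≤ (k + 1) / k := by
    rw [div_le_div_iff₀ hm0 hk']
    nlinarith
  refine (Real.rpow_le_rpow_of_exponent_le (by norm_num) h1).trans ?_
  refine le_of_pow_le_pow_left₀ hk.ne' hc ?_
  refine le_trans (le_of_eq ?_) h
  rw [← Real.rpow_natCast, ← Real.rpow_mul (by norm_num), div_mul_cancel₀ _ hk'.ne',
    ← Real.rpow_natCast]
  push_cast
  rfl

/-- This is where `κ ≤ 0.15` is tight: the factor per position must stay below `K ^ 2`, with a spare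
`3 / 2` whose `n`-th power absorbs polynomial factors. The constant `119 / 100` is an upper bound
for `2 ^ (1 / 4)`. -/
theorem mul_floor_le_sq {K : ℝ} {m : ℕ} (hK : 20 / 3 ≤ K) (hm1 : (m : ℝ) ≤ K)
    (hm2 : K < m + 1) :
    (2 : ℝ) ^ (K / m) ≤ 9 / 4 ∧
      119 / 100 * (3 / 2) * (m + 1) * 2 ^ (K / m) * (3 / 2) ≤ K ^ 2 := by
  have hm6 : 6 ≤ m := by
    have : (5 : ℝ) < m := by linarith
    have : 5 < m := by exact_mod_cast this
    omega
  have h6 : (2 : ℝ) ^ (K / m) ≤ 9 / 4 :=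
    two_rpow_div_le (by norm_num) hm6 hm2 (by norm_num) (by norm_num)
  refine ⟨h6, ?_⟩
  have hm0 : (0 : ℝ) ≤ m := m.cast_nonneg
  have hKm : (m : ℝ) ^ 2 ≤ K ^ 2 := pow_le_pow_left₀ hm0 hm1 2
  have aux : ∀ c : ℝ, (2 : ℝ) ^ (K / m) ≤ c →
      119 / 100 * (3 / 2) * (m + 1) * 2 ^ (K / m) * (3 / 2)
        ≤ 119 / 100 * (3 / 2) * (m + 1) * c * (3 / 2) := fun c hc => by gcongr
  rcases hm6.eq_or_lt with h | h
  -- For `m = 6` the bound by `m ^ 2` fails and `K ≥ 20 / 3` itself is needed.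
  · refine (aux _ h6).trans ?_
    rw [← h]
    norm_num
    nlinarith
  · rcases (Nat.succ_le_of_lt h).eq_or_lt with h | h
    · refine (aux (221 / 100) (two_rpow_div_le (k := 7) (by norm_num) h.le hm2 (by norm_num)
        (by norm_num))).trans (le_trans ?_ hKm)
      rw [← h]
      norm_num
    · refine (aux (219 / 100) (two_rpow_div_le (k := 8) (by norm_num) h hm2 (by norm_num)
        (by norm_num))).trans (le_trans ?_ hKm)
      have : (8 : ℝ) ≤ m := by exact_mod_cast (show 8 ≤ m from h)
      nlinarith

/-- For `K ≤ 16` the spare factor `(3 / 2) ^ n` beats the polynomial once `n ≥ 61`. For `K ≥ 16` the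
factor per position is only linear in `K`, which leaves enough room already from `n ≥ 13`. -/
theorem counting_bound {K : ℝ} {m n : ℕ} (hK : 20 / 3 ≤ K) (hm1 : (m : ℝ) ≤ K)
    (hm2 : K < m + 1) (hn : K ≤ 16 ∧ 61 ≤ n ∨ 16 ≤ K ∧ 13 ≤ n) :
    12 * (119 / 100) ^ n * (n ^ 2 * K + n / 2 + 10) * (n + 6) * (m + 1) ^ n *
      (2 ^ (K / m)) ^ (n + 1) * (3 / 2) ^ (n + 2) ≤ K ^ (2 * n) := by
  obtain ⟨h1, h2⟩ := mul_floor_le_sq hK hm1 hm2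
  set z : ℝ := 2 ^ (K / m) with hz
  have hz0 : 0 < z := by positivity
  rcases hn with ⟨hK2, hn⟩ | ⟨hK2, hn⟩
  · have hn' : (61 : ℝ) ≤ n := by exact_mod_cast hn
    have e : 12 * (119 / 100) ^ n * (n ^ 2 * K + n / 2 + 10) * (n + 6) * (m + 1) ^ n *
        z ^ (n + 1) * (3 / 2) ^ (n + 2)
        = (27 * z * (n ^ 2 * K + n / 2 + 10) * (n + 6)) *
          (119 / 100 * (3 / 2) * (m + 1) * z) ^ n := by
      simp only [mul_pow, pow_succ]
      ring
    have h3 : 27 * z * (n ^ 2 * K + n / 2 + 10) * (n + 6) ≤ (3 / 2) ^ n := by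
      refine le_trans ?_ (cubic_le_three_halves_pow hn)
      have h4 : 27 * z ≤ 61 := by linarith
      have h5 : (n ^ 2 * K + n / 2 + 10 : ℝ) ≤ 17 * n ^ 2 := by nlinarith
      have h6 : (0 : ℝ) ≤ n ^ 2 * K + n / 2 + 10 := by positivity
      gcongr
    rw [e]
    calc _ ≤ (3 / 2 : ℝ) ^ n * (119 / 100 * (3 / 2) * (m + 1) * z) ^ n := by gcongr
      _ = (119 / 100 * (3 / 2) * (m + 1) * z * (3 / 2)) ^ n := by rw [← mul_pow]; ring_nf
      _ ≤ (K ^ 2) ^ n := by gcongr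
      _ = K ^ (2 * n) := by rw [pow_mul]
  · have hn' : (13 : ℝ) ≤ n := by exact_mod_cast hn
    have hm16 : 16 ≤ m := by
      have : (15 : ℝ) < m := by linarith
      have : 15 < m := by exact_mod_cast this
      omega
    have hz2 : z ≤ 21 / 10 := two_rpow_div_le (k := 16) (by norm_num) hm16 hm2 (by norm_num)
      (by norm_num)
    have e : 12 * (119 / 100) ^ n * (n ^ 2 * K + n / 2 + 10) * (n + 6) * (m + 1) ^ n *
        z ^ (n + 1) * (3 / 2) ^ (n + 2)
        = (27 * z * (n ^ 2 * K + n / 2 + 10) * (n + 6)) *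
          (119 / 100 * (3 / 2) * (m + 1) * z) ^ n := by
      simp only [mul_pow, pow_succ]
      ring
    have hK0 : 0 < K := by linarith
    have h3 : 119 / 100 * (3 / 2) * (m + 1) * z ≤ 4 * K := by
      calc 119 / 100 * (3 / 2) * (m + 1) * z ≤ 119 / 100 * (3 / 2) * (17 / 16 * K) * (21 / 10) := by
            gcongr
            linarith
        _ ≤ 4 * K := by linarith
    have h4 : 27 * z * (n ^ 2 * K + n / 2 + 10) * (n + 6) ≤ K / 16 * 4 ^ n := by
      have h5 : (n ^ 2 * K + n / 2 + 10 : ℝ) ≤ 2 * n ^ 2 * K := by nlinarith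
      calc 27 * z * (n ^ 2 * K + n / 2 + 10) * (n + 6)
          ≤ 27 * (21 / 10) * (2 * n ^ 2 * K) * (n + 6) := by gcongr
        _ ≤ K / 16 * (1824 * n ^ 2 * (n + 6)) := by
            have : 0 ≤ K * n ^ 2 * (n + 6) := by positivity
            nlinarith
        _ ≤ K / 16 * 4 ^ n := by gcongr; exact cubic_le_four_pow hn
    have h6 : K / 16 * (4 ^ n * 4 ^ n) ≤ K ^ n := by
      obtain ⟨k, rfl⟩ : ∃ k, n = k + 1 := ⟨n - 1, by omega⟩
      rw [← mul_pow, pow_succ, pow_succ]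
      have : ((4 * 4 : ℝ)) ^ k ≤ K ^ k := by gcongr; linarith
      have h7 := mul_le_mul_of_nonneg_left this hK0.le
      generalize (4 * 4 : ℝ) ^ k = p at h7 ⊢
      linarith
    rw [e]
    calc _ ≤ (K / 16 * 4 ^ n) * (4 * K) ^ n := by gcongr
      _ = (K / 16 * (4 ^ n * 4 ^ n)) * K ^ n := by rw [mul_pow]; ring
      _ ≤ K ^ n * K ^ n := by gcongr
      _ = K ^ (2 * n) := by rw [two_mul, pow_add]

/-- Concavity of the logarithm, with equality at `4` and `16`. -/
theorem quarter_le_logb {K : ℝ} (h4 : 4 ≤ K) (h16 : K ≤ 16) : K / 4 ≤ Real.logb 2 K := by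
  have hl : 0 < Real.log 2 := Real.log_pos (by norm_num)
  have h := strictConcaveOn_log_Ioi.concaveOn.2 (show (4 : ℝ) ∈ Set.Ioi 0 by simp)
    (show (16 : ℝ) ∈ Set.Ioi 0 by simp) (show 0 ≤ (16 - K) / 12 by linarith)
    (show 0 ≤ (K - 4) / 12 by linarith) (by ring)
  simp only [smul_eq_mul] at h
  have e4 : Real.log 4 = 2 * Real.log 2 := by
    rw [show (4 : ℝ) = 2 ^ 2 by norm_num, Real.log_pow]; norm_num
  have e16 : Real.log 16 = 4 * Real.log 2 := by
    rw [show (16 : ℝ) = 2 ^ 4 by norm_num, Real.log_pow]; norm_num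
  rw [e4, e16, show (16 - K) / 12 * 4 + (K - 4) / 12 * 16 = K by ring] at h
  rw [Real.logb, le_div_iff₀ hl]
  nlinarith

end

/-! ### Choice of parameters -/

section

open Matrix

variable {E : Type*} [Fintype E] [DecidableEq E]

theorem ceil_inv_fourth_root_le {ε : ℝ} {n : ℕ} (hε : 0 < ε) (h1 : 1 ≤ ε * 2 ^ n) :
    (⌈(ε ^ (1 / 4 : ℝ))⁻¹⌉₊ : ℝ) ≤ 2 * (119 / 100) ^ n := by
  set f := ε ^ (1 / 4 : ℝ) with hf
  have hf0 : 0 < f := by positivity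
  have hf4 : f ^ 4 = ε := by
    rw [hf, ← Real.rpow_natCast, ← Real.rpow_mul hε.le]; norm_num
  have h2 : f⁻¹ ≤ (119 / 100) ^ n := by
    refine le_of_pow_le_pow_left₀ (n := 4) (by norm_num) (by positivity) ?_
    rw [inv_pow, hf4, inv_le_iff_one_le_mul₀ hε]
    refine h1.trans ?_
    rw [mul_comm, ← pow_mul, mul_comm n, pow_mul]
    gcongr
    norm_num
  have h3 := (Nat.ceil_lt_add_one (inv_pos.2 hf0).le).le
  have h4 : (1 : ℝ) ≤ (119 / 100) ^ n := one_le_pow₀ (by norm_num)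
  linarith

/-- With `f = ε ^ (1 / 4) ≤ 1 / 3`, the budget `3 f` is used as `2 f` for the block boundaries, `f /
3` for the remote couplings and `2 f ^ 2 ≤ 2 f / 3` for the sampler. -/
theorem error_terms_le {ε T z : ℝ} {n : ℕ} (hε : 0 < ε) (hε' : ε < 1 / 81) (h1 : 1 ≤ ε * 2 ^ n)
    (hT : T ^ 2 ≤ 2 ^ (-(n / 2 + 9 : ℝ))) (hz : 0 ≤ z) :
    2 / (⌈(ε ^ (1 / 4 : ℝ))⁻¹⌉₊ : ℝ) + 6 * T + 2 * √(z ^ 2 + ε)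
      ≤ 2 * z + 3 * ε ^ (1 / 4 : ℝ) := by
  set f := ε ^ (1 / 4 : ℝ) with hf
  have hf0 : 0 < f := by positivity
  have hf4 : f ^ 4 = ε := by
    rw [hf, ← Real.rpow_natCast, ← Real.rpow_mul hε.le]; norm_num
  have hf3 : f ≤ 1 / 3 := by
    refine le_of_pow_le_pow_left₀ (n := 4) (by norm_num) (by norm_num) ?_
    rw [hf4]
    norm_num
    linarith
  have hB : 2 / (⌈f⁻¹⌉₊ : ℝ) ≤ 2 * f := by
    have h2 : f⁻¹ ≤ (⌈f⁻¹⌉₊ : ℝ) := Nat.le_ceil _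
    rw [div_le_iff₀ ((inv_pos.2 hf0).trans_le h2)]
    have := mul_le_mul_of_nonneg_left h2 hf0.le
    rw [mul_inv_cancel₀ hf0.ne'] at this
    linarith
  have hη : √(z ^ 2 + ε) ≤ z + f ^ 2 := by
    rw [Real.sqrt_le_left (by positivity)]
    have : (z + f ^ 2) ^ 2 = z ^ 2 + f ^ 4 + 2 * (z * f ^ 2) := by ring
    rw [this, hf4]
    have : 0 ≤ z * f ^ 2 := by positivity
    linarith
  have hTf : T ≤ f / 18 := by
    refine le_of_sq_le_sq ?_ (by positivity)
    refine hT.trans ?_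
    have h3 : (2 : ℝ) ^ (-(n / 2 : ℝ)) ≤ f ^ 2 := by
      refine le_of_sq_le_sq ?_ (by positivity)
      rw [← pow_mul, hf4, ← Real.rpow_natCast, ← Real.rpow_mul (by norm_num)]
      rw [show -(n / 2 : ℝ) * (2 : ℕ) = -(n : ℝ) by push_cast; ring, Real.rpow_neg (by norm_num),
        Real.rpow_natCast, inv_le_iff_one_le_mul₀ (by positivity)]
      exact h1
    rw [neg_add, Real.rpow_add (by norm_num), div_pow]
    have h4 : (2 : ℝ) ^ (-9 : ℝ) = 1 / 512 := by
      rw [Real.rpow_neg (by norm_num), show (9 : ℝ) = ((9 : ℕ) : ℝ) by norm_num,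
        Real.rpow_natCast]
      norm_num
    rw [h4]
    have : 0 < f ^ 2 := by positivity
    linarith
  have : f ^ 2 ≤ f / 3 := by nlinarith
  linarith

theorem two_rpow_logb {w : ℝ} (hw : 0 < w) : (2 : ℝ) ^ Real.logb 2 w = w :=
  Real.rpow_logb (by norm_num) (by norm_num) hw

theorem weight_rpow_le {n r : ℕ} {δ : ℝ} (hn : 0 < n) (hrn : r ≤ n) (hδ : 0 ≤ δ) :
    (6 + n * (2 : ℝ) ^ δ) ^ (r / n : ℝ) ≤ (n + 6) * 2 ^ (δ * (r / n)) := by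
  have hn' : (0 : ℝ) < n := by exact_mod_cast hn
  have hrn' : (r / n : ℝ) ≤ 1 := by
    rw [div_le_one hn']; exact_mod_cast hrn
  have h1 : (1 : ℝ) ≤ 2 ^ δ := Real.one_le_rpow (by norm_num) hδ
  have h2 : 6 + n * (2 : ℝ) ^ δ ≤ (n + 6) * 2 ^ δ := by nlinarith
  refine (Real.rpow_le_rpow (by positivity) h2 (by positivity)).trans ?_
  rw [Real.mul_rpow (by positivity) (by positivity), ← Real.rpow_mul (by norm_num)]
  gcongr
  conv_rhs => rw [← Real.rpow_one ((n : ℝ) + 6)]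
  exact Real.rpow_le_rpow_of_exponent_le (by linarith) hrn'

/-- The total loss factor is at most `K ^ (2 n)`. -/
theorem loss_factor_le {n r m a B : ℕ} {ξ L K δ h q : ℝ} (hn : 0 < n) (hr : 0 < r)
    (hrn : r ≤ n) (hL : 0 < L) (hKdef : K = r * L / n) (hK : 20 / 3 ≤ K)
    (hm1 : (m : ℝ) ≤ K) (hm2 : K < m + 1) (hcase : K ≤ 16 ∧ 61 ≤ n ∨ 16 ≤ K ∧ 13 ≤ n)
    (hδ : δ = L / m) (hB : (B : ℝ) ≤ 2 * (119 / 100) ^ n) (ha : (a : ℝ) ≤ n * L + n / 2 + 10)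
    (hq : q = h - 2 * ξ * n * L - Real.logb 2 (6 + n * 2 ^ δ)) :
    a * B * (m + 1) ^ n * ((2 : ℝ) ^ (-(r / n * q - ξ * (δ * m) * r)) *
      (2 ^ (δ * r) * (3 / 2) ^ (n + 2))) * 6
      ≤ 2 ^ (-(r / n * h - 3 * ξ * r * L - 2 * n * Real.logb 2 K)) := by
  have hn' : (0 : ℝ) < n := by exact_mod_cast hn
  have hr' : (1 : ℝ) ≤ r := by exact_mod_cast hr
  have hm0 : (0 : ℝ) < m := by linarith
  have hK0 : 0 < K := by linarith
  have hδ0 : 0 ≤ δ := by rw [hδ]; positivity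
  set w : ℝ := 6 + n * 2 ^ δ with hw
  have hw0 : 0 < w := by positivity
  set Y : ℝ := 2 ^ (-(r / n * h) + 3 * ξ * r * L) with hY
  have hY0 : 0 < Y := by positivity
  -- The loss `3 ξ` consists of `2 ξ` contained in `q` and one `ξ` from the sampler, since `δ * m =
  -- L`.
  have e1 : (2 : ℝ) ^ (-(r / n * q - ξ * (δ * m) * r)) = Y * w ^ (r / n : ℝ) := by
    conv_rhs => rw [← two_rpow_logb hw0]
    rw [hY, ← Real.rpow_mul (by norm_num), ← Real.rpow_add (by norm_num), hq, hδ]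
    congr 1
    field_simp
    ring
  have e2 : (2 : ℝ) ^ (-(r / n * h - 3 * ξ * r * L - 2 * n * Real.logb 2 K)) = Y * K ^ (2 * n) := by
    conv_rhs => rw [← two_rpow_logb hK0]
    rw [hY, ← Real.rpow_natCast, ← Real.rpow_mul (by norm_num), ← Real.rpow_add (by norm_num)]
    congr 1
    push_cast
    ring
  have e3 : δ * (r / n) = K / m := by rw [hδ, hKdef]; field_simp
  have e4 : (2 : ℝ) ^ (δ * r) = (2 ^ (K / m)) ^ n := by
    rw [← Real.rpow_natCast, ← Real.rpow_mul (by norm_num), ← e3]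
    congr 1
    field_simp
  have h5 := weight_rpow_le hn hrn hδ0
  rw [e3, ← hw] at h5
  have h6 : (a : ℝ) ≤ n ^ 2 * K + n / 2 + 10 := by
    refine ha.trans ?_
    have : n * L ≤ n ^ 2 * K := by
      rw [hKdef, show (n : ℝ) ^ 2 * (r * L / n) = r * (n * L) by field_simp]
      exact le_mul_of_one_le_left (by positivity) hr'
    linarith
  rw [e1, e2, e4]
  have h7 := counting_bound hK hm1 hm2 hcase
  set z : ℝ := 2 ^ (K / m) with hz
  calc a * B * (m + 1) ^ n * (Y * w ^ (r / n : ℝ) * (z ^ n * (3 / 2) ^ (n + 2))) * 6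
      ≤ (n ^ 2 * K + n / 2 + 10) * (2 * (119 / 100) ^ n) * (m + 1) ^ n *
        (Y * ((n + 6) * z) * (z ^ n * (3 / 2) ^ (n + 2))) * 6 := by gcongr
    _ = Y * (12 * (119 / 100) ^ n * (n ^ 2 * K + n / 2 + 10) * (n + 6) * (m + 1) ^ n *
        z ^ (n + 1) * (3 / 2) ^ (n + 2)) := by rw [pow_succ z]; ring
    _ ≤ Y * K ^ (2 * n) := by gcongr

theorem exists_sampled_family_of_large {X : Type*} [Fintype X] [DecidableEq X] [Nonempty E]
    (hX : 2 ≤ Fintype.card X) {n r : ℕ} (hn : 0 < n) (hr : 0 < r)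
    {ξ ε : ℝ} {P : Subsets n r → ℝ} (hP : IsSampler n r ξ ε P) (hξ0 : 0 < ξ)
    (hε : ε < 1 / 81) {L K h : ℝ} (hLdef : L = Real.logb 2 (Fintype.card X))
    (hKdef : K = r * L / n) (hK : 20 / 3 ≤ K) (hξ : 3 * ξ * n + r < n)
    (hcase : K ≤ 16 ∧ 61 ≤ n ∨ 16 ≤ K ∧ 13 ≤ n) (hh0 : 0 ≤ h) (hh : h ≤ n * L)
    (ρ : (Fin n → X) → Matrix E E ℂ) (hρ : ∀ x, (ρ x).PosSemidef) (hρ1 : ∑ x, rtr (ρ x) ≤ 1)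
    {σ₀ : Matrix E E ℂ} (hσ : σ₀.PosSemidef) (hσ1 : rtr σ₀ = 1)
    (hρσ : ∀ x, ρ x ≤ ((2 : ℝ) ^ (-h)) • σ₀) :
    ∃ (σ : Matrix E E ℂ) (c : ℝ), σ.PosSemidef ∧ 0 < rtr σ ∧
      c * rtr σ ≤ 2 ^ (-(r / n * h - 3 * ξ * r * L - 2 * n * Real.logb 2 K)) ∧
      ∃ ρ' : Subsets n r → (Fin n → X) → Matrix E E ℂ, (∀ S x, (ρ' S x).PosSemidef) ∧
        (∀ S, ∑ x, rtr (ρ' S x) ≤ 1) ∧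
        (∀ S (y : Fin n → X), ∑ x, (if ∀ i ∈ S.1, x i = y i then ρ' S x else 0) ≤ c • σ) ∧
        ∀ C : Subsets n r → (Fin n → X) → Matrix E E ℂ, (∀ S x, IsContr (C S x)) →
          ∑ S, P S * ∑ x, rtr (C S x * (ρ x - ρ' S x))
            ≤ 2 * 2 ^ (-(ξ * n * L)) + 3 * ε ^ (1 / 4 : ℝ) := by
  have hn' : (0 : ℝ) < n := by exact_mod_cast hn
  have hX0 : (0 : ℝ) < Fintype.card X := by exact_mod_cast (by omega : 0 < Fintype.card X)
  have hL0 : 0 < L := by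
    rw [hLdef]
    exact Real.logb_pos (by norm_num) (by exact_mod_cast hX)
  have h2L : (2 : ℝ) ^ L = Fintype.card X := by rw [hLdef, two_rpow_logb hX0]
  have hrn : r ≤ n := by
    have : (r : ℝ) ≤ n := by nlinarith [mul_pos hξ0 hn']
    exact_mod_cast this
  have h1 := hP.one_le_eps_mul hn hξ0 hξ
  have hε0 : 0 < ε := by
    by_contra hcon
    have : ε * 2 ^ n ≤ 0 := mul_nonpos_of_nonpos_of_nonneg (not_lt.1 hcon) (by positivity)
    linarith
  -- About `K` bins balance the number `(m + 1) ^ n` of bin strings against the rounding loss `2 ^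
  -- (δ r) = 2 ^ (n K / m)`.
  set m := ⌊K⌋₊ with hm
  have hm1 : (m : ℝ) ≤ K := Nat.floor_le (by linarith)
  have hm2 : K < m + 1 := Nat.lt_floor_add_one K
  have hm0 : 0 < m := by
    have : (0 : ℝ) < m := by linarith
    exact_mod_cast this
  have hm0' : (0 : ℝ) < m := by exact_mod_cast hm0
  set δ := L / m with hδ
  have hδ0 : 0 ≤ δ := by positivity
  have hδm : δ * m = L := div_mul_cancel₀ _ hm0'.ne'
  -- Chosen so that the cells with small total weigh at most `(2 ^ (-ξ n L)) ^ 2`, whose square root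
  -- appears in the error.
  set q := h - 2 * ξ * n * L - Real.logb 2 (6 + n * 2 ^ δ) with hq
  -- The term `n * L - h` compensates `|X| ^ n * 2 ^ (-h)`. The rest gives `T ^ 2 ≤ 2 ^ (-n / 2) /
  -- 512 ≤ √ε / 512`, by `ε ≥ 2 ^ (-n)`.
  set a := ⌈n * L - h + n / 2 + 9⌉₊ with ha
  have ha1 : n * L - h + n / 2 + 9 ≤ a := Nat.le_ceil _
  have ha2 : (a : ℝ) ≤ n * L + n / 2 + 10 := by
    have := Nat.ceil_lt_add_one (show (0 : ℝ) ≤ n * L - h + n / 2 + 9 by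
      have : 0 ≤ (n : ℝ) / 2 := by positivity
      linarith)
    linarith
  have ha0 : 0 < a := Nat.ceil_pos.2 (by
    have : 0 ≤ (n : ℝ) / 2 := by positivity
    linarith)
  set B := ⌈(ε ^ (1 / 4 : ℝ))⁻¹⌉₊ with hB
  have hB0 : 0 < B := Nat.ceil_pos.2 (by positivity)
  have hcardX : (Fintype.card (Fin n → X) : ℝ) = 2 ^ (n * L) := by
    rw [Fintype.card_fun, Fintype.card_fin, mul_comm, Real.rpow_mul (by norm_num), h2L,
      Real.rpow_natCast]
    push_cast
    rfl
  have hTT : (Fintype.card (Fin n → X) : ℝ) * (2 : ℝ) ^ (-h) * (1 / 2) ^ a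
      = 2 ^ (n * L - h - a) := by
    rw [hcardX, Real.rpow_sub (by norm_num), Real.rpow_sub (by norm_num),
      Real.rpow_neg (by norm_num), Real.rpow_natCast, one_div, inv_pow]
    rfl
  have hpos : (0 : ℝ) < 2 ^ (n * L - h - a) := by positivity
  obtain ⟨σ, hσp, hσ0, hσ6, ρ', hρ', hρ1', hle, hC⟩ := exists_sampled_family
    (h := h) (q := q) (T := √(2 ^ (n * L - h - a))) (η := (2 ^ (-(ξ * n * L))) ^ 2 + ε)
    hn hr hm0 ha0 hB0 hP hδ0 (by rw [hδm, Real.rpow_neg (by norm_num), h2L,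
      inv_mul_cancel₀ hX0.ne']) ρ hρ hρ1 hσ hσ1 hρσ (Real.sqrt_pos.2 hpos)
    (by rw [Real.sq_sqrt hpos.le, hTT]) (by positivity) (by
      refine add_le_add (le_of_eq ?_) le_rfl
      have hw0 : (0 : ℝ) < 6 + n * 2 ^ δ := by positivity
      conv_lhs => rw [mul_assoc]; arg 2; arg 2; rw [← two_rpow_logb hw0]
      rw [← Real.rpow_add (by norm_num), ← Real.rpow_add (by norm_num), ← Real.rpow_natCast,
        ← Real.rpow_mul (by norm_num), hq]
      congr 1
      push_cast
      ring)
  refine ⟨σ, a * B * (m + 1) ^ n * ((2 : ℝ) ^ (-(r / n * q - ξ * (δ * m) * r)) *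
    (2 ^ (δ * r) * (3 / 2) ^ (n + 2))), hσp, hσ0, ?_, ρ', hρ', hρ1', fun S y => ?_,
    fun C hCC => (hC C hCC).trans ?_⟩
  rotate_left
  · refine le_trans (le_of_eq ?_) (hle S y)
    refine Finset.sum_congr rfl fun x _ => ?_
    congr
  · refine error_terms_le hε0 hε h1 ?_ (by positivity)
    rw [Real.sq_sqrt hpos.le]
    refine Real.rpow_le_rpow_of_exponent_le (by norm_num) ?_
    linarith
  · refine (mul_le_mul_of_nonneg_left hσ6 (by positivity)).trans ?_
    exact loss_factor_le hn hr hrn hL0 hKdef hK hm1 hm2 hcase hδ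
      (ceil_inv_fourth_root_le hε0 h1) ha2 hq

end

/-! ### Trivial regimes and assembly of the bound -/

section

open Matrix

variable {E : Type*} [Fintype E] [DecidableEq E]

/-- The regime of parameters in which the entropy bound is not implied by a trivial one. -/
theorem regime_of_lt {n r ξ L K l h : ℝ} (hn : 0 < n) (hr : 0 < r) (hrn : r ≤ n) (hL : 0 < L)
    (hξ : 0 < ξ) (hl : 0 < l) (hK : K = r * L / n)
    (h0 : 0 < r / n * h - 3 * ξ * r * L - 2 * n * l)
    (h1 : h - (n - r) * L < r / n * h - 3 * ξ * r * L - 2 * n * l) :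
    0 ≤ h ∧ h ≤ n * L ∧ 3 * ξ * n + r + 2 * (l / K) * n < n := by
  have hK0 : 0 < K := by rw [hK]; positivity
  set u := 3 * ξ + 2 * (l / K) with hu
  have hu0 : 0 < u := by positivity
  -- Thus `u` is the total loss in rate. Positivity of the bound gives `h > n L u`, and beating the
  -- counting bound then forces `n u + r < n`.
  have e : 3 * ξ * r * L + 2 * n * l = r * L * u := by
    rw [hu, hK]; field_simp
  have hA : n * L * u < h := by
    have : r * L * u < r / n * h := by linarith
    have h2 := mul_lt_mul_of_pos_left this (div_pos hn hr)
    rw [show n / r * (r * L * u) = n * L * u by field_simp,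
      show n / r * (r / n * h) = h by field_simp] at h2
    exact h2
  have hB : n * (r * L * u) < (n - r) * (n * L - h) := by
    have : h - (n - r) * L < r / n * h - r * L * u := by linarith
    have h2 := mul_lt_mul_of_pos_left this hn
    rw [show n * (r / n * h - r * L * u) = r * h - n * (r * L * u) by field_simp] at h2
    linarith
  have hnLu : 0 < n * L * u := by positivity
  refine ⟨by linarith, ?_, ?_⟩
  · by_contra hcon
    have : (n - r) * (n * L - h) ≤ 0 :=
      mul_nonpos_of_nonneg_of_nonpos (by linarith) (by linarith)
    have : 0 < n * (r * L * u) := by positivity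
    linarith
  · have h3 : (n - r) * (n * L - h) ≤ (n - r) * (n * L - n * L * u) :=
      mul_le_mul_of_nonneg_left (by linarith) (by linarith)
    have h4 : 0 < n * L * (n - r - n * u) := by nlinarith
    have h5 := (pos_iff_pos_of_mul_pos h4).1 (by positivity)
    rw [hu] at h5
    linarith

/-- The smoothing operator `M` need not be classical, but its diagonal blocks satisfy the same
entropy bound and are no farther from `ρ`. What remains is to handle these blocks and add `τ` by the
triangle inequality. -/
theorem le_smoothMinEntropy_sampledState_of_le {X : Type*} [Fintype X] [DecidableEq X]
    (hX : 2 ≤ Fintype.card X) {n r : ℕ} (hr : 0 < r)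
    (ρ : (Fin n → X) → Matrix E E ℂ) (hρ : IsDensity (cqOperator ρ))
    {ξ ε : ℝ} {P : Subsets n r → ℝ} (hP : IsSampler n r ξ ε P)
    {L K τ h : ℝ} (hLdef : L = Real.logb 2 (Fintype.card X)) (hKdef : K = r * L / n)
    (hK : 20 / 3 ≤ K) (hτ : 0 ≤ τ)
    {M : Matrix ((Fin n → X) × E) ((Fin n → X) × E) ℂ} (hM : M.PosSemidef)
    (hM1 : M.trace.re ≤ 1) (hMτ : traceNorm (M - cqOperator ρ) ≤ τ)
    {σ₀ : Matrix E E ℂ} (hσ : IsDensity σ₀)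
    (hle : M ≤ ((2 : ℝ) ^ (-h)) • ((1 : Matrix (Fin n → X) (Fin n → X) ℂ) ⊗ₖ σ₀)) :
    ((r / n * h - 3 * ξ * r * L - 2 * n * Real.logb 2 K : ℝ) : EReal)
      ≤ smoothMinEntropy (2 * (2 : ℝ) ^ (-(ξ * n * L)) + 3 * ε ^ (1 / 4 : ℝ) + τ)
        (sampledState P ρ) := by
  have hPs := hP.mem_stdSimplex
  have hε0 := hP.eps_nonneg
  set ε' := 2 * (2 : ℝ) ^ (-(ξ * n * L)) + 3 * ε ^ (1 / 4 : ℝ) with hε'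
  have hε'0 : 0 ≤ ε' := by positivity
  have hρp : ∀ x, (ρ x).PosSemidef := fun x => by
    rw [← block_cqOperator ρ x]
    exact block_posSemidef hρ.posSemidef x
  have hρ1 : ∑ x, rtr (ρ x) = 1 := by
    rw [← rtr_cqOperator, rtr_apply, hρ.trace_eq_one, Complex.one_re]
  have hσ1 : rtr σ₀ = 1 := by rw [rtr_apply, hσ.trace_eq_one, Complex.one_re]
  have : Nonempty E := by
    by_contra hE
    rw [not_nonempty_iff] at hE
    rw [rtr_apply, Matrix.trace, Finset.univ_eq_empty, Finset.sum_empty] at hσ1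
    simp at hσ1
  have hrn : r ≤ n := by
    have : Nonempty (Subsets n r) := by
      by_contra hE
      rw [not_nonempty_iff] at hE
      have := hPs.2
      simp at this
    obtain ⟨S⟩ := this
    have := Finset.card_le_univ S.1
    rwa [S.2, Fintype.card_fin] at this
  have hn : 0 < n := hr.trans_le hrn
  have hn' : (0 : ℝ) < n := by exact_mod_cast hn
  have hr' : (0 : ℝ) < r := by exact_mod_cast hr
  have hrn' : (r : ℝ) ≤ n := by exact_mod_cast hrn
  have hX0 : (0 : ℝ) < Fintype.card X := by exact_mod_cast (by omega : 0 < Fintype.card X)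
  have hL0 : 0 < L := by
    rw [hLdef]
    exact Real.logb_pos (by norm_num) (by exact_mod_cast hX)
  have h2L : (2 : ℝ) ^ L = Fintype.card X := by rw [hLdef, two_rpow_logb hX0]
  set g := r / n * h - 3 * ξ * r * L - 2 * n * Real.logb 2 K with hg
  set b : (Fin n → X) → Matrix E E ℂ := block M with hb
  have hbp : ∀ x, (b x).PosSemidef := block_posSemidef hM
  have hb1 : ∑ x, rtr (b x) ≤ 1 := by rw [hb, ← rtr_eq_sum_block]; exact hM1
  have hbσ : ∀ x, b x ≤ ((2 : ℝ) ^ (-h)) • σ₀ := fun x => by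
    have := block_mono hle x
    rw [one_kronecker_eq, cqOperator_smul, block_cqOperator] at this
    exact this
  have hbτ : ∀ C : (Fin n → X) → Matrix E E ℂ, (∀ x, IsContr (C x)) →
      ∑ x, rtr (C x * (b x - ρ x)) ≤ τ := fun C hC =>
    (sum_rtr_block_sub_le hC M ρ).trans hMτ
  have hPτ : ∀ C : Subsets n r → (Fin n → X) → Matrix E E ℂ, (∀ S x, IsContr (C S x)) →
      ∑ S, P S * ∑ x, rtr (C S x * (b x - ρ x)) ≤ τ := fun C hC => by
    have h1 : ∑ S, P S * ∑ x, rtr (C S x * (b x - ρ x)) ≤ ∑ S, P S * τ :=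
      Finset.sum_le_sum fun S _ => mul_le_mul_of_nonneg_left (hbτ _ (hC S)) (hPs.1 S)
    rwa [← Finset.sum_mul, hPs.2, one_mul] at h1
  -- With error at least one, the zero operator is admissible and has infinite min-entropy.
  by_cases hbig : 1 ≤ ε'
  · refine le_smoothMinEntropy_sampledState hPs ρ (fun _ _ => 0) (fun _ _ => PosSemidef.zero)
      (fun S => by simp) (fun C hC => ?_) (σ := 1) PosSemidef.one ?_ (c := 0) ?_ (fun S y => ?_)
    · have h1 : ∑ S, P S * ∑ x, rtr (C S x * (0 - ρ x)) ≤ ∑ S, P S * 1 := by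
        refine Finset.sum_le_sum fun S _ => mul_le_mul_of_nonneg_left ?_ (hPs.1 S)
        rw [← hρ1]
        refine Finset.sum_le_sum fun x _ => ?_
        have := (hC S x).neg.rtr_mul_le_rtr (hρp x)
        simpa using this
      rw [← Finset.sum_mul, hPs.2] at h1
      linarith
    · rw [rtr_apply, Matrix.trace_one]
      simp [Fintype.card_pos]
    · rw [zero_mul]; positivity
    · simp
  have hξ0 : 0 < ξ := by
    by_contra hcon
    refine hbig ?_
    have h1 : (1 : ℝ) ≤ 2 ^ (-(ξ * n * L)) := by
      refine Real.one_le_rpow (by norm_num) ?_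
      have : ξ * (n * L) ≤ 0 := mul_nonpos_of_nonpos_of_nonneg (not_lt.1 hcon) (by positivity)
      linarith
    have h2 : 0 ≤ ε ^ (1 / 4 : ℝ) := by positivity
    linarith
  have hε : ε < 1 / 81 := by
    by_contra hcon
    refine hbig ?_
    have h1 : 1 / 3 ≤ ε ^ (1 / 4 : ℝ) := by
      refine le_of_pow_le_pow_left₀ (n := 4) (by norm_num) (by positivity) ?_
      rw [← Real.rpow_natCast (ε ^ (1 / 4 : ℝ)), ← Real.rpow_mul hε0]
      norm_num at hcon ⊢
      exact hcon
    have h2 : (0 : ℝ) < 2 ^ (-(ξ * n * L)) := by positivity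
    linarith
  have trivial_case : ∀ (σ : Matrix E E ℂ) (c : ℝ), σ.PosSemidef → rtr σ = 1 →
      c ≤ 2 ^ (-g) →
      (∀ (S : Subsets n r) (y : Fin n → X),
        ∑ x, (if ∀ i ∈ S.1, x i = y i then b x else 0) ≤ c • σ) →
      (g : EReal) ≤ smoothMinEntropy (ε' + τ) (sampledState P ρ) := by
    intro σ c hσp hσ1 hc hS
    refine le_smoothMinEntropy_sampledState hPs ρ (fun _ => b) (fun _ => hbp) (fun _ => hb1)
      (fun C hC => ?_) hσp (by rw [hσ1]; norm_num) (c := c) (by rwa [hσ1, mul_one]) hS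
    exact (hPτ C hC).trans (by linarith)
  by_cases hg0 : g ≤ 0
  -- The marginal on `E`, completed to trace one, shows nonnegative entropy of a classical register.
  · refine trivial_case (∑ x, b x + (1 - ∑ x, rtr (b x)) • σ₀) 1 ?_ ?_
      (Real.one_le_rpow (by norm_num) (by linarith)) (fun S y => ?_)
    · exact (posSemidef_sum _ fun x _ => hbp x).add
        (smul_posSemidef hσ.posSemidef (by linarith))
    · rw [map_add, map_sum, map_smul, hσ1, smul_eq_mul]
      ring
    · rw [one_smul]
      have h1 : ∑ x, (if ∀ i ∈ S.1, x i = y i then b x else 0) ≤ ∑ x, b x :=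
        Finset.sum_le_sum fun x _ => by
          split_ifs
          · exact le_rfl
          · exact (hbp x).nonneg
      exact h1.trans (le_add_of_nonneg_right
        (smul_posSemidef hσ.posSemidef (by linarith)).nonneg)
  by_cases hg1 : g ≤ h - (n - r) * L
  -- Exactly `|X| ^ (n - r)` strings agree with `y` on `S`, and each contributes at most `2 ^ (-h) •
  -- σ₀`.
  · refine trivial_case σ₀ ((Fintype.card X : ℝ) ^ (n - r) * 2 ^ (-h)) hσ.posSemidef hσ1 ?_
      (fun S y => ?_)
    · rw [← h2L, ← Real.rpow_natCast, ← Real.rpow_mul (by norm_num),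
        ← Real.rpow_add (by norm_num), Nat.cast_sub hrn]
      refine Real.rpow_le_rpow_of_exponent_le (by norm_num) ?_
      linarith
    · rw [← Finset.sum_filter]
      refine (Finset.sum_le_sum fun x _ => hbσ x).trans (le_of_eq ?_)
      rw [Finset.sum_const, card_agree, ← Nat.cast_smul_eq_nsmul ℝ, smul_smul]
      push_cast
      rfl
  have hlog : 0 < Real.logb 2 K := Real.logb_pos (by norm_num) (by linarith)
  obtain ⟨hh0, hh, hreg⟩ := regime_of_lt hn' hr' hrn' hL0 hξ0 hlog hKdef
    (not_le.1 hg0) (not_le.1 hg1)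
  have hK0 : 0 < K := by linarith
  have hreg' : 3 * ξ * n + r < n := by
    have : 0 ≤ 2 * (Real.logb 2 K / K) * n := by positivity
    linarith
  have hcase : K ≤ 16 ∧ 61 ≤ n ∨ 16 ≤ K ∧ 13 ≤ n := by
    rcases le_total K 16 with hK16 | hK16
    · refine Or.inl ⟨hK16, hP.sixty_lt hn hε hξ0 ?_⟩
      -- For `K ≤ 16` this sharpens the regime to `3 ξ n + r + n / 2 < n`, which is the hypothesis
      -- of `IsSampler.sixty_lt`.
      have h1 : 1 / 4 ≤ Real.logb 2 K / K := by
        rw [le_div_iff₀ hK0]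
        have := quarter_le_logb (by linarith) hK16
        linarith
      have h2 := mul_le_mul_of_nonneg_right h1 hn'.le
      linarith
    · exact Or.inr ⟨hK16, hP.twelve_lt hn hε hξ0 hreg'⟩
  obtain ⟨σ, c, hσp, hσ0, hc, ρ', hρ', hρ1', hle', hC'⟩ := exists_sampled_family_of_large hX hn hr
    hP hξ0 hε hLdef hKdef hK hreg' hcase hh0 hh b hbp hb1 hσ.posSemidef hσ1 hbσ
  refine le_smoothMinEntropy_sampledState hPs ρ ρ' hρ' hρ1' (fun C hC => ?_) hσp hσ0 hc hle'
  have h1 := hC' (fun S x => -C S x) (fun S x => (hC S x).neg)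
  have h2 := hPτ C hC
  refine le_trans (le_of_eq ?_) (add_le_add h1 h2)
  rw [← Finset.sum_add_distrib]
  refine Finset.sum_congr rfl fun S _ => ?_
  rw [← mul_add, ← Finset.sum_add_distrib]
  congr 1
  refine Finset.sum_congr rfl fun x _ => ?_
  rw [← map_add]
  congr 1
  simp only [Matrix.neg_mul, Matrix.mul_sub]
  abel

theorem coe_le_mul_div_add {t : EReal} {x a b c : ℝ} (ha : 0 < a) (hb : 0 < b)
    (h : ((b * (x / a - c) : ℝ) : EReal) ≤ t) :
    (x : EReal) ≤ (a : EReal) * (t / (b : EReal) + (c : EReal)) := by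
  induction t with
  | bot => exact absurd h (not_le.2 (EReal.bot_lt_coe _))
  | top =>
    rw [EReal.top_div_of_pos_ne_top (by exact_mod_cast hb) (EReal.coe_ne_top _),
      EReal.top_add_coe, EReal.coe_mul_top_of_pos ha]
    exact le_top
  | coe t =>
    have h' : b * (x / a - c) ≤ t := by exact_mod_cast h
    rw [← EReal.coe_div, ← EReal.coe_add, ← EReal.coe_mul]
    refine EReal.coe_le_coe_iff.2 ?_
    have h1 : x / a - c ≤ t / b := by rwa [le_div_iff₀ hb, mul_comm]
    have h2 : x / a ≤ t / b + c := by linarith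
    rwa [div_le_iff₀ ha, mul_comm] at h2

theorem logb_card_fun {X : Type*} [Fintype X] (k : ℕ) :
    Real.logb 2 (Fintype.card (Fin k → X)) = k * Real.logb 2 (Fintype.card X) := by
  rw [Fintype.card_fun, Fintype.card_fin, Nat.cast_pow, Real.logb_pow]

end

end QSampling

end

open QSampling in
theorem corollary5p14 {X E : Type*} [Fintype X] [DecidableEq X] [Fintype E] [DecidableEq E]
    (hX : 2 ≤ Fintype.card X) (n r : ℕ) (hr : 0 < r)
    (ρ : (Fin n → X) → Matrix E E ℂ) (hρ : IsDensity (cqOperator ρ))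
    (ξ ε : ℝ) (P : Subsets n r → ℝ) (hP : IsSampler n r ξ ε P)
    (κ : ℝ) (hκ_def : κ = n / (r * Real.logb 2 (Fintype.card X))) (hκ : κ ≤ 0.15)
    (ε' : ℝ) (hε' : ε' = 2 * (2 : ℝ) ^ (-(ξ * n * Real.logb 2 (Fintype.card X)))
      + 3 * ε ^ (1 / 4 : ℝ))
    (τ : ℝ) (hτ : 0 ≤ τ) :
    smoothMinEntropyRate τ (cqOperator ρ)
        - ((3 * ξ + 2 * κ * Real.logb 2 (1 / κ) : ℝ) : EReal)
      ≤ smoothMinEntropyRate (ε' + τ) (sampledState P ρ) := by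
  have hrn : 0 < n := by
    rcases Nat.eq_zero_or_pos n with rfl | hn
    · have h1 := hP.mem_stdSimplex.2
      have : IsEmpty (Subsets 0 r) := ⟨fun S => by
        have h2 := Finset.card_le_univ S.1
        rw [S.2, Fintype.card_fin] at h2
        omega⟩
      simp at h1
    · exact hn
  have hn : (0 : ℝ) < n := by exact_mod_cast hrn
  have hr' : (0 : ℝ) < r := by exact_mod_cast hr
  obtain ⟨L, hL⟩ : ∃ L, L = Real.logb 2 (Fintype.card X) := ⟨_, rfl⟩
  have hL0 : 0 < L := by
    rw [hL]
    exact Real.logb_pos (by norm_num) (by exact_mod_cast hX)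
  rw [← hL] at hκ_def hε'
  have hκ0 : 0 < κ := by rw [hκ_def]; positivity
  have hK : 1 / κ = r * L / n := by rw [hκ_def, one_div_div]
  have hK1 : 20 / 3 ≤ 1 / κ := by
    rw [le_div_iff₀ hκ0]
    linarith
  rw [smoothMinEntropyRate, smoothMinEntropyRate, logb_card_fun, logb_card_fun, ← hL,
    EReal.sub_le_iff_le_add (Or.inl (EReal.coe_ne_bot _)) (Or.inl (EReal.coe_ne_top _)),
    EReal.div_le_iff_le_mul (by exact_mod_cast mul_pos hn hL0) (EReal.coe_ne_top _)]
  refine iSup₂_le fun M hM => iSup₂_le fun σ hσ => iSup₂_le fun h hh => ?_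
  refine coe_le_mul_div_add (mul_pos hn hL0) (mul_pos hr' hL0) ?_
  have key := le_smoothMinEntropy_sampledState_of_le hX hr ρ hρ hP hL hK hK1 hτ hM.1 hM.2.1 hM.2.2
    hσ hh
  rw [← hε'] at key
  refine le_trans (le_of_eq ?_) key
  congr 1
  have e1 : r * L * κ = n := by rw [hκ_def]; field_simp
  have e2 : r * L * (h / (n * L)) = r / n * h := by field_simp
  linear_combination e2 - 2 * Real.logb 2 (1 / κ) * e1
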